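/- Consider the word RAM with $w$-bit words, in which loading a word from a read-only memory, comparing two words with a jump, and the unsigned word operations (addition, subtraction, multiplication, division and remainder, bitwise operations, shifts) each take one unit of time. The word size is $w=\Theta(\log m)$: writing $\ell(m)=\lfloor\log_2 m\rfloor+1$, we have $\ell(m)\le w\le K\,\ell(m)$ for a fixed integer $K$. For a bitstring $S$ of length $m$ with $n\ge 1$ ones, put $B(n,m)=\lceil\log_2\binom mn\rceil$. For $b\in\{0,1\}$ let $\mathrm{rank}_b(S,i)$, $0\le i\le m$, be the number of occurrences of $b$ among the first $i$ bits of $S$, and let $\mathrm{select}_b(S,i)$ be the position in $\{1,\dots,m\}$ of the $i$-th occurrence of $b$ in $S$, for $1\le i\le\mathrm{rank}_b(S,m)$. A fully indexable dictionary (FID) for $S$ is a memory content from which fixed programs, given only the argument $i$, answer all these queries. There is an absolute constant $C>0$ such that for every $K$ and every real $\varepsilon>0$ there are four programs (for $\mathrm{rank}_0,\mathrm{rank}_1,\mathrm{select}_0,\mathrm{select}_1$) and a constant $C'$, depending only on $\varepsilon$ and $K$, with the following property. For all $m$, all $1\le n\le m$, every word size $w$ with $\ell(m)\le w\le K\,\ell(m)$,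 and every bitstring $S$ of length $m$ with $n$ ones, there is a memory content of $w$-bit words, occupying in total at most $$B(n,m)+C'\,n\left(\frac mn\right)^{\varepsilon}$$ bits, from which the four programs answer every rank and select query on $S$ in time at most $C\max\{1,\log(1/\varepsilon)\}$. That is, there is a FID using $B(n,m)+O(n(m/n)^{\varepsilon})$ bits that supports all operations in $O(\log(1/\varepsilon))$ time. -/

import Mathlib

/-! ## The word RAM

A program is a finite list of instructions.  It works on registers holding `w`-bit words and
on a read-only memory of `w`-bit words that holds the data structure.  Every instruction costs
one unit of time.  One program serves all word sizes, all memories and all inputs. -/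

/-- Binary operations on words; arithmetic is unsigned, modulo `2 ^ w`. -/
inductive WordOp where
  | add | sub | mul | div | mod | and | or | xor | shl | shr

/-- `shl` and `shr` fill with zeros; division by zero follows the `BitVec` convention. -/
def WordOp.eval {w : ℕ} (o : WordOp) (x y : BitVec w) : BitVec w :=
  match o with
  | .add => x + y
  | .sub => x - y
  | .mul => x * y
  | .div => x / y
  | .mod => x % y
  | .and => x &&& y
  | .or => x ||| y
  | .xor => x ^^^ y
  | .shl => x <<< y.toNat
  | .shr => x >>> y.toNat

/-- Instructions; `d`, `a`, `b` name registers and `l` is an index into the program. -/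
inductive Instr where
  /-- `r_d := c` (modulo `2 ^ w`), then go on -/
  | const (d c : ℕ)
  /-- `r_d := r_a o r_b`, then go on -/
  | arith (o : WordOp) (d a b : ℕ)
  /-- `r_d := memory[r_a]`, then go on -/
  | load (d a : ℕ)
  /-- go to instruction `l` -/
  | jump (l : ℕ)
  /-- go to instruction `l` if `r_a < r_b` (unsigned), otherwise go on -/
  | jumpLT (a b l : ℕ)
  /-- go to instruction `l` if `r_a = r_b`, otherwise go on -/
  | jumpEQ (a b l : ℕ)
  /-- stop; the output is the content of register `0` -/
  | halt

/-- A program: a finite list of instructions, started at index `0`. -/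
abbrev Program := List Instr

/-- A configuration: program counter and registers. -/
structure Config (w : ℕ) where
  pc : ℕ
  reg : ℕ → BitVec w

/-- Write `v` to register `d` and move to the next instruction. -/
def Config.write {w : ℕ} (c : Config w) (d : ℕ) (v : BitVec w) : Config w :=
  ⟨c.pc + 1, Function.update c.reg d v⟩

/-- The effect of a single instruction that does not stop the program.  `none` is a fault: a
read outside the memory (`halt` is treated in `Program.run`). -/
def Instr.step {w : ℕ} (M : List (BitVec w)) (c : Config w) : Instr → Option (Config w)
  | .const d k => some (c.write d (BitVec.ofNat w k))
  | .arith o d a b => some (c.write d (o.eval (c.reg a) (c.reg b)))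
  | .load d a => (M[(c.reg a).toNat]?).map (fun v => c.write d v)
  | .jump l => some ⟨l, c.reg⟩
  | .jumpLT a b l => some ⟨if (c.reg a).toNat < (c.reg b).toNat then l else c.pc + 1, c.reg⟩
  | .jumpEQ a b l => some ⟨if c.reg a = c.reg b then l else c.pc + 1, c.reg⟩
  | .halt => none

/-- The output of the program from configuration `c`, provided that it stops without a fault
after at most `t` instructions (the final `halt` included), and `none` otherwise. -/
def Program.run {w : ℕ} (P : Program) (M : List (BitVec w)) : ℕ → Config w → Option (BitVec w)
  | 0, _ => none
  | t + 1, c =>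
    match P[c.pc]? with
    | none => none
    | some .halt => some (c.reg 0)
    | some i => (i.step M c).bind (fun c' => Program.run P M t c')

/-- The initial configuration: the input is in register `0`, all other registers are zero. -/
def Config.init (w x : ℕ) : Config w :=
  ⟨0, fun r => if r = 0 then BitVec.ofNat w x else 0⟩

/-- With memory `M` and input `x`, the program `P` outputs the number `y` in time at most `t`. -/
def Program.Answers {w : ℕ} (P : Program) (M : List (BitVec w)) (t x y : ℕ) : Prop :=
  ∃ v : BitVec w, P.run M t (Config.init w x) = some v ∧ v.toNat = y

/-! ## Bitstrings, rank and select

A bitstring of length `m` is a map `S : Fin m → Bool`.  Positions are counted from `1` to `m`,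
so the bit at position `p` is `S ⟨p - 1, _⟩`. -/

/-- The number of occurrences of the bit `b` in the prefix of `S` of length `i`. -/
def bitRank {m : ℕ} (b : Bool) (S : Fin m → Bool) (i : ℕ) : ℕ :=
  (Finset.univ.filter (fun j : Fin m => (j : ℕ) < i ∧ S j = b)).card

/-- The position of the `i`-th occurrence of the bit `b` in `S`, which is the least position
whose prefix contains `i` occurrences (meaningful when `1 ≤ i` and `S` has at least `i`
occurrences of `b`). -/
noncomputable def bitSelect {m : ℕ} (b : Bool) (S : Fin m → Bool) (i : ℕ) : ℕ :=
  sInf {p : ℕ | bitRank b S p = i}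

/-- The number of ones of `S`. -/
def numOnes {m : ℕ} (S : Fin m → Bool) : ℕ :=
  (Finset.univ.filter (fun j : Fin m => S j = true)).card

/-- `B(n, m) = ⌈log₂ (m choose n)⌉`. -/
def infoBound (n m : ℕ) : ℕ := Nat.clog 2 (m.choose n)

/-! ## Fully indexable dictionaries -/

/-- The query programs: one for each of `rank_0`, `rank_1`, `select_0`, `select_1`. -/
structure FIDPrograms where
  rank : Bool → Program
  select : Bool → Program

/-- The memory `M` represents `S` as a fully indexable dictionary: the given programs, which see
`M` and the query argument only, answer every rank and select query on `S` in time at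
most `t`. -/
structure IsFID {w m : ℕ} (A : FIDPrograms) (M : List (BitVec w)) (S : Fin m → Bool) (t : ℕ) :
    Prop where
  rank_answers : ∀ (b : Bool) (i : ℕ), i ≤ m →
    (A.rank b).Answers M t i (bitRank b S i)
  select_answers : ∀ (b : Bool) (i : ℕ), 1 ≤ i → i ≤ bitRank b S m →
    (A.select b).Answers M t i (bitSelect b S i)

/-- The number of bits occupied by a memory of `w`-bit words. -/
def spaceBits {w : ℕ} (M : List (BitVec w)) : ℕ := w * M.length

/-! The redundancy `n (m/n)^ε` already dominates the information bound: `B(n,m)` is at most about `n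
log₂(e m/n)`, which is `O(n (m/n)^ε)` for fixed `ε`. No succinct encoding is needed, and `infoBound`
is dropped at the end; everything has to fit into `O(n (m/n)^ε)` bits.

All four queries reduce to monotone functions. `select_1` is a monotone array of `n + 1` entries
bounded by `m`. `rank_0(i) = i - rank_1(i)`, and `select_0(i) = i + onesBefore(i)`
(`bitSelect_false`). Both `rank_1` and `onesBefore` are monotone with values at most `n`, hence step
functions with at most `n` jumps.

Monotone arrays (`ev_access`, `length_monoArray_le`) have constant access time. Entries are grouped
in blocks of `β`, and each is split into block start, upper part and lower part. The upper parts of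
a block form a monotone map of `{0, …, β-1}` to itself; there are at most `4^β` of these, all
tabulated once. The lower parts are packed into words. With `β` proportional to `ε log m`, the table
has size a small power of `m`, while `w = O(β)` makes the per-word overhead constant per entry.

A step function (`exists_structured`) is evaluated by counting the jumps below the argument and
looking up the value reached. Put `D = 2^e`, about `1/ε`, and cut the arguments into windows of
length `2^(D h)`. A monotone array counts the jumps before each window. The jumps in a window form a
trie of depth `D` and degree `2^h`; binary search over the levels finds the longest prefix present
in `e = O(log(1/ε))` rounds (`ev_search`), each a perfect hash lookup (`exists_dictionary`), and the
node found stores the counts of elements below its children. Taking `h = log(m/n)/(D+8)` balances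
the number of windows, `O(n 2^(8h))`, against the trie cells, `n 2^(4h)`; both are within the budget
since `2^(8h) ≤ (m/n)^ε` if `ε ≤ 1`; larger `ε` are treated with exponent `1`.

If `m/n` is bounded, the step function is stored as a monotone array instead. Words of bounded size,
where asymptotic estimates give no control over the address space, are treated separately
(`isFID_bitWords`, `direct_space_le`).

Programs are written as loop-free terms. Compiled code only jumps forward, so the running time is at
most the code length, which depends on `e` alone once the threshold `t` for short words is fixed. -/

namespace WordRAM

/-! ## Segments of lists -/

/-- The list `l` occurs in `L` at index `a`. -/
def Seg {α : Type*} (L : List α) (a : ℕ) (l : List α) : Prop :=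
  ∀ i v, l[i]? = some v → L[a + i]? = some v

theorem Seg.refl {α : Type*} (L : List α) : Seg L 0 L := by
  intro i v h; simpa using h

theorem Seg.left {α : Type*} {L l₁ l₂ : List α} {a : ℕ} (h : Seg L a (l₁ ++ l₂)) : Seg L a l₁ := by
  intro i v hv
  obtain ⟨hi, -⟩ := List.getElem?_eq_some_iff.1 hv
  exact h i v (by rw [List.getElem?_append_left hi]; exact hv)

theorem Seg.right {α : Type*} {L l₁ l₂ : List α} {a : ℕ} (h : Seg L a (l₁ ++ l₂)) :
    Seg L (a + l₁.length) l₂ := by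
  intro i v hv
  rw [add_assoc]
  exact h _ v (by rw [List.getElem?_append_right (by omega)]; simpa using hv)

theorem Seg.trans {α : Type*} {L l k : List α} {a b : ℕ} (h : Seg L a l) (h' : Seg l b k) :
    Seg L (a + b) k := by
  intro i v hv
  rw [add_assoc]
  exact h _ v (h' i v hv)

theorem Seg.head {α : Type*} {L l : List α} {x : α} {a : ℕ} (h : Seg L a (x :: l)) :
    L[a]? = some x := by
  simpa using h 0 x rfl

theorem Seg.tail {α : Type*} {L l : List α} {x : α} {a : ℕ} (h : Seg L a (x :: l)) :
    Seg L (a + 1) l := Seg.right (l₁ := [x]) h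

theorem Seg.le_length {α : Type*} {L l : List α} {a : ℕ} (h : Seg L a l) (hl : l ≠ []) :
    a + l.length ≤ L.length := by
  have hp : 0 < l.length := List.length_pos_iff.2 hl
  have := h (l.length - 1) (l[l.length - 1]) (List.getElem?_eq_getElem _)
  obtain ⟨hi, -⟩ := List.getElem?_eq_some_iff.1 this
  omega

theorem Seg.append_left {α : Type*} (l₁ l₂ : List α) : Seg (l₁ ++ l₂) 0 l₁ :=
  (Seg.refl (l₁ ++ l₂)).left

theorem Seg.append_right {α : Type*} (l₁ l₂ : List α) : Seg (l₁ ++ l₂) l₁.length l₂ := by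
  simpa using (Seg.refl (l₁ ++ l₂)).right

theorem Seg.map {α β : Type*} {L l : List α} {a : ℕ} (f : α → β) (h : Seg L a l) :
    Seg (L.map f) a (l.map f) := by
  intro i v hv
  rw [List.getElem?_map] at hv ⊢
  cases hl : l[i]? with
  | none => simp [hl] at hv
  | some y => rw [h i y hl]; simpa [hl] using hv

/-- The `r`-th piece of a flattened family starts after the pieces before it. -/
theorem seg_flatten {α : Type*} (F : ℕ → List α) (N r : ℕ) (hr : r < N) :
    Seg ((List.range N).map F).flatten (∑ i ∈ Finset.range r, (F i).length) (F r) := by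
  induction N with
  | zero => omega
  | succ N ih =>
    have hlen : ((List.range N).map F).flatten.length = ∑ i ∈ Finset.range N, (F i).length := by
      clear ih hr
      induction N with
      | zero => simp
      | succ N ih => rw [List.range_succ, Finset.sum_range_succ]; simp [← ih]
    rw [List.range_succ, List.map_append, List.flatten_append]
    rcases Nat.lt_succ_iff_lt_or_eq.1 hr with h | rfl
    · simpa using (Seg.append_left _ _).trans (ih h)
    · simpa [hlen] using Seg.append_right ((List.range r).map F).flatten (F r)

theorem length_flatten_map_range {α : Type*} (F : ℕ → List α) (N : ℕ) :
    ((List.range N).map F).flatten.length = ∑ i ∈ Finset.range N, (F i).length := by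
  induction N with
  | zero => simp
  | succ N ih => rw [List.range_succ, Finset.sum_range_succ]; simp [← ih]

/-! ## A term language compiled to the word RAM -/

/-- Loop-free terms with sharing, in parametric higher-order abstract syntax. -/
inductive Tm (V : Type) where
  | var (x : V)
  | cst (c : ℕ)
  | op (o : WordOp) (a b : Tm V)
  | ld (a : Tm V)
  | bind (a : Tm V) (f : V → Tm V)
  | ifLT (a b t e : Tm V)
  | ifEQ (a b t e : Tm V)

/-- Code for a term, placed at index `pc`; the value goes to register `d` and only registers from
`d` on are changed. -/
def Tm.compile : Tm ℕ → ℕ → ℕ → List Instr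
  | .var r, _, d => [.arith .or d r r]
  | .cst c, _, d => [.const d c]
  | .op o a b, pc, d =>
    let A := a.compile pc d
    let B := b.compile (pc + A.length) (d + 1)
    A ++ (B ++ [.arith o d d (d + 1)])
  | .ld a, pc, d => a.compile pc d ++ [.load d d]
  | .bind a f, pc, d =>
    let A := a.compile pc d
    A ++ ((f d).compile (pc + A.length) (d + 1) ++ [.arith .or d (d + 1) (d + 1)])
  | .ifLT a b t e, pc, d =>
    let A := a.compile pc d
    let B := b.compile (pc + A.length) (d + 1)
    let E := e.compile (pc + A.length + B.length + 1) d
    let T := t.compile (pc + A.length + B.length + 1 + E.length + 1) d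
    A ++ (B ++ (.jumpLT d (d + 1) (pc + A.length + B.length + 1 + E.length + 1) ::
      (E ++ (.jump (pc + A.length + B.length + 1 + E.length + 1 + T.length) :: T))))
  | .ifEQ a b t e, pc, d =>
    let A := a.compile pc d
    let B := b.compile (pc + A.length) (d + 1)
    let E := e.compile (pc + A.length + B.length + 1) d
    let T := t.compile (pc + A.length + B.length + 1 + E.length + 1) d
    A ++ (B ++ (.jumpEQ d (d + 1) (pc + A.length + B.length + 1 + E.length + 1) ::
      (E ++ (.jump (pc + A.length + B.length + 1 + E.length + 1 + T.length) :: T))))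

/-- The length of the code of a term. -/
def Tm.cost : Tm ℕ → ℕ → ℕ
  | .var _, _ => 1
  | .cst _, _ => 1
  | .op _ a b, d => a.cost d + b.cost (d + 1) + 1
  | .ld a, d => a.cost d + 1
  | .bind a f, d => a.cost d + (f d).cost (d + 1) + 1
  | .ifLT a b t e, d => a.cost d + b.cost (d + 1) + t.cost d + e.cost d + 2
  | .ifEQ a b t e, d => a.cost d + b.cost (d + 1) + t.cost d + e.cost d + 2

theorem Tm.length_compile (t : Tm ℕ) : ∀ pc d, (t.compile pc d).length = t.cost d := by
  induction t with
  | var | cst => intros; rfl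
  | op o a b iha ihb => intro pc d; simp [compile, cost, iha, ihb]; omega
  | ld a iha => intro pc d; simp [compile, cost, iha]
  | bind a f iha ihf => intro pc d; simp [compile, cost, iha, ihf]; omega
  | ifLT a b t e iha ihb iht ihe =>
    intro pc d; simp [compile, cost, iha, ihb, iht, ihe]; omega
  | ifEQ a b t e iha ihb iht ihe =>
    intro pc d; simp [compile, cost, iha, ihb, iht, ihe]; omega

/-- Evaluation of a term whose variables hold numbers below `2 ^ w`. -/
inductive Ev {w : ℕ} (M : List (BitVec w)) : Tm ℕ → ℕ → Prop
  | var (x : ℕ) : Ev M (.var x) x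
  | cst (c : ℕ) : Ev M (.cst c) (c % 2 ^ w)
  | op {o : WordOp} {a b : Tm ℕ} {x y : ℕ} : Ev M a x → Ev M b y →
      Ev M (.op o a b) (o.eval (BitVec.ofNat w x) (BitVec.ofNat w y)).toNat
  | ld {a : Tm ℕ} {x : ℕ} {v : BitVec w} : Ev M a x → M[x]? = some v → Ev M (.ld a) v.toNat
  | bind {a : Tm ℕ} {f : ℕ → Tm ℕ} {x y : ℕ} : Ev M a x → Ev M (f x) y → Ev M (.bind a f) y
  | ifLT_true {a b t e : Tm ℕ} {x y v : ℕ} : Ev M a x → Ev M b y → x < y → Ev M t v →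
      Ev M (.ifLT a b t e) v
  | ifLT_false {a b t e : Tm ℕ} {x y v : ℕ} : Ev M a x → Ev M b y → ¬ x < y → Ev M e v →
      Ev M (.ifLT a b t e) v
  | ifEQ_true {a b t e : Tm ℕ} {x y v : ℕ} : Ev M a x → Ev M b y → x = y → Ev M t v →
      Ev M (.ifEQ a b t e) v
  | ifEQ_false {a b t e : Tm ℕ} {x y v : ℕ} : Ev M a x → Ev M b y → x ≠ y → Ev M e v →
      Ev M (.ifEQ a b t e) v

/-- Two instances of the same parametric term; `Γ` relates their free variables. -/
inductive WF : Set (ℕ × ℕ) → Tm ℕ → Tm ℕ → Prop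
  | var {Γ : Set (ℕ × ℕ)} {r x : ℕ} : (r, x) ∈ Γ → WF Γ (.var r) (.var x)
  | cst {Γ : Set (ℕ × ℕ)} {c : ℕ} : WF Γ (.cst c) (.cst c)
  | op {Γ : Set (ℕ × ℕ)} {o : WordOp} {a b a' b' : Tm ℕ} : WF Γ a a' → WF Γ b b' →
      WF Γ (.op o a b) (.op o a' b')
  | ld {Γ : Set (ℕ × ℕ)} {a a' : Tm ℕ} : WF Γ a a' → WF Γ (.ld a) (.ld a')
  | bind {Γ : Set (ℕ × ℕ)} {a a' : Tm ℕ} {f f' : ℕ → Tm ℕ} : WF Γ a a' →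
      (∀ r x, WF (insert (r, x) Γ) (f r) (f' x)) → WF Γ (.bind a f) (.bind a' f')
  | ifLT {Γ : Set (ℕ × ℕ)} {a b t e a' b' t' e' : Tm ℕ} : WF Γ a a' → WF Γ b b' → WF Γ t t' →
      WF Γ e e' → WF Γ (.ifLT a b t e) (.ifLT a' b' t' e')
  | ifEQ {Γ : Set (ℕ × ℕ)} {a b t e a' b' t' e' : Tm ℕ} : WF Γ a a' → WF Γ b b' → WF Γ t t' →
      WF Γ e e' → WF Γ (.ifEQ a b t e) (.ifEQ a' b' t' e')

theorem WF.mono {Γ Δ : Set (ℕ × ℕ)} {t t' : Tm ℕ} (h : WF Γ t t') (hs : Γ ⊆ Δ) : WF Δ t t' := by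
  induction h generalizing Δ with
  | var h => exact .var (hs h)
  | cst => exact .cst
  | op _ _ iha ihb => exact .op (iha hs) (ihb hs)
  | ld _ ih => exact .ld (ih hs)
  | bind _ _ iha ihf => exact .bind (iha hs) fun r x => ihf r x (Set.insert_subset_insert hs)
  | ifLT _ _ _ _ h1 h2 h3 h4 => exact .ifLT (h1 hs) (h2 hs) (h3 hs) (h4 hs)
  | ifEQ _ _ _ _ h1 h2 h3 h4 => exact .ifEQ (h1 hs) (h2 hs) (h3 hs) (h4 hs)

theorem WF.weaken {Γ : Set (ℕ × ℕ)} {t t' : Tm ℕ} {p : ℕ × ℕ} (h : WF Γ t t') :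
    WF (insert p Γ) t t' := h.mono (Set.subset_insert _ _)

/-- From `c` the program reaches `c'` in `k` steps. -/
def Reach {w : ℕ} (P : Program) (M : List (BitVec w)) (c c' : Config w) (k : ℕ) : Prop :=
  ∀ t, P.run M (t + k) c = P.run M t c'

theorem Reach.trans {w : ℕ} {P : Program} {M : List (BitVec w)} {c₁ c₂ c₃ : Config w} {k l : ℕ}
    (h : Reach P M c₁ c₂ k) (h' : Reach P M c₂ c₃ l) : Reach P M c₁ c₃ (k + l) := by
  intro t
  rw [show t + (k + l) = (t + l) + k by omega, h, h']

theorem Reach.step {w : ℕ} {P : Program} {M : List (BitVec w)} {c c' : Config w} {i : Instr}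
    (h : P[c.pc]? = some i) (hs : i.step M c = some c') : Reach P M c c' 1 := by
  intro t
  rw [Program.run, h]
  cases i with
  | halt => simp [Instr.step] at hs
  | _ => simp [hs]

/-- The outcome of running the code of a term. -/
def Computes {w : ℕ} (P : Program) (M : List (BitVec w)) (code : List Instr) (pc d : ℕ)
    (ρ : ℕ → BitVec w) (v : ℕ) : Prop :=
  ∃ ρ' k, k ≤ code.length ∧ Reach P M ⟨pc, ρ⟩ ⟨pc + code.length, ρ'⟩ k ∧
    (∀ r < d, ρ' r = ρ r) ∧ (ρ' d).toNat = v

theorem Computes.single {w : ℕ} {P : Program} {M : List (BitVec w)} {i : Instr} {pc d : ℕ}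
    {ρ : ℕ → BitVec w} {x : BitVec w} (h : P[pc]? = some i)
    (hs : i.step M ⟨pc, ρ⟩ = some ((⟨pc, ρ⟩ : Config w).write d x)) :
    Computes P M [i] pc d ρ x.toNat := by
  refine ⟨Function.update ρ d x, 1, le_rfl, Reach.step h hs, ?_, by simp⟩
  intro r hr
  simp [Function.update_of_ne hr.ne]

/-- Values of variables agree with the registers below `d`. -/
def EnvOK {w : ℕ} (Γ : Set (ℕ × ℕ)) (d : ℕ) (ρ : ℕ → BitVec w) : Prop :=
  ∀ p ∈ Γ, p.1 < d ∧ (ρ p.1).toNat = p.2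

theorem EnvOK.congr {w : ℕ} {Γ : Set (ℕ × ℕ)} {d d' : ℕ} {ρ ρ' : ℕ → BitVec w}
    (h : EnvOK Γ d ρ) (hd : d ≤ d') (hr : ∀ r < d, ρ' r = ρ r) : EnvOK Γ d' ρ' := by
  intro p hp
  obtain ⟨h1, h2⟩ := h p hp
  exact ⟨h1.trans_le hd, by rw [hr _ h1, h2]⟩

theorem ofNat_of_toNat {w x : ℕ} {b : BitVec w} (h : b.toNat = x) : BitVec.ofNat w x = b := by
  subst h; simp

/-- Induction on `WF`, the logical relation between the instance whose variables are register
numbers and the one whose variables are values. All jumps go forward, so no instruction runs twice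
and the code length bounds the time. A subterm writes only to registers from its `d` on, which lie
above all registers holding variables. -/
theorem computes_of_ev {w : ℕ} {M : List (BitVec w)} {P : Program} {Γ : Set (ℕ × ℕ)}
    {t t' : Tm ℕ} (hwf : WF Γ t t') : ∀ {v : ℕ}, Ev M t' v → ∀ {pc d : ℕ} {ρ : ℕ → BitVec w},
    Seg P pc (t.compile pc d) → EnvOK Γ d ρ → Computes P M (t.compile pc d) pc d ρ v := by
  induction hwf with
  | @var Γ r x hx =>
    intro v hv pc d ρ hP hρ
    cases hv
    obtain ⟨h1, h2⟩ := hρ _ hx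
    have := Computes.single (M := M) (ρ := ρ) (d := d) (x := ρ r) hP.head (by
      simp [Instr.step, WordOp.eval])
    rwa [h2] at this
  | @cst Γ c =>
    intro v hv pc d ρ hP hρ
    cases hv
    have := Computes.single (M := M) (ρ := ρ) (d := d) (x := BitVec.ofNat w c) hP.head (by
      simp [Instr.step])
    simpa [Tm.compile] using this
  | @op Γ o a b a' b' _ _ iha ihb =>
    intro v hv pc d ρ hP hρ
    cases hv with
    | @op _ _ _ x y hx hy =>
    simp only [Tm.compile] at hP ⊢
    obtain ⟨ρ₁, k₁, hk₁, hr₁, he₁, hv₁⟩ := iha hx hP.left hρ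
    obtain ⟨ρ₂, k₂, hk₂, hr₂, he₂, hv₂⟩ :=
      ihb hy hP.right.left (hρ.congr (Nat.le_succ d) he₁)
    obtain ⟨ρ₃, k₃, hk₃, hr₃, he₃, hv₃⟩ := Computes.single (M := M) (ρ := ρ₂) (d := d)
      (x := o.eval (ρ₂ d) (ρ₂ (d + 1))) hP.right.right.head (by simp [Instr.step])
    refine ⟨ρ₃, k₁ + (k₂ + k₃), ?_, ?_, ?_, ?_⟩
    · simp at hk₃ ⊢; omega
    · have := hr₁.trans (hr₂.trans hr₃)
      convert this using 2
      simp; omega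
    · intro r hr
      rw [he₃ r hr, he₂ r (by omega), he₁ r hr]
    · rw [hv₃, ofNat_of_toNat hv₂, he₂ d (by omega), ofNat_of_toNat hv₁]
  | @ld Γ a a' _ iha =>
    intro v hv pc d ρ hP hρ
    cases hv with
    | @ld _ x v hx hM =>
    simp only [Tm.compile] at hP ⊢
    obtain ⟨ρ₁, k₁, hk₁, hr₁, he₁, hv₁⟩ := iha hx hP.left hρ
    obtain ⟨ρ₃, k₃, hk₃, hr₃, he₃, hv₃⟩ := Computes.single (M := M) (ρ := ρ₁) (d := d)
      (x := v) hP.right.head (by simp [Instr.step, hv₁, hM])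
    refine ⟨ρ₃, k₁ + k₃, ?_, ?_, ?_, hv₃⟩
    · simp at hk₃ ⊢; omega
    · convert hr₁.trans hr₃ using 2
      simp; omega
    · intro r hr
      rw [he₃ r hr, he₁ r hr]
  | @bind Γ a a' f f' _ _ iha ihf =>
    intro v hv pc d ρ hP hρ
    cases hv with
    | @bind _ _ x _ hx hy =>
    simp only [Tm.compile] at hP ⊢
    obtain ⟨ρ₁, k₁, hk₁, hr₁, he₁, hv₁⟩ := iha hx hP.left hρ
    have hρ₁ : EnvOK (insert (d, x) Γ) (d + 1) ρ₁ := by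
      rintro p (rfl | hp)
      · exact ⟨Nat.lt_succ_self _, hv₁⟩
      · exact hρ.congr (Nat.le_succ d) he₁ p hp
    obtain ⟨ρ₂, k₂, hk₂, hr₂, he₂, hv₂⟩ := ihf d x hy hP.right.left hρ₁
    obtain ⟨ρ₃, k₃, hk₃, hr₃, he₃, hv₃⟩ := Computes.single (M := M) (ρ := ρ₂) (d := d)
      (x := ρ₂ (d + 1)) hP.right.right.head (by simp [Instr.step, WordOp.eval])
    refine ⟨ρ₃, k₁ + (k₂ + k₃), ?_, ?_, ?_, hv₃.trans hv₂⟩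
    · simp at hk₃ ⊢; omega
    · have := hr₁.trans (hr₂.trans hr₃)
      convert this using 2
      simp; omega
    · intro r hr
      rw [he₃ r hr, he₂ r (by omega), he₁ r hr]
  | @ifLT Γ a b t e a' b' t' e' _ _ _ _ iha ihb iht ihe =>
    intro v hv pc d ρ hP hρ
    simp only [Tm.compile] at hP ⊢
    cases hv with
    | @ifLT_true _ _ _ _ x y _ hx hy hlt ht =>
      obtain ⟨ρ₁, k₁, hk₁, hr₁, he₁, hv₁⟩ := iha hx hP.left hρ
      obtain ⟨ρ₂, k₂, hk₂, hr₂, he₂, hv₂⟩ :=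
        ihb hy hP.right.left (hρ.congr (Nat.le_succ d) he₁)
      have he : ∀ r < d, ρ₂ r = ρ r := fun r hr => by rw [he₂ r (by omega), he₁ r hr]
      have hj := hP.right.right
      obtain ⟨ρ₃, k₃, hk₃, hr₃, he₃, hv₃⟩ :=
        iht ht (by convert hj.tail.right.tail using 1) (hρ.congr le_rfl he)
      have hs := Reach.step (M := M) (c := ⟨_, ρ₂⟩) hj.head rfl
      rw [show (ρ₂ d).toNat = x by rw [he₂ d (by omega), hv₁], hv₂, if_pos hlt] at hs
      refine ⟨ρ₃, k₁ + (k₂ + (1 + k₃)), ?_, ?_, ?_, hv₃⟩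
      · simp; omega
      · have := hr₁.trans (hr₂.trans (hs.trans hr₃))
        convert this using 2
        simp; omega
      · intro r hr
        rw [he₃ r hr, he r hr]
    | @ifLT_false _ _ _ _ x y _ hx hy hlt ht =>
      obtain ⟨ρ₁, k₁, hk₁, hr₁, he₁, hv₁⟩ := iha hx hP.left hρ
      obtain ⟨ρ₂, k₂, hk₂, hr₂, he₂, hv₂⟩ :=
        ihb hy hP.right.left (hρ.congr (Nat.le_succ d) he₁)
      have he : ∀ r < d, ρ₂ r = ρ r := fun r hr => by rw [he₂ r (by omega), he₁ r hr]
      have hj := hP.right.right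
      obtain ⟨ρ₃, k₃, hk₃, hr₃, he₃, hv₃⟩ := ihe ht hj.tail.left (hρ.congr le_rfl he)
      have hs := Reach.step (M := M) (c := ⟨_, ρ₂⟩) hj.head rfl
      rw [show (ρ₂ d).toNat = x by rw [he₂ d (by omega), hv₁], hv₂, if_neg hlt] at hs
      have hs' := Reach.step (M := M) (c := ⟨_, ρ₃⟩) hj.tail.right.head rfl
      refine ⟨ρ₃, k₁ + (k₂ + (1 + (k₃ + 1))), ?_, ?_, ?_, hv₃⟩
      · simp; omega
      · have := hr₁.trans (hr₂.trans (hs.trans (hr₃.trans hs')))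
        convert this using 2
        simp; omega
      · intro r hr
        rw [he₃ r hr, he r hr]
  | @ifEQ Γ a b t e a' b' t' e' _ _ _ _ iha ihb iht ihe =>
    intro v hv pc d ρ hP hρ
    simp only [Tm.compile] at hP ⊢
    cases hv with
    | @ifEQ_true _ _ _ _ x y _ hx hy hlt ht =>
      obtain ⟨ρ₁, k₁, hk₁, hr₁, he₁, hv₁⟩ := iha hx hP.left hρ
      obtain ⟨ρ₂, k₂, hk₂, hr₂, he₂, hv₂⟩ :=
        ihb hy hP.right.left (hρ.congr (Nat.le_succ d) he₁)
      have he : ∀ r < d, ρ₂ r = ρ r := fun r hr => by rw [he₂ r (by omega), he₁ r hr]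
      have hj := hP.right.right
      obtain ⟨ρ₃, k₃, hk₃, hr₃, he₃, hv₃⟩ :=
        iht ht (by convert hj.tail.right.tail using 1) (hρ.congr le_rfl he)
      have hs := Reach.step (M := M) (c := ⟨_, ρ₂⟩) hj.head rfl
      have hxy : ρ₂ d = ρ₂ (d + 1) := by
        apply BitVec.eq_of_toNat_eq; rw [he₂ d (by omega), hv₁, hv₂, hlt]
      rw [if_pos hxy] at hs
      refine ⟨ρ₃, k₁ + (k₂ + (1 + k₃)), ?_, ?_, ?_, hv₃⟩
      · simp; omega
      · have := hr₁.trans (hr₂.trans (hs.trans hr₃))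
        convert this using 2
        simp; omega
      · intro r hr
        rw [he₃ r hr, he r hr]
    | @ifEQ_false _ _ _ _ x y _ hx hy hlt ht =>
      obtain ⟨ρ₁, k₁, hk₁, hr₁, he₁, hv₁⟩ := iha hx hP.left hρ
      obtain ⟨ρ₂, k₂, hk₂, hr₂, he₂, hv₂⟩ :=
        ihb hy hP.right.left (hρ.congr (Nat.le_succ d) he₁)
      have he : ∀ r < d, ρ₂ r = ρ r := fun r hr => by rw [he₂ r (by omega), he₁ r hr]
      have hj := hP.right.right
      obtain ⟨ρ₃, k₃, hk₃, hr₃, he₃, hv₃⟩ := ihe ht hj.tail.left (hρ.congr le_rfl he)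
      have hs := Reach.step (M := M) (c := ⟨_, ρ₂⟩) hj.head rfl
      have hxy : ρ₂ d ≠ ρ₂ (d + 1) := by
        intro h
        apply hlt
        rw [← hv₁, ← hv₂, ← he₂ d (by omega), h]
      rw [if_neg hxy] at hs
      have hs' := Reach.step (M := M) (c := ⟨_, ρ₃⟩) hj.tail.right.head rfl
      refine ⟨ρ₃, k₁ + (k₂ + (1 + (k₃ + 1))), ?_, ?_, ?_, hv₃⟩
      · simp; omega
      · have := hr₁.trans (hr₂.trans (hs.trans (hr₃.trans hs')))
        convert this using 2
        simp; omega
      · intro r hr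
        rw [he₃ r hr, he r hr]

/-- The program of a term with one free variable, which holds the input. -/
def program (q : ∀ V : Type, V → Tm V) : Program :=
  (q ℕ 0).compile 0 1 ++ [.arith .or 0 1 1, .halt]

theorem answers_mono {w : ℕ} {P : Program} {M : List (BitVec w)} {t s x y : ℕ}
    (h : P.Answers M t x y) (hts : t ≤ s) : P.Answers M s x y := by
  have key : ∀ (t : ℕ) (c : Config w) (v : BitVec w), P.run M t c = some v →
      P.run M (t + 1) c = some v := by
    intro t
    induction t with
    | zero => intro c v h; simp [Program.run] at h
    | succ t ih =>
      intro c v h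
      rw [Program.run] at h ⊢
      cases hp : P[c.pc]? with
      | none => simp [hp] at h
      | some i =>
        cases i with
        | halt => simpa [hp] using h
        | _ =>
          simp only [hp, Option.bind_eq_some_iff] at h ⊢
          obtain ⟨c', h1, h2⟩ := h
          exact ⟨c', h1, ih _ _ h2⟩
  obtain ⟨v, hv, rfl⟩ := h
  refine ⟨v, ?_, rfl⟩
  induction s, hts using Nat.le_induction with
  | base => exact hv
  | succ s _ ih => exact key _ _ _ ih

/-- Register `0` keeps the input, hence compilation from register `1` on; the two extra steps copy
the result to register `0` and halt. -/
theorem program_answers {w : ℕ} {M : List (BitVec w)} {q : ∀ V : Type, V → Tm V} {x y : ℕ}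
    (hx : x < 2 ^ w) (hwf : WF {(0, x)} (q ℕ 0) (q ℕ x)) (hev : Ev M (q ℕ x) y) :
    (program q).Answers M ((q ℕ 0).cost 1 + 2) x y := by
  have hP : Seg (program q) 0 (program q) := Seg.refl _
  have henv : EnvOK {((0 : ℕ), x)} 1 (Config.init w x).reg := by
    rintro p rfl
    simp [Config.init, Nat.mod_eq_of_lt hx]
  obtain ⟨ρ, k, hk, hr, -, hv⟩ := computes_of_ev (P := program q) hwf hev hP.left henv
  have h2 := hP.right
  have hs := Reach.step (M := M) (c := ⟨_, ρ⟩) h2.head rfl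
  refine answers_mono (t := k + 2) ⟨ρ 1, ?_, hv⟩ ?_
  · have hh := h2.tail.head
    rw [zero_add] at hh
    have := (hr.trans hs) 1
    rw [show 1 + (k + 1) = k + 2 by omega] at this
    rw [show Config.init w x = ⟨0, (Config.init w x).reg⟩ from rfl, this]
    simp [Program.run, Config.write, WordOp.eval, hh]
  · rw [← Tm.length_compile _ 0 1]; omega

/-! ## Arithmetic in the term language -/

instance {V : Type} : Add (Tm V) := ⟨Tm.op .add⟩
instance {V : Type} : Sub (Tm V) := ⟨Tm.op .sub⟩
instance {V : Type} : Mul (Tm V) := ⟨Tm.op .mul⟩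
instance {V : Type} : Div (Tm V) := ⟨Tm.op .div⟩
instance {V : Type} : Mod (Tm V) := ⟨Tm.op .mod⟩

/-- Left shift. -/
abbrev Tm.shl {V : Type} (a b : Tm V) : Tm V := .op .shl a b

/-- Right shift. -/
abbrev Tm.shr {V : Type} (a b : Tm V) : Tm V := .op .shr a b

section

variable {w : ℕ} {M : List (BitVec w)} {a b : Tm ℕ} {x y : ℕ}

theorem Ev.congr {z : ℕ} (h : Ev M a x) (hz : x = z) : Ev M a z := hz ▸ h

theorem Ev.lit {c : ℕ} (h : c < 2 ^ w) : Ev M (.cst c) c :=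
  (Ev.cst c).congr (Nat.mod_eq_of_lt h)

theorem Ev.add (ha : Ev M a x) (hb : Ev M b y) (h : x + y < 2 ^ w) : Ev M (a + b) (x + y) :=
  (Ev.op (o := .add) ha hb).congr (by
    simp [WordOp.eval, BitVec.toNat_add, Nat.mod_eq_of_lt h])

theorem Ev.mul (ha : Ev M a x) (hb : Ev M b y) (h : x * y < 2 ^ w) : Ev M (a * b) (x * y) :=
  (Ev.op (o := .mul) ha hb).congr (by
    simp [WordOp.eval, BitVec.toNat_mul, Nat.mod_eq_of_lt h])

theorem Ev.sub (ha : Ev M a x) (hb : Ev M b y) (hx : x < 2 ^ w) (h : y ≤ x) :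
    Ev M (a - b) (x - y) :=
  (Ev.op (o := .sub) ha hb).congr (by
    simp only [WordOp.eval, BitVec.toNat_sub, BitVec.toNat_ofNat, Nat.mod_eq_of_lt hx,
      Nat.mod_eq_of_lt (h.trans_lt hx)]
    rw [show 2 ^ w - y + x = (x - y) + 2 ^ w by omega, Nat.add_mod_right, Nat.mod_eq_of_lt]
    omega)

theorem Ev.div (ha : Ev M a x) (hb : Ev M b y) (hx : x < 2 ^ w) (hy : y < 2 ^ w) :
    Ev M (a / b) (x / y) :=
  (Ev.op (o := .div) ha hb).congr (by
    simp [WordOp.eval, BitVec.toNat_udiv, Nat.mod_eq_of_lt hx, Nat.mod_eq_of_lt hy])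

theorem Ev.mod (ha : Ev M a x) (hb : Ev M b y) (hx : x < 2 ^ w) (hy : y < 2 ^ w) :
    Ev M (a % b) (x % y) :=
  (Ev.op (o := .mod) ha hb).congr (by
    simp [WordOp.eval, BitVec.toNat_umod, Nat.mod_eq_of_lt hx, Nat.mod_eq_of_lt hy])

theorem Ev.shr (ha : Ev M a x) (hb : Ev M b y) (hx : x < 2 ^ w) (hy : y < 2 ^ w) :
    Ev M (a.shr b) (x / 2 ^ y) :=
  (Ev.op (o := .shr) ha hb).congr (by
    simp [WordOp.eval, Nat.mod_eq_of_lt hx, Nat.mod_eq_of_lt hy, Nat.shiftRight_eq_div_pow])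

theorem Ev.shl (ha : Ev M a x) (hb : Ev M b y) (hy : y < 2 ^ w) (h : x * 2 ^ y < 2 ^ w) :
    Ev M (a.shl b) (x * 2 ^ y) :=
  (Ev.op (o := .shl) ha hb).congr (by
    have hx : x < 2 ^ w := (Nat.le_mul_of_pos_right x (by positivity)).trans_lt h
    simp [WordOp.eval, Nat.mod_eq_of_lt hx, Nat.mod_eq_of_lt hy, Nat.shiftLeft_eq,
      Nat.mod_eq_of_lt h])

/-- The memory holds the number `v` at address `x`. -/
def Reads (M : List (BitVec w)) (x v : ℕ) : Prop := ∃ b, M[x]? = some b ∧ b.toNat = v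

theorem Ev.load {v : ℕ} (ha : Ev M a x) (h : Reads M x v) : Ev M (.ld a) v := by
  obtain ⟨b, hb, rfl⟩ := h
  exact .ld ha hb

/-- With `M.length ≤ 2 ^ w`, this supplies most of the no-overflow conditions for address
arithmetic. -/
theorem Reads.lt_length {v : ℕ} (h : Reads M x v) : x < M.length := by
  obtain ⟨b, hb, -⟩ := h
  exact (List.getElem?_eq_some_iff.1 hb).1

theorem Reads.lt {v : ℕ} (h : Reads M x v) : v < 2 ^ w := by
  obtain ⟨b, -, rfl⟩ := h
  exact b.isLt

/-- The memory holds the list `l` of numbers at address `x`. -/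
abbrev Holds (M : List (BitVec w)) (x : ℕ) (l : List ℕ) : Prop :=
  Seg M x (l.map (BitVec.ofNat w))

theorem Holds.reads {l : List ℕ} {i v : ℕ} (h : Holds M x l) (hi : l[i]? = some v)
    (hv : v < 2 ^ w) : Reads M (x + i) v :=
  ⟨BitVec.ofNat w v, h i _ (by simp [hi]), by simp [Nat.mod_eq_of_lt hv]⟩

theorem Holds.reads_head {l : List ℕ} {v : ℕ} (h : Holds M x (v :: l)) (hv : v < 2 ^ w) :
    Reads M x v := h.reads (i := 0) rfl hv

theorem Holds.left {l k : List ℕ} (h : Holds M x (l ++ k)) : Holds M x l := by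
  unfold Holds at h
  rw [List.map_append] at h
  exact Seg.left h

theorem Holds.right {l k : List ℕ} (h : Holds M x (l ++ k)) : Holds M (x + l.length) k := by
  unfold Holds at h
  rw [List.map_append] at h
  simpa using Seg.right h

theorem Holds.sub {l k : List ℕ} {i : ℕ} (h : Holds M x l) (hk : Seg l i k) :
    Holds M (x + i) k := Seg.trans h (hk.map _)

theorem Holds.lt_length {l : List ℕ} {i : ℕ} (h : Holds M x l) (hi : i < l.length) :
    x + i < M.length := by
  have := h i (BitVec.ofNat w l[i]) (by simp [hi])
  exact (List.getElem?_eq_some_iff.1 this).1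

end

/-! ## Packed arrays of small cells -/

/-- The cells `c 0, …, c N`, of `f` bits each, with `q` cells to a word. -/
def pack (f q : ℕ) (c : ℕ → ℕ) (N : ℕ) : List ℕ :=
  (List.range (N / q + 1)).map fun i =>
    Nat.ofDigits (2 ^ f) ((List.range q).map fun j => c (i * q + j))

theorem length_pack (f q : ℕ) (c : ℕ → ℕ) (N : ℕ) : (pack f q c N).length = N / q + 1 := by
  simp [pack]

/-- The cells of a word are its digits in base `2 ^ f`, and a digit is extracted by a division and a
remainder. -/
theorem pack_spec {f q w N : ℕ} {c : ℕ → ℕ} (hf : 1 ≤ f) (hq : 1 ≤ q) (hw : f * q ≤ w)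
    (hc : ∀ i, c i < 2 ^ f) {i : ℕ} (hi : i ≤ N) :
    ∃ v, (pack f q c N)[i / q]? = some v ∧ v < 2 ^ w ∧
      v / 2 ^ (f * (i % q)) % 2 ^ f = c i := by
  have hlt : i / q < N / q + 1 := Nat.lt_succ_of_le (Nat.div_le_div_right hi)
  have h1 : 1 < 2 ^ f := Nat.one_lt_two_pow (by omega)
  have hdig : ∀ d ∈ (List.range q).map (fun j => c (i / q * q + j)), d < 2 ^ f := by
    intro d hd
    obtain ⟨j, -, rfl⟩ := List.mem_map.1 hd
    exact hc _
  refine ⟨_, by rw [pack, List.getElem?_map, List.getElem?_range hlt]; rfl, ?_, ?_⟩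
  · refine (Nat.ofDigits_lt_base_pow_length h1 hdig).trans_le ?_
    rw [← pow_mul]
    exact Nat.pow_le_pow_right (by norm_num) (by simpa using hw)
  · have hm : i % q < q := Nat.mod_lt _ hq
    rw [pow_mul, Nat.ofDigits_div_pow_eq_ofDigits_drop _ (by positivity) _ hdig,
      List.drop_eq_getElem_cons (by simpa using hm), Nat.ofDigits_cons, Nat.add_mul_mod_self_left,
      List.getElem_map, List.getElem_range, Nat.div_add_mod', Nat.mod_eq_of_lt (hc _)]

/-- Cell `i` of a packed array. -/
def readCell {V : Type} (base q f i : Tm V) : Tm V :=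
  ((Tm.ld (base + i / q)).shr (f * (i % q))) % (Tm.cst 1).shl f

theorem ev_readCell {w f q N b i : ℕ} {M : List (BitVec w)} {c : ℕ → ℕ}
    {tb tq tf ti : Tm ℕ} (hf : 1 ≤ f) (hfw : f < w) (hq : 1 ≤ q) (hw : f * q ≤ w)
    (hc : ∀ i, c i < 2 ^ f) (hM : M.length ≤ 2 ^ w) (hH : Holds M b (pack f q c N))
    (hi : i ≤ N) (hi' : i < 2 ^ w) (eb : Ev M tb b) (eq : Ev M tq q) (ef : Ev M tf f)
    (ei : Ev M ti i) : Ev M (readCell tb tq tf ti) (c i) := by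
  obtain ⟨v, h1, h2, h3⟩ := pack_spec hf hq hw hc hi
  have hr := hH.reads h1 h2
  have hww : w < 2 ^ w := Nat.lt_two_pow_self
  have hqw : q < 2 ^ w := (Nat.le_mul_of_pos_left q hf).trans_lt (hw.trans_lt hww)
  have hm : i % q < q := Nat.mod_lt _ hq
  have hsw : f * (i % q) < 2 ^ w :=
    (Nat.mul_le_mul_left f hm.le).trans_lt (hw.trans_lt hww)
  have h2f : 2 ^ f < 2 ^ w := Nat.pow_lt_pow_right (by norm_num) hfw
  rw [← h3]
  refine Ev.mod (Ev.shr (Ev.load (eb.add (ei.div eq hi' hqw) (hr.lt_length.trans_le hM)) hr)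
    (ef.mul (ei.mod eq hi' hqw) hsw) h2 hsw) ?_ ?_ h2f
  · have := Ev.shl (Ev.lit (M := M) (c := 1) (by omega)) ef (by omega) (by simpa using h2f)
    simpa using this
  · exact (Nat.div_le_self _ _).trans_lt h2

/-! ## Monotone arrays with constant time access -/

/-- Entry `i` of the monotone array with block table at `bt`.  Addresses `0` and `1` hold the word
size and the block length. -/
def access {V : Type} (bt i : Tm V) : Tm V :=
  .bind (bt + .cst 4 * (i / .ld (.cst 1))) fun p =>
  .bind (i % .ld (.cst 1)) fun t =>
  .bind (.ld (.var p + .cst 1)) fun s =>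
  Tm.ld (.var p) + (Tm.ld (Tm.ld (.var p + .cst 2) + .var t)).shl (.var s) +
    readCell (.ld (.var p + .cst 3)) (Tm.ld (.cst 0) / .var s) (.var s) (.var t)

/-- The memory holds all monotone patterns of length `β` with values below `β`. -/
def HasPatterns {w : ℕ} (M : List (BitVec w)) (β : ℕ) (row : (ℕ → ℕ) → ℕ) : Prop :=
  ∀ p : ℕ → ℕ, Monotone p → (∀ t, p t < β) → ∀ t < β, Reads M (row p + t) (p t)

section MonotoneArray

variable (w β : ℕ) (a : ℕ → ℕ)

/-- The number of bits of the lower parts of the entries of a block. -/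
def lowBits (B : ℕ) : ℕ := Nat.log 2 ((a ((B + 1) * β) - a (B * β)) / β + 1) + 1

/-- The packed lower parts of the entries of a block. -/
def lowArea (B : ℕ) : List ℕ :=
  pack (lowBits β a B) (w / lowBits β a B)
    (fun t => (a (B * β + t) - a (B * β)) % 2 ^ lowBits β a B) (β - 1)

/-- The upper parts of the entries of a block. -/
def highPart (B : ℕ) (t : ℕ) : ℕ :=
  (a (B * β + min t (β - 1)) - a (B * β)) / 2 ^ lowBits β a B

/-- The entry of the block table. -/
def blockEntry (row : (ℕ → ℕ) → ℕ) (A NB B : ℕ) : List ℕ :=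
  [a (B * β), lowBits β a B, row (highPart β a B),
    A + 4 * NB + ∑ B' ∈ Finset.range B, (lowArea w β a B').length]

/-- The monotone array `a 0, …, a N`, to be placed at address `A`. -/
def monoArray (N : ℕ) (row : (ℕ → ℕ) → ℕ) (A : ℕ) : List ℕ :=
  ((List.range (N / β + 1)).map (blockEntry w β a row A (N / β + 1))).flatten ++
    ((List.range (N / β + 1)).map (lowArea w β a)).flatten

variable {w β a}

/-- This makes the upper parts of a block smaller than `β`, so that they form one of the tabulated
patterns. -/
theorem range_lt_lowBits (hβ : 1 ≤ β) (B : ℕ) :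
    a ((B + 1) * β) - a (B * β) < 2 ^ lowBits β a B * β := by
  set r := a ((B + 1) * β) - a (B * β)
  have h : r / β + 1 < 2 ^ lowBits β a B := Nat.lt_pow_succ_log_self (by norm_num) _
  have h2 : r < (r / β + 1) * β := by
    have := Nat.lt_div_mul_add (a := r) hβ; linarith
  exact h2.trans (Nat.mul_lt_mul_of_pos_right h hβ)

/-- Dividing the range by `β ≥ 4` saves two bits, which makes the inequality strict: a word has room
for a cell, and the modulus `2 ^ lowBits` is itself a word. -/
theorem lowBits_lt (hβ : 4 ≤ β) (hw : 2 ≤ w) {V : ℕ} (hV : V < 2 ^ w) (ha : ∀ i, a i ≤ V)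
    (B : ℕ) : lowBits β a B < w := by
  set r := a ((B + 1) * β) - a (B * β) with hr
  have h1 : r < 2 ^ w := ((Nat.sub_le _ _).trans (ha _)).trans_lt hV
  have h2 : r / β < 2 ^ (w - 2) := by
    have h4 : 2 ^ w = 2 ^ (w - 2) * 4 := by
      rw [show (4 : ℕ) = 2 ^ 2 by norm_num, ← pow_add]; congr 1; omega
    refine Nat.div_lt_of_lt_mul (h1.trans_le ?_)
    rw [h4, mul_comm]
    exact Nat.mul_le_mul_right _ hβ
  have h3 : Nat.log 2 (r / β + 1) ≤ w - 2 := by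
    calc Nat.log 2 (r / β + 1) ≤ Nat.log 2 (2 ^ (w - 2)) := Nat.log_mono_right h2
      _ = w - 2 := Nat.log_pow (by norm_num) _
  rw [lowBits, ← hr]
  omega

/-- The entry is block start plus upper part times `2 ^ s` plus lower part. The block table gives
the start, `s`, a pointer to the pattern of upper parts and a pointer to the packed lower parts. -/
theorem ev_access {N V A i : ℕ} {row : (ℕ → ℕ) → ℕ} {M : List (BitVec w)} {tb ti : Tm ℕ}
    (hβ : 4 ≤ β) (hw : 3 ≤ w) (hV : V < 2 ^ w) (hmono : Monotone a) (ha : ∀ i, a i ≤ V)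
    (hM : M.length ≤ 2 ^ w) (h0 : Reads M 0 w) (h1 : Reads M 1 β) (hp : HasPatterns M β row)
    (hH : Holds M A (monoArray w β a N row A)) (hi : i ≤ N) (hi' : i < 2 ^ w)
    (eb : Ev M tb A) (ei : Ev M ti i) : Ev M (access tb ti) (a i) := by
  set NB := N / β + 1 with hNB
  set B := i / β with hB
  set t := i % β with ht
  set s := lowBits β a B with hs
  have hβ0 : 0 < β := by omega
  have hBN : B < NB := Nat.lt_succ_of_le (Nat.div_le_div_right hi)
  have htβ : t < β := Nat.mod_lt _ hβ0
  have hit : B * β + t = i := Nat.div_add_mod' i β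
  have h4B : ∑ i ∈ Finset.range B, (blockEntry w β a row A NB i).length = 4 * B := by
    simp [blockEntry, mul_comm]
  have h4NB : ((List.range NB).map (blockEntry w β a row A NB)).flatten.length = 4 * NB := by
    rw [length_flatten_map_range]
    simp [blockEntry, mul_comm]
  have hE : Holds M (A + 4 * B) (blockEntry w β a row A NB B) := by
    rw [← h4B]
    exact hH.left.sub (seg_flatten _ _ _ hBN)
  have hL : Holds M (A + 4 * NB + ∑ B' ∈ Finset.range B, (lowArea w β a B').length)
      (lowArea w β a B) := by
    have := hH.right
    rw [← hNB, h4NB] at this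
    exact this.sub (seg_flatten _ _ _ hBN)
  set lp := A + 4 * NB + ∑ B' ∈ Finset.range B, (lowArea w β a B').length with hlp
  have hs1 : 1 ≤ s := by rw [hs, lowBits]; omega
  have hsw : s < w := lowBits_lt hβ (by omega) hV ha B
  have hww : w < 2 ^ w := Nat.lt_two_pow_self
  have hstart : a (B * β) ≤ a i := hmono (by omega)
  have hmin : min t (β - 1) = t := by omega
  have hhigh : ∀ t, highPart β a B t < β := by
    intro t
    refine Nat.div_lt_of_lt_mul ((tsub_le_tsub_right (hmono ?_) _).trans_lt
      (range_lt_lowBits (a := a) (by omega) B))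
    rw [add_mul, one_mul]; omega
  have hhm : Monotone (highPart β a B) := by
    intro t t' htt
    exact Nat.div_le_div_right (tsub_le_tsub_right (hmono (by omega)) _)
  have hrow := hp _ hhm hhigh t htβ
  have r0 : Reads M (A + 4 * B) (a (B * β)) := hE.reads_head ((ha _).trans_lt hV)
  have r1 : Reads M (A + 4 * B + 1) s := hE.reads (i := 1) rfl (hsw.trans hww)
  have r2 : Reads M (A + 4 * B + 2) (row (highPart β a B)) :=
    hE.reads (i := 2) rfl (lt_of_le_of_lt (Nat.le_add_right _ _) (hrow.lt_length.trans_le hM))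
  have r3 : Reads M (A + 4 * B + 3) lp := by
    refine hE.reads (i := 3) rfl ?_
    have := hL.lt_length (i := 0) (by simp [lowArea, length_pack])
    exact this.trans_le hM
  have hq1 : 1 ≤ w / s := (Nat.one_le_div_iff hs1).2 hsw.le
  have eβ : Ev M (.ld (.cst 1)) β := (Ev.lit (by omega)).load h1
  have ew : Ev M (.ld (.cst 0)) w := (Ev.lit (by omega)).load h0
  have h4w : 4 < 2 ^ w := by
    calc 4 < 2 ^ 3 := by norm_num
      _ ≤ 2 ^ w := Nat.pow_le_pow_right (by norm_num) hw
  have hp3 : A + 4 * B + 3 < 2 ^ w := r3.lt_length.trans_le hM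
  have ep : Ev M (.var (A + 4 * B)) (A + 4 * B) := .var _
  have es : Ev M (.var s) s := .var _
  have et : Ev M (.var t) t := .var _
  have hval : a i = a (B * β) + highPart β a B t * 2 ^ s + (a (B * β + t) - a (B * β)) % 2 ^ s := by
    have := Nat.div_add_mod' (a i - a (B * β)) (2 ^ s)
    rw [highPart, hmin, hit, ← hs]
    omega
  have haw : a i < 2 ^ w := (ha _).trans_lt hV
  refine Ev.bind (x := A + 4 * B) (eb.add ((Ev.lit (by omega)).mul (ei.div eβ hi' h1.lt) (by omega))
    (by omega)) ?_
  refine Ev.bind (x := t) (ei.mod eβ hi' h1.lt) ?_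
  refine Ev.bind (x := s) ((ep.add (.lit (by omega)) (by omega)).load r1) ?_
  rw [hval] at haw ⊢
  refine Ev.add (Ev.add (ep.load r0) (Ev.shl (x := highPart β a B t) ?_ es (hsw.trans hww) (by omega)) (by omega)) ?_ haw
  · exact (((ep.add (.lit (by omega)) (by omega)).load r2).add et
      (hrow.lt_length.trans_le hM)).load hrow
  · exact ev_readCell (c := fun t => (a (B * β + t) - a (B * β)) % 2 ^ s) hs1 hsw hq1
      (Nat.mul_div_le w s) (fun _ => Nat.mod_lt _ (by positivity)) hM hL (by omega)
      (by omega) ((ep.add (.lit (by omega)) hp3).load r3) (ew.div es hww (hsw.trans hww)) es et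

/-- A linear bound in place of the concavity of the logarithm: summed over blocks, the terms `x / 2
^ σ` telescope. A good `σ` is the logarithm of the average increment. -/
theorem log_two_le_add (x σ : ℕ) : Nat.log 2 x ≤ σ + x / 2 ^ σ := by
  rcases Nat.eq_zero_or_pos x with rfl | hx
  · simp
  rcases le_or_gt (Nat.log 2 x) σ with h | h
  · exact h.trans (Nat.le_add_right _ _)
  · have h1 : 2 ^ (Nat.log 2 x - σ) ≤ x / 2 ^ σ := by
      rw [Nat.le_div_iff_mul_le (by positivity), ← pow_add, Nat.sub_add_cancel h.le]
      exact Nat.pow_log_le_self 2 hx.ne'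
    have h2 : Nat.log 2 x - σ < x / 2 ^ σ := Nat.lt_two_pow_self.trans_le h1
    omega

theorem mul_lowBits_le (B σ : ℕ) : β * lowBits β a B ≤
    β * (σ + 2) + (a ((B + 1) * β) - a (B * β)) / 2 ^ σ := by
  set r := a ((B + 1) * β) - a (B * β) with hr
  have h1 := log_two_le_add (r / β + 1) σ
  have h2 : (r / β + 1) / 2 ^ σ ≤ r / 2 ^ σ / β + 1 := by
    rw [Nat.div_div_eq_div_mul, mul_comm, ← Nat.div_div_eq_div_mul]
    calc (r / β + 1) / 2 ^ σ ≤ (r / β + 2 ^ σ) / 2 ^ σ :=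
          Nat.div_le_div_right (by have := Nat.one_le_two_pow (n := σ); omega)
      _ = _ := Nat.add_div_right _ (by positivity)
  calc β * lowBits β a B ≤ β * (σ + (r / 2 ^ σ / β + 1) + 1) :=
        Nat.mul_le_mul_left _ (by rw [lowBits, ← hr]; omega)
    _ = β * (σ + 2) + β * (r / 2 ^ σ / β) := by ring
    _ ≤ _ := Nat.add_le_add_left (Nat.mul_div_le _ _) _

/-- Integer division is superadditive in the numerator and the increments telescope. -/
theorem sum_range_div_le {V : ℕ} (hmono : Monotone a) (ha : ∀ i, a i ≤ V) (c n : ℕ) :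
    ∑ B ∈ Finset.range n, (a ((B + 1) * β) - a (B * β)) / c ≤ V / c := by
  refine le_trans (b := (a (n * β) - a 0) / c) ?_
    (Nat.div_le_div_right ((Nat.sub_le _ _).trans (ha _)))
  induction n with
  | zero => simp
  | succ n ih =>
    rw [Finset.sum_range_succ]
    refine (Nat.add_le_add_right ih _).trans (Nat.div_add_div_le_add_div.trans
      (Nat.div_le_div_right ?_))
    have h1 : a 0 ≤ a (n * β) := hmono (by omega)
    have h2 : a (n * β) ≤ a ((n + 1) * β) := hmono (Nat.mul_le_mul_right _ (by omega))
    omega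

/-- Each block costs four table words and at most one partially filled word, hence `5 * w`. The
factor `2` occurs because `w / s` cells of `s` bits fill at least half of a word. The parameter `σ`
is chosen by the caller: `0` when `V` is of the order of `N`, and about `log (V / N)` for
`select_1`. -/
theorem length_monoArray_le {N V A : ℕ} {row : (ℕ → ℕ) → ℕ} (hβ : 4 ≤ β) (hw : 2 ≤ w)
    (hV : V < 2 ^ w) (hmono : Monotone a) (ha : ∀ i, a i ≤ V) (σ : ℕ) :
    w * (monoArray w β a N row A).length ≤
      (N / β + 1) * (5 * w + 2 * (β * (σ + 2))) + 2 * (V / 2 ^ σ) := by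
  set NB := N / β + 1 with hNB
  have hlow : ∀ B, w * (lowArea w β a B).length ≤ 2 * (β * lowBits β a B) + w := by
    intro B
    rw [lowArea, length_pack]
    have hs1 : 1 ≤ lowBits β a B := by rw [lowBits]; omega
    have hsw : lowBits β a B < w := lowBits_lt hβ hw hV ha B
    set s := lowBits β a B
    set q := w / s with hq
    have hq1 : 1 ≤ q := (Nat.one_le_div_iff hs1).2 hsw.le
    have h1 : w ≤ q * s + s := (Nat.lt_div_mul_add hs1).le
    have h2 : s ≤ q * s := Nat.le_mul_of_pos_left s hq1
    have h3 : (β - 1) / q * q ≤ β := (Nat.div_mul_le_self _ _).trans (Nat.sub_le _ _)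
    have h4 : (β - 1) / q * w ≤ (β - 1) / q * (2 * (q * s)) := Nat.mul_le_mul_left _ (by omega)
    have h5 : (β - 1) / q * (2 * (q * s)) = 2 * (((β - 1) / q * q) * s) := by ring
    have h6 : ((β - 1) / q * q) * s ≤ β * s := Nat.mul_le_mul_right _ h3
    calc w * ((β - 1) / q + 1) = (β - 1) / q * w + w := by ring
      _ ≤ _ := by omega
  have hsum : w * ∑ B ∈ Finset.range NB, (lowArea w β a B).length ≤
      NB * (w + 2 * (β * (σ + 2))) + 2 * (V / 2 ^ σ) := by
    rw [Finset.mul_sum]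
    calc ∑ B ∈ Finset.range NB, w * (lowArea w β a B).length
        ≤ ∑ B ∈ Finset.range NB, ((w + 2 * (β * (σ + 2))) +
            2 * ((a ((B + 1) * β) - a (B * β)) / 2 ^ σ)) := by
          refine Finset.sum_le_sum fun B _ => (hlow B).trans ?_
          have := mul_lowBits_le (β := β) (a := a) B σ
          omega
      _ ≤ _ := by
          rw [Finset.sum_add_distrib, ← Finset.mul_sum]
          have := sum_range_div_le (β := β) hmono ha (2 ^ σ) NB
          simp only [Finset.sum_const, Finset.card_range, smul_eq_mul]
          omega
  rw [monoArray, List.length_append, length_flatten_map_range, length_flatten_map_range, ← hNB,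
    mul_add]
  have : ∑ i ∈ Finset.range NB, (blockEntry w β a row A NB i).length = NB * 4 := by
    simp [blockEntry]
  rw [this]
  calc w * (NB * 4) + w * ∑ B ∈ Finset.range NB, (lowArea w β a B).length
      ≤ w * (NB * 4) + (NB * (w + 2 * (β * (σ + 2))) + 2 * (V / 2 ^ σ)) := by omega
    _ = _ := by ring

end MonotoneArray

/-! ## The table of patterns -/

/-- The monotone maps from `Fin β` to `Fin β`. -/
noncomputable def patterns (β : ℕ) : Finset (Fin β → Fin β) :=
  letI := Classical.decPred fun p : Fin β → Fin β => Monotone p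
  Finset.univ.filter fun p => Monotone p

/-- Adding `t` to `p t` makes the map strictly increasing, so it is determined by its range, a
subset of a set of `2 * β` elements. -/
theorem card_patterns_le (β : ℕ) : (patterns β).card ≤ 4 ^ β := by
  classical
  let g : (Fin β → Fin β) → Finset (Fin (2 * β)) := fun p =>
    Finset.univ.image fun t : Fin β => (⟨(p t : ℕ) + t, by omega⟩ : Fin (2 * β))
  have hg : Set.InjOn g (patterns β : Set (Fin β → Fin β)) := by
    intro p hp p' hp' h
    simp only [patterns, Finset.coe_filter, Finset.mem_univ, true_and, Set.mem_ofPred_eq] at hp hp'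
    have strict : ∀ p : Fin β → Fin β, Monotone p →
        StrictMono fun t : Fin β => (⟨(p t : ℕ) + t, by omega⟩ : Fin (2 * β)) := by
      intro p hp t t' htt
      have : (p t : ℕ) ≤ p t' := hp htt.le
      have : (t : ℕ) < t' := htt
      simp only [Fin.mk_lt_mk]; omega
    have hr := (strict p hp).range_inj (strict p' hp') |>.1 (by
      have := congrArg (fun s : Finset (Fin (2 * β)) => (s : Set (Fin (2 * β)))) h
      simpa [g] using this)
    funext t
    have := congrFun hr t
    simp only [Fin.mk.injEq] at this
    exact Fin.ext (by omega)
  have := Finset.card_le_card_of_injOn g (t := Finset.univ) (fun _ _ => Finset.mem_univ _) hg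
  simpa [pow_mul] using this

/-- All patterns, one after the other. -/
noncomputable def patternTable (β : ℕ) : List ℕ :=
  ((patterns β).toList.map fun p => List.ofFn fun t => (p t : ℕ)).flatten

theorem length_patternTable_le (β : ℕ) : (patternTable β).length ≤ 4 ^ β * β := by
  have : (patternTable β).length = (patterns β).card * β := by
    simp [patternTable, List.length_flatten, Function.comp_def]
  rw [this]
  exact Nat.mul_le_mul_right _ (card_patterns_le β)

/-- The row addresses depend only on `β` and the table address, so blocks can refer to them before
the memory is assembled. -/
theorem exists_row (β A : ℕ) : ∃ row : (ℕ → ℕ) → ℕ, ∀ (w : ℕ) (M : List (BitVec w)),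
    β ≤ 2 ^ w → Holds M A (patternTable β) → HasPatterns M β row := by
  have key : ∀ p : ℕ → ℕ, ∃ o : ℕ, Monotone p → (∀ t, p t < β) →
      ∀ t < β, (patternTable β)[o + t]? = some (p t) := by
    intro p
    by_cases hp : Monotone p ∧ ∀ t, p t < β
    · obtain ⟨h1, h2⟩ := hp
      let p' : Fin β → Fin β := fun t => ⟨p t, h2 t⟩
      have hmem : (List.ofFn fun t => (p' t : ℕ)) ∈
          (patterns β).toList.map fun p => List.ofFn fun t => (p t : ℕ) := by
        refine List.mem_map.2 ⟨p', ?_, rfl⟩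
        rw [Finset.mem_toList]
        simp only [patterns, Finset.mem_filter, Finset.mem_univ, true_and]
        exact fun t t' h => h1 h
      obtain ⟨s, s', hs⟩ := List.append_of_mem hmem
      refine ⟨s.flatten.length, fun _ _ t ht => ?_⟩
      rw [patternTable, hs, List.flatten_append, List.flatten_cons]
      rw [List.getElem?_append_right (by omega), Nat.add_sub_cancel_left,
        List.getElem?_append_left (by simpa using ht)]
      simp [ht, p']
    · exact ⟨0, fun h1 h2 => absurd ⟨h1, h2⟩ hp⟩
  choose o ho using key
  refine ⟨fun p => A + o p, fun w M hw hH p h1 h2 t ht => ?_⟩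
  rw [add_assoc]
  exact hH.reads (ho p h1 h2 t ht) ((h2 t).trans_le hw)

/-! ## Perfect hashing modulo primes -/

open scoped Nat.Prime in
-- A Chebyshev bound: `lcm(1, …, N)` is a product of `π(N)` prime powers, each at most `N`, and for
-- `N = 2 ^ a` it is at least `2 ^ N / (N + 1)`.
theorem two_pow_le_mul_primeCounting (a : ℕ) (ha : 1 ≤ a) : 2 ^ a ≤ a * (π (2 ^ a) + 2) := by
  have h1 := Chebyshev.two_pow_le_mul_lcmUpto (2 ^ a)
  have h2 : Nat.lcmUpto (2 ^ a) ≤ (2 ^ a) ^ π (2 ^ a) := by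
    rw [Nat.lcmUpto_eq_prod_pow_log, ← Nat.primesLE_card_eq_primeCounting]
    refine Finset.prod_le_pow_card _ _ _ fun p _ => Nat.pow_log_le_self p (by positivity)
  have h3 : 2 ^ a + 1 ≤ 2 ^ (a + 1) := by
    have := Nat.one_le_two_pow (n := a)
    rw [pow_succ]; omega
  have h4 : 2 ^ 2 ^ a ≤ 2 ^ (a + 1 + a * π (2 ^ a)) := by
    rw [pow_add, pow_mul]
    exact h1.trans (Nat.mul_le_mul h3 h2)
  have h5 := (Nat.pow_le_pow_iff_right (by norm_num)).1 h4
  rw [mul_add]; omega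

theorem card_primeFactors_le {d b : ℕ} (hd : d ≠ 0) (hb : d < 2 ^ b) : d.primeFactors.card ≤ b := by
  have h1 : 2 ^ d.primeFactors.card ≤ d := by
    calc 2 ^ d.primeFactors.card ≤ ∏ p ∈ d.primeFactors, p :=
          Finset.pow_card_le_prod _ _ _ fun p hp => (Nat.prime_of_mem_primeFactors hp).two_le
      _ ≤ d := Nat.le_of_dvd (Nat.pos_of_ne_zero hd) (Nat.prod_primeFactors_dvd d)
  exact ((Nat.pow_lt_pow_iff_right (by norm_num)).1 (h1.trans_lt hb)).le

/-- The ordered pairs of distinct elements of `S` that collide modulo `q`. -/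
def collisions (S : Finset ℕ) (q : ℕ) : Finset (ℕ × ℕ) :=
  S.offDiag.filter fun p => p.1 % q = p.2 % q

/-- Averaging over the primes up to `2 ^ a ≤ R * 2 ^ γ`. Two distinct keys collide only modulo prime
divisors of their difference, at most `b` of them, and there are at least `R * b` primes, so some
prime has at most `|S|² / R` collisions. The condition on `γ` absorbs the logarithmic loss in the
prime count. -/
theorem exists_modulus {S : Finset ℕ} {b γ R : ℕ} (hS : ∀ x ∈ S, x < 2 ^ b) (hb : 1 ≤ b)
    (hR : 1 ≤ R) (hγ : 1 ≤ γ) (h : (Nat.log 2 R + γ) * (b + 1) ≤ 2 ^ (γ - 1)) :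
    ∃ q, 1 ≤ q ∧ q ≤ R * 2 ^ γ ∧ (collisions S q).card * R ≤ S.card ^ 2 := by
  set a := Nat.log 2 R + γ with ha
  set P := Nat.primesLE (2 ^ a) with hP
  have hcard : R * b ≤ P.card := by
    rw [hP, Nat.primesLE_card_eq_primeCounting]
    by_contra! hlt
    have h1 := two_pow_le_mul_primeCounting a (by omega)
    have h2 : a * ((2 ^ a).primeCounting + 2) ≤ a * (R * (b + 1)) := by
      refine Nat.mul_le_mul_left _ ?_
      rw [mul_add]; omega
    have h3 : a * (R * (b + 1)) ≤ R * 2 ^ (γ - 1) := by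
      calc a * (R * (b + 1)) = R * (a * (b + 1)) := by ring
        _ ≤ _ := Nat.mul_le_mul_left _ h
    have h4 : R * 2 ^ (γ - 1) < 2 ^ a := by
      have : 2 ^ a = 2 ^ (Nat.log 2 R + 1) * 2 ^ (γ - 1) := by
        rw [← pow_add]; congr 1; omega
      rw [this]
      exact Nat.mul_lt_mul_of_pos_right (Nat.lt_pow_succ_log_self (by norm_num) _) (by positivity)
    omega
  have hsum : ∑ q ∈ P, (collisions S q).card ≤ S.card ^ 2 * b := by
    simp only [collisions, Finset.card_filter]
    rw [Finset.sum_comm]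
    have hle : ∀ p ∈ S.offDiag, ∑ q ∈ P, (if p.1 % q = p.2 % q then 1 else 0) ≤ b := by
      rintro ⟨x, y⟩ hxy
      rw [Finset.mem_offDiag] at hxy
      obtain ⟨hx, hy, hne⟩ := hxy
      rw [← Finset.card_filter]
      have hd : (Int.natAbs ((x : ℤ) - y)) ≠ 0 := by simp at hne ⊢; omega
      have hd2 : (Int.natAbs ((x : ℤ) - y)) < 2 ^ b := by
        have := hS x hx; have := hS y hy; simp only at *; omega
      refine (Finset.card_le_card fun q hq => ?_).trans (card_primeFactors_le hd hd2)
      simp only [Finset.mem_filter, hP, Nat.mem_primesLE] at hq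
      rw [Nat.mem_primeFactors]
      refine ⟨hq.1.2, ?_, hd⟩
      rw [← Int.natCast_dvd]
      exact (Nat.modEq_iff_dvd.1 (show y ≡ x [MOD q] from hq.2.symm))
    refine (Finset.sum_le_card_nsmul _ _ _ hle).trans ?_
    rw [smul_eq_mul]
    refine Nat.mul_le_mul_right _ ?_
    rw [Finset.offDiag_card, sq]
    exact Nat.sub_le _ _
  by_contra! hcon
  have hpos : 0 < P.card := lt_of_lt_of_le (Nat.mul_pos hR hb) hcard
  have hbig : ∀ q ∈ P, S.card ^ 2 + 1 ≤ (collisions S q).card * R := by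
    intro q hq
    rw [hP, Nat.mem_primesLE] at hq
    refine hcon q hq.2.one_lt.le (hq.1.trans ?_)
    rw [ha, pow_add]
    exact Nat.mul_le_mul_right _ (Nat.pow_log_le_self 2 (by omega))
  have h1 := Finset.card_nsmul_le_sum _ _ _ hbig
  rw [← Finset.sum_mul, smul_eq_mul] at h1
  have h2 : P.card * (S.card ^ 2 + 1) ≤ S.card ^ 2 * P.card := by
    calc _ ≤ _ := h1
      _ ≤ S.card ^ 2 * b * R := Nat.mul_le_mul_right _ hsum
      _ = S.card ^ 2 * (R * b) := by ring
      _ ≤ _ := Nat.mul_le_mul_left _ hcard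
  nlinarith

/-- Both sides count the ordered pairs with equal residues; the diagonal contributes `S.card`. -/
theorem sum_card_sq_classes (S : Finset ℕ) {q : ℕ} (hq : 1 ≤ q) :
    ∑ r ∈ Finset.range q, (S.filter fun x => x % q = r).card ^ 2 =
      (collisions S q).card + S.card := by
  have h1 : (collisions S q).card + S.card =
      ((S ×ˢ S).filter fun p => p.1 % q = p.2 % q).card := by
    rw [collisions, ← Finset.diag_union_offDiag, Finset.filter_union,
      Finset.card_union_of_disjoint, add_comm]
    · congr 1
      rw [Finset.filter_true_of_mem, Finset.diag_card]
      rintro ⟨x, y⟩ h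
      rw [Finset.mem_diag] at h
      rw [h.2]
    · exact Finset.disjoint_filter_filter (Finset.disjoint_diag_offDiag S)
  rw [h1, Finset.card_eq_sum_card_fiberwise (f := fun p => p.1 % q) (t := Finset.range q)
    (fun p _ => by simpa using Nat.mod_lt _ hq)]
  refine Finset.sum_congr rfl fun r _ => ?_
  rw [sq, ← Finset.card_product]
  congr 1
  ext ⟨x, y⟩
  simp only [Finset.mem_product, Finset.mem_filter]
  constructor
  · rintro ⟨⟨h1, h2⟩, h3, h4⟩
    exact ⟨⟨⟨h1, h3⟩, h2.trans h4.symm⟩, h2⟩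
  · rintro ⟨⟨⟨h1, h3⟩, h2⟩, h4⟩
    exact ⟨⟨h1, h4⟩, h3, h2 ▸ h4⟩

/-- A static dictionary with constant lookup time: a list of cells that holds the keys `S`, each
with a payload of `P` cells. -/
theorem exists_dictionary {S : Finset ℕ} {b γ : ℕ} (P : ℕ) (pay : ℕ → ℕ → ℕ)
    (hS : ∀ x ∈ S, x < 2 ^ b) (hne : S.Nonempty) (hb : 1 ≤ b) (hγ : 1 ≤ γ)
    (h : (2 * b + 1 + γ) * (b + 1) ≤ 2 ^ (γ - 1)) :
    ∃ dict : List ℕ,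
      dict.length ≤ 1 + 2 * (S.card * 2 ^ γ) +
        (P + 1) * 2 ^ γ * (2 * S.card + S.card * 2 ^ γ) ∧
      (∀ x ∈ dict, x ≤ dict.length ∨ x < 2 ^ b ∨ ∃ κ g, x = pay κ g) ∧
      ∀ κ, 1 ≤ κ → ∃ q₁ q₂ o κ', dict[0]? = some q₁ ∧ dict[1 + 2 * (κ % q₁)]? = some q₂ ∧
        dict[2 + 2 * (κ % q₁)]? = some o ∧ dict[o + κ % q₂ * (P + 1)]? = some κ' ∧
        (κ' = κ ↔ κ ∈ S) ∧
        (κ ∈ S → ∀ g < P, dict[o + κ % q₂ * (P + 1) + 1 + g]? = some (pay κ g)) := by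
  have hN : 1 ≤ S.card := hne.card_pos
  have hNb : S.card ≤ 2 ^ b := by
    have : S ⊆ Finset.range (2 ^ b) := fun x hx => Finset.mem_range.2 (hS x hx)
    simpa using Finset.card_le_card this
  have hlog : ∀ R, R ≤ 2 ^ (2 * b) + 1 → (Nat.log 2 R + γ) * (b + 1) ≤ 2 ^ (γ - 1) := by
    intro R hR
    refine le_trans (Nat.mul_le_mul_right _ (Nat.add_le_add_right ?_ _)) h
    calc Nat.log 2 R ≤ Nat.log 2 (2 ^ (2 * b + 1)) := by
          refine Nat.log_mono_right (hR.trans ?_)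
          have := Nat.one_le_two_pow (n := 2 * b)
          rw [pow_succ]; omega
      _ = 2 * b + 1 := Nat.log_pow (by norm_num) _
  have hbb : 2 ^ b * 2 ^ b = 2 ^ (2 * b) := by rw [← pow_add]; congr 1; omega
  -- Two-level hashing. With `R = |S|` the first modulus has at most `|S|` collisions, so the
  -- squares of the class sizes sum to at most `2 * |S|`.
  obtain ⟨q₁, hq₁, hq₁', hcoll⟩ := exists_modulus hS hb hN hγ (hlog _ (by nlinarith))
  have hcoll' : (collisions S q₁).card ≤ S.card := by
    rw [sq] at hcoll
    exact Nat.le_of_mul_le_mul_right hcoll hN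
  let cls : ℕ → Finset ℕ := fun r => S.filter fun x => x % q₁ = r
  have hclsS : ∀ r, cls r ⊆ S := fun r => Finset.filter_subset _ _
  have hsecond : ∀ r, ∃ q, 1 ≤ q ∧ q ≤ ((cls r).card ^ 2 + 1) * 2 ^ γ ∧
      ∀ x ∈ cls r, ∀ y ∈ cls r, x % q = y % q → x = y := by
    intro r
    have hc : (cls r).card ≤ 2 ^ b := (Finset.card_le_card (hclsS r)).trans hNb
    -- With `R` exceeding the square of the class size, the number of collisions in the class is
    -- less than one.
    obtain ⟨q, h1, h2, h3⟩ := exists_modulus (S := cls r) (R := (cls r).card ^ 2 + 1)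
      (fun x hx => hS x (hclsS r hx)) hb (by omega) hγ (hlog _ (by nlinarith))
    refine ⟨q, h1, h2, fun x hx y hy hxy => ?_⟩
    by_contra hne
    have : 0 < (collisions (cls r) q).card := Finset.card_pos.2
      ⟨(x, y), by simp only [collisions, Finset.mem_filter, Finset.mem_offDiag]
                  exact ⟨⟨hx, hy, hne⟩, hxy⟩⟩
    nlinarith
  choose q₂ hq₂ hq₂' hinj using hsecond
  -- A slot holds at most one key, and the supremum of the empty set marks a free slot by `0`; this
  -- is why queries are restricted to `κ ≥ 1`.
  let keyAt : ℕ → ℕ → ℕ := fun r j => ((cls r).filter fun x => x % q₂ r = j).sup id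
  have hkey : ∀ r j, keyAt r j = 0 ∨ keyAt r j ∈ S := by
    intro r j
    rcases ((cls r).filter fun x => x % q₂ r = j).eq_empty_or_nonempty with he | he
    · left; simp [keyAt, he]
    · right
      obtain ⟨x, hx, hxe⟩ := Finset.exists_mem_eq_sup _ he id
      have : keyAt r j = x := hxe
      rw [this]
      exact hclsS r (Finset.filter_subset _ _ hx)
  let slot : ℕ → ℕ → List ℕ := fun r j =>
    keyAt r j :: (List.range P).map fun g => pay (keyAt r j) g
  let row : ℕ → List ℕ := fun r => ((List.range (q₂ r)).map (slot r)).flatten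
  have hslot : ∀ r j, (slot r j).length = P + 1 := by intro r j; simp [slot]
  have hrow : ∀ r, (row r).length = q₂ r * (P + 1) := by
    intro r
    simp only [row, length_flatten_map_range, hslot, Finset.sum_const, Finset.card_range,
      smul_eq_mul]
  let off : ℕ → ℕ := fun r => 1 + 2 * q₁ + ∑ r' ∈ Finset.range r, (row r').length
  let head : ℕ → List ℕ := fun r => [q₂ r, off r]
  let heads := ((List.range q₁).map head).flatten
  let rows := ((List.range q₁).map row).flatten
  have hheads : heads.length = 2 * q₁ := by
    simp only [heads, length_flatten_map_range]
    simp [head, mul_comm]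
  have hrows : rows.length = ∑ r ∈ Finset.range q₁, (row r).length := length_flatten_map_range _ _
  let dict := q₁ :: (heads ++ rows)
  have hlen : dict.length = 1 + 2 * q₁ + rows.length := by
    simp [dict, hheads]; omega
  have hd : Seg dict 0 (q₁ :: (heads ++ rows)) := Seg.refl _
  have hdrows : ∀ r < q₁, Seg dict (off r) (row r) := by
    intro r hr
    have := hd.tail.right.trans (seg_flatten row q₁ r hr)
    rwa [hheads, zero_add] at this
  have hdheads : ∀ r < q₁, Seg dict (1 + 2 * r) (head r) := by
    intro r hr
    have := hd.tail.left.trans (seg_flatten head q₁ r hr)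
    have h2 : ∑ i ∈ Finset.range r, (head i).length = 2 * r := by simp [head, mul_comm]
    rwa [h2, zero_add] at this
  refine ⟨dict, ?_, ?_, ?_⟩
  · have hsum : ∑ r ∈ Finset.range q₁, q₂ r ≤ 2 ^ γ * (2 * S.card + S.card * 2 ^ γ) := by
      calc ∑ r ∈ Finset.range q₁, q₂ r
          ≤ ∑ r ∈ Finset.range q₁, ((cls r).card ^ 2 + 1) * 2 ^ γ :=
            Finset.sum_le_sum fun r _ => hq₂' r
        _ = (((collisions S q₁).card + S.card) + q₁) * 2 ^ γ := by
            rw [← Finset.sum_mul, Finset.sum_add_distrib, ← sum_card_sq_classes S hq₁]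
            simp [cls]
        _ ≤ _ := by
            rw [mul_comm]
            exact Nat.mul_le_mul_left _ (by omega)
    have : rows.length = (∑ r ∈ Finset.range q₁, q₂ r) * (P + 1) := by
      rw [hrows, Finset.sum_mul]
      exact Finset.sum_congr rfl fun r _ => hrow r
    rw [hlen, this]
    have h2 := Nat.mul_le_mul_right (P + 1) hsum
    have h3 : (P + 1) * 2 ^ γ * (2 * S.card + S.card * 2 ^ γ) =
      2 ^ γ * (2 * S.card + S.card * 2 ^ γ) * (P + 1) := by ring
    rw [h3]
    omega
  · intro x hx
    rcases List.mem_cons.1 hx with rfl | hx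
    · left; rw [hlen]; omega
    rcases List.mem_append.1 hx with hx | hx
    · obtain ⟨l, hl, hxl⟩ := List.mem_flatten.1 hx
      obtain ⟨r, hr, rfl⟩ := List.mem_map.1 hl
      rw [List.mem_range] at hr
      left
      have hle : off r + (row r).length ≤ dict.length :=
        (hdrows r hr).le_length (by
          intro h0
          have := hrow r
          rw [h0, List.length_nil] at this
          have := Nat.mul_pos (hq₂ r) (show 0 < P + 1 by omega)
          omega)
      have : q₂ r ≤ (row r).length := by rw [hrow]; exact Nat.le_mul_of_pos_right _ (Nat.succ_pos P)
      simp only [head, List.mem_cons, List.not_mem_nil, or_false] at hxl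
      rcases hxl with rfl | rfl <;> omega
    · obtain ⟨l, hl, hxl⟩ := List.mem_flatten.1 hx
      obtain ⟨r, hr, rfl⟩ := List.mem_map.1 hl
      obtain ⟨l, hl, hxl⟩ := List.mem_flatten.1 hxl
      obtain ⟨j, hj, rfl⟩ := List.mem_map.1 hl
      rcases List.mem_cons.1 hxl with rfl | hxl
      · right; left
        rcases hkey r j with h0 | h0
        · rw [h0]; positivity
        · exact hS _ h0
      · obtain ⟨g, -, rfl⟩ := List.mem_map.1 hxl
        right; right
        exact ⟨_, _, rfl⟩
  · intro κ hκ
    have hr : κ % q₁ < q₁ := Nat.mod_lt _ hq₁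
    have hj : κ % q₂ (κ % q₁) < q₂ (κ % q₁) := Nat.mod_lt _ (hq₂ _)
    have hs := (hdrows _ hr).trans (seg_flatten (slot (κ % q₁)) _ _ hj)
    have hsum : ∑ i ∈ Finset.range (κ % q₂ (κ % q₁)), (slot (κ % q₁) i).length =
      κ % q₂ (κ % q₁) * (P + 1) := by simp [hslot]
    rw [hsum] at hs
    have hiff : keyAt (κ % q₁) (κ % q₂ (κ % q₁)) = κ ↔ κ ∈ S := by
      constructor
      · intro he
        rcases hkey (κ % q₁) (κ % q₂ (κ % q₁)) with h0 | h0
        · omega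
        · rwa [he] at h0
      · intro hm
        have hf : (cls (κ % q₁)).filter (fun x => x % q₂ (κ % q₁) = κ % q₂ (κ % q₁)) = {κ} := by
          ext x
          rw [Finset.mem_filter, Finset.mem_singleton]
          constructor
          · rintro ⟨h1, h2⟩
            exact hinj _ _ h1 _ (Finset.mem_filter.2 ⟨hm, rfl⟩) h2
          · rintro rfl
            exact ⟨Finset.mem_filter.2 ⟨hm, rfl⟩, rfl⟩
        simp [keyAt, hf]
    refine ⟨q₁, q₂ (κ % q₁), off (κ % q₁), keyAt (κ % q₁) (κ % q₂ (κ % q₁)), hd.head,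
      (hdheads _ hr).head, ?_, hs.head, hiff, ?_⟩
    · have := (hdheads _ hr).tail.head
      rwa [show 1 + 2 * (κ % q₁) + 1 = 2 + 2 * (κ % q₁) by omega] at this
    · intro hm g hg
      refine hs.tail g _ ?_
      rw [List.getElem?_map, List.getElem?_range hg, hiff.2 hm]
      rfl

/-! ## Counting in a small universe by binary search over prefixes -/

/-- The variables used by the search inside a bucket: base address of the cells, cells per word,
bits per cell, bits per level, cells per slot, first cell of the bucket, and the argument. -/
structure BucketVars (V : Type) where
  base : V
  perWord : V
  width : V
  step : V
  slot : V
  start : V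
  arg : V

/-- A cell of the global cell array. -/
def cell {V : Type} (p : BucketVars V) (i : Tm V) : Tm V :=
  readCell (.var p.base) (.var p.perWord) (.var p.width) i

/-- The slot of a key in the dictionary of a bucket. -/
def lookup {V : Type} (p : BucketVars V) (κ : V) : Tm V :=
  .bind (.var κ % cell p (.var p.start)) fun r =>
    .var p.start + (cell p (.var p.start + (.cst 2 + .cst 2 * .var r)) +
      (.var κ % cell p (.var p.start + (.cst 1 + .cst 2 * .var r))) * .var p.slot)

/-- Binary search, in `e` rounds, for the longest prefix of the argument that is a key; `r` is the
number of levels cut off from a prefix known to be a key, whose slot is `s`. -/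
def search {V : Type} (p : BucketVars V) : ℕ → V → V → Tm V
  | 0, r, s =>
    .bind ((Tm.var p.arg).shr (.var p.step * (.var r - .cst 1)) % (Tm.cst 1).shl (.var p.step))
      fun g => cell p (.var s + (.cst 1 + .var g))
  | e + 1, r, s =>
    .bind (.var r - .cst (2 ^ e)) fun r' =>
    .bind ((Tm.var p.arg).shr (.var p.step * .var r')) fun κ =>
    .bind (lookup p κ) fun s' =>
    .bind (cell p (.var s')) fun κ' =>
    .bind (.ifEQ (.var κ') (.var κ) (.var r') (.var r)) fun r₂ =>
    .bind (.ifEQ (.var κ') (.var κ) (.var s') (.var s)) fun s₂ =>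
    search p e r₂ s₂

/-- The number of elements of the bucket below the argument. -/
def bucketCount {V : Type} (e : ℕ) (p : BucketVars V) : Tm V :=
  .bind (.cst (2 ^ e)) fun D =>
  .bind (.cst 1) fun one =>
  .bind (lookup p one) fun s => search p e D s

/-! ### Tries of prefixes and the longest prefix present. -/

section Bucket

/-- The nonempty prefixes, cut at multiples of `h`, of the numbers `2 ^ (D * h) + z`, `z ∈ Z`. -/
def prefixes (D h : ℕ) (Z : Finset ℕ) : Finset ℕ :=
  (Finset.Icc 1 D).biUnion fun r => Z.image fun z => (2 ^ (D * h) + z) / 2 ^ (h * r)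

/-- The number of levels cut off from a prefix. -/
def cutOff (D h κ : ℕ) : ℕ := D - Nat.log 2 κ / h

/-- The number of elements of `Z` below the child `g` of the prefix `κ`. -/
def childCount (D h : ℕ) (Z : Finset ℕ) (κ g : ℕ) : ℕ :=
  (Z.filter fun z => 2 ^ (D * h) + z < (κ * 2 ^ h + g) * 2 ^ (h * (cutOff D h κ - 1))).card

variable {D h : ℕ} {Z : Finset ℕ}

/-- The leading one of `2 ^ (D * h) + z` records the length of a prefix. Prefixes of different
levels are therefore different numbers, and one dictionary serves all levels. -/
theorem cutOff_prefix (hh : 1 ≤ h) {x r : ℕ} (h1 : 2 ^ (D * h) ≤ x) (h2 : x < 2 ^ (D * h + 1))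
    (hr : r ≤ D) : cutOff D h (x / 2 ^ (h * r)) = r := by
  have hlog : Nat.log 2 (x / 2 ^ (h * r)) = h * (D - r) := by
    have e1 : D * h = h * (D - r) + h * r := by
      rw [← mul_add, Nat.sub_add_cancel hr, mul_comm]
    rw [e1, pow_add] at h1
    rw [e1, add_right_comm, pow_add] at h2
    refine Nat.log_eq_of_pow_le_of_lt_pow ?_ ?_
    · rwa [Nat.le_div_iff_mul_le (by positivity)]
    · rwa [Nat.div_lt_iff_lt_mul (by positivity)]
  rw [cutOff, hlog, Nat.mul_div_cancel_left _ hh]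
  omega

theorem mem_prefixes_iff (hh : 1 ≤ h) (hZ : ∀ z ∈ Z, z < 2 ^ (D * h)) {x r : ℕ}
    (h1 : 2 ^ (D * h) ≤ x) (h2 : x < 2 ^ (D * h + 1)) (hr : 1 ≤ r) (hrD : r ≤ D) :
    x / 2 ^ (h * r) ∈ prefixes D h Z ↔
      ∃ z ∈ Z, (2 ^ (D * h) + z) / 2 ^ (h * r) = x / 2 ^ (h * r) := by
  simp only [prefixes, Finset.mem_biUnion, Finset.mem_image, Finset.mem_Icc]
  constructor
  · rintro ⟨r', ⟨-, hr'⟩, z, hz, he⟩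
    have hz' := hZ z hz
    have e1 := cutOff_prefix hh (x := 2 ^ (D * h) + z) (by omega) (by rw [pow_succ]; omega) hr'
    rw [he, cutOff_prefix hh h1 h2 hrD] at e1
    subst e1
    exact ⟨z, hz, he⟩
  · rintro ⟨z, hz, he⟩
    exact ⟨r, ⟨hr, hrD⟩, z, hz, he⟩

theorem prefixes_lt (hZ : ∀ z ∈ Z, z < 2 ^ (D * h)) {κ : ℕ} (hκ : κ ∈ prefixes D h Z) :
    κ < 2 ^ (D * h + 1) := by
  simp only [prefixes, Finset.mem_biUnion, Finset.mem_image] at hκ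
  obtain ⟨r, -, z, hz, rfl⟩ := hκ
  have := hZ z hz
  refine (Nat.div_le_self _ _).trans_lt ?_
  rw [pow_succ]; omega

theorem card_prefixes_le : (prefixes D h Z).card ≤ D * Z.card := by
  refine Finset.card_biUnion_le.trans ?_
  refine (Finset.sum_le_card_nsmul _ _ _ fun r _ => Finset.card_image_le).trans ?_
  simp

/-- Prefixes of a present prefix are present, so presence is monotone in the number `r` of levels
cut off, with threshold `r₀`. No element of `Z` lies in the child of that node towards `x` (if `r₀ =
1`, the child is `x` itself), so the elements below `x` are those below the whole child, a number
stored at the node. -/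
theorem exists_longest_prefix (hh : 1 ≤ h) (hD : 1 ≤ D) (hne : Z.Nonempty)
    (hZ : ∀ z ∈ Z, z < 2 ^ (D * h)) {x : ℕ}
    (h1 : 2 ^ (D * h) ≤ x) (h2 : x < 2 ^ (D * h + 1)) :
    ∃ r₀, 1 ≤ r₀ ∧ r₀ ≤ D ∧
      (∀ r, 1 ≤ r → r ≤ D → (x / 2 ^ (h * r) ∈ prefixes D h Z ↔ r₀ ≤ r)) ∧
      childCount D h Z (x / 2 ^ (h * r₀)) (x / 2 ^ (h * (r₀ - 1)) % 2 ^ h) =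
        (Z.filter fun z => 2 ^ (D * h) + z < x).card := by
  classical
  have hone : ∀ y, 2 ^ (D * h) ≤ y → y < 2 ^ (D * h + 1) → y / 2 ^ (h * D) = 1 := by
    intro y h1 h2
    rw [mul_comm h D]
    rw [pow_succ] at h2
    exact Nat.div_eq_of_lt_le (by omega) (by omega)
  have hex : ∃ r, 1 ≤ r ∧ r ≤ D ∧ x / 2 ^ (h * r) ∈ prefixes D h Z := by
    obtain ⟨z, hz⟩ := hne
    have := hZ z hz
    refine ⟨D, hD, le_rfl, (mem_prefixes_iff hh hZ h1 h2 hD le_rfl).2 ⟨z, hz, ?_⟩⟩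
    rw [hone x h1 h2, hone _ (by omega) (by rw [pow_succ]; omega)]
  have hr₀ := Nat.find_spec hex
  set r₀ := Nat.find hex with hr₀def
  obtain ⟨hr1, hrD, hmem⟩ := hr₀
  refine ⟨r₀, hr1, hrD, fun r hr hrD' => ⟨fun hm => Nat.find_min' hex ⟨hr, hrD', hm⟩, ?_⟩, ?_⟩
  · intro hle
    obtain ⟨z, hz, he⟩ := (mem_prefixes_iff hh hZ h1 h2 hr1 hrD).1 hmem
    refine (mem_prefixes_iff hh hZ h1 h2 hr hrD').2 ⟨z, hz, ?_⟩
    have : h * r = h * r₀ + h * (r - r₀) := by rw [← mul_add]; congr 1; omega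
    rw [this, pow_add, ← Nat.div_div_eq_div_mul, ← Nat.div_div_eq_div_mul, he]
  · have hchild : x / 2 ^ (h * r₀) * 2 ^ h + x / 2 ^ (h * (r₀ - 1)) % 2 ^ h =
        x / 2 ^ (h * (r₀ - 1)) := by
      have e : h * r₀ = h * (r₀ - 1) + h := by
        rw [← Nat.mul_succ]; congr 1; omega
      rw [e, pow_add, ← Nat.div_div_eq_div_mul, Nat.div_add_mod']
    rw [childCount, cutOff_prefix hh h1 h2 hrD, hchild]
    congr 1
    refine Finset.filter_congr fun z hz => ?_
    set q := 2 ^ (h * (r₀ - 1)) with hq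
    have hq0 : 0 < q := by positivity
    constructor
    · exact fun hlt => hlt.trans_le (Nat.div_mul_le_self _ _)
    · intro hlt
      rw [← Nat.div_lt_iff_lt_mul hq0]
      refine lt_of_le_of_ne (Nat.div_le_div_right hlt.le) fun he => ?_
      -- An element with the child's prefix would equal `x` if `r₀ = 1`, and would contradict the
      -- minimality of `r₀` otherwise.
      rcases Nat.eq_or_lt_of_le hr1 with h0 | h0
      · rw [hq, ← h0] at he
        simp at he
        omega
      · have := Nat.find_min' hex (m := r₀ - 1) ⟨by omega, by omega,
          (mem_prefixes_iff hh hZ h1 h2 (by omega) (by omega)).2 ⟨z, hz, he⟩⟩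
        omega

end Bucket

/-! ### Correctness of the search inside a bucket. -/

section Search

variable {w Nc : ℕ} {M : List (BitVec w)} {c : ℕ → ℕ} {p : BucketVars ℕ}

/-- The terms for cells of the global cell array evaluate correctly. -/
def CellsOK (M : List (BitVec w)) (c : ℕ → ℕ) (Nc : ℕ) (p : BucketVars ℕ) : Prop :=
  ∀ i ≤ Nc, ∀ t, Ev M t i → Ev M (cell p t) (c i)

/-- The cells from `p.start` on hold the list `l`. -/
def CellSeg (c : ℕ → ℕ) (Nc a : ℕ) (l : List ℕ) : Prop :=
  ∀ i v, l[i]? = some v → c (a + i) = v ∧ a + i ≤ Nc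

theorem ev_lookup {S : Finset ℕ} {P : ℕ} {pay : ℕ → ℕ → ℕ} {dict : List ℕ} (hw : 2 ≤ w)
    (hNc : Nc < 2 ^ w) (hcw : ∀ i, c i < 2 ^ w)
    (hc : CellsOK M c Nc p) (hseg : CellSeg c Nc p.start dict) (hP : p.slot = P + 1)
    {κ : ℕ} (hκw : κ < 2 ^ w)
    (hspec : ∃ q₁ q₂ o κ', dict[0]? = some q₁ ∧ dict[1 + 2 * (κ % q₁)]? = some q₂ ∧
        dict[2 + 2 * (κ % q₁)]? = some o ∧ dict[o + κ % q₂ * (P + 1)]? = some κ' ∧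
        (κ' = κ ↔ κ ∈ S) ∧
        (κ ∈ S → ∀ g < P, dict[o + κ % q₂ * (P + 1) + 1 + g]? = some (pay κ g))) :
    ∃ s, Ev M (lookup p κ) s ∧ s ≤ Nc ∧ (c s = κ ↔ κ ∈ S) ∧
      (κ ∈ S → ∀ g < P, c (s + (1 + g)) = pay κ g ∧ s + (1 + g) ≤ Nc) := by
  obtain ⟨q₁, q₂, o, κ', h0, h1, h2, h3, hiff, hpay⟩ := hspec
  obtain ⟨c0, l0⟩ := hseg _ _ h0
  obtain ⟨c1, l1⟩ := hseg _ _ h1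
  obtain ⟨c2, l2⟩ := hseg _ _ h2
  obtain ⟨c3, l3⟩ := hseg _ _ h3
  rw [add_zero] at c0 l0
  have hv : ∀ x : ℕ, Ev M (.var x) x := Ev.var
  have h2w : 2 < 2 ^ w := by
    calc 2 < 2 ^ 2 := by norm_num
      _ ≤ 2 ^ w := Nat.pow_le_pow_right (by norm_num) hw
  have hq1 : q₁ < 2 ^ w := c0 ▸ hcw _
  have hq2 : q₂ < 2 ^ w := c1 ▸ hcw _
  refine ⟨p.start + (o + κ % q₂ * (P + 1)), ?_, l3, ?_, ?_⟩
  · have e0 : Ev M (cell p (.var p.start)) q₁ := c0 ▸ hc _ l0 _ (hv _)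
    refine Ev.bind (x := κ % q₁) ((hv κ).mod e0 hκw hq1) ?_
    set r := κ % q₁ with hr
    have e1 : Ev M (cell p (.var p.start + (.cst 1 + .cst 2 * .var r))) q₂ :=
      c1 ▸ hc _ l1 _ ((hv _).add ((Ev.lit (by omega)).add
        ((Ev.lit (by omega)).mul (hv r) (by omega)) (by omega)) (by omega))
    have e2 : Ev M (cell p (.var p.start + (.cst 2 + .cst 2 * .var r))) o :=
      c2 ▸ hc _ l2 _ ((hv _).add ((Ev.lit (by omega)).add
        ((Ev.lit (by omega)).mul (hv r) (by omega)) (by omega)) (by omega))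
    have e3 : Ev M (.var p.slot) (P + 1) := hP ▸ hv _
    exact (hv _).add (e2.add (((hv κ).mod e1 hκw hq2).mul e3 (by omega)) (by omega)) (by omega)
  · rw [c3, hiff]
  · intro hm g hg
    have := hseg _ _ (hpay hm g hg)
    rwa [add_assoc (o + _), ← add_assoc p.start] at this

/-- Invariant with `e` rounds left: `r₀ ≤ r < r₀ + 2 ^ e`, and `s` is the slot of the prefix with
`r` levels cut off. Testing `r - 2 ^ (e - 1)` halves the uncertainty, and `2 ^ e ≤ r` keeps the
tested level at least `1`. -/
theorem ev_search {S : Finset ℕ} {D h r₀ : ℕ} {pay : ℕ → ℕ → ℕ} {dict : List ℕ}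
    (hw : 2 ≤ w) (hDw : D < 2 ^ w) (hDhw : D * h < w)
    (hNc : Nc < 2 ^ w) (hcw : ∀ i, c i < 2 ^ w) (hxw : p.arg < 2 ^ w) (hx : 2 ^ (D * h) ≤ p.arg)
    (hc : CellsOK M c Nc p) (hseg : CellSeg c Nc p.start dict) (hP : p.slot = 2 ^ h + 1)
    (hstep : p.step = h)
    (hspec : ∀ κ, 1 ≤ κ → ∃ q₁ q₂ o κ', dict[0]? = some q₁ ∧ dict[1 + 2 * (κ % q₁)]? = some q₂ ∧
        dict[2 + 2 * (κ % q₁)]? = some o ∧ dict[o + κ % q₂ * (2 ^ h + 1)]? = some κ' ∧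
        (κ' = κ ↔ κ ∈ S) ∧
        (κ ∈ S → ∀ g < 2 ^ h, dict[o + κ % q₂ * (2 ^ h + 1) + 1 + g]? = some (pay κ g)))
    (hr₀ : 1 ≤ r₀) (hS : ∀ r, 1 ≤ r → r ≤ D → (p.arg / 2 ^ (h * r) ∈ S ↔ r₀ ≤ r)) :
    ∀ (e r s : ℕ), 2 ^ e ≤ r → r ≤ D → r₀ ≤ r → r < r₀ + 2 ^ e →
      (∀ g < 2 ^ h, c (s + (1 + g)) = pay (p.arg / 2 ^ (h * r)) g ∧ s + (1 + g) ≤ Nc) →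
      Ev M (search p e r s)
        (pay (p.arg / 2 ^ (h * r₀)) (p.arg / 2 ^ (h * (r₀ - 1)) % 2 ^ h)) := by
  have hv : ∀ x : ℕ, Ev M (.var x) x := Ev.var
  have hww : w < 2 ^ w := Nat.lt_two_pow_self
  have eh : Ev M (.var p.step) h := hstep ▸ hv _
  have hhw : ∀ r ≤ D, h * r < 2 ^ w := by
    intro r hr
    have := Nat.mul_le_mul_left h hr
    rw [mul_comm h D] at this
    omega
  intro e
  induction e with
  | zero =>
    intro r s h1 hrD h2 h3 hs
    obtain rfl : r = r₀ := by omega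
    have hg := hs (p.arg / 2 ^ (h * (r - 1)) % 2 ^ h) (Nat.mod_lt _ (by positivity))
    have h2h : 2 ^ h < 2 ^ w := by
      refine Nat.pow_lt_pow_right (by norm_num) (lt_of_le_of_lt ?_ hDhw)
      exact Nat.le_mul_of_pos_left _ (by omega)
    refine Ev.bind (x := p.arg / 2 ^ (h * (r - 1)) % 2 ^ h) ?_ ?_
    · refine Ev.mod (Ev.shr (hv _) (eh.mul ((hv r).sub (Ev.lit (by omega)) (by omega) hr₀)
        (hhw _ (by omega))) hxw (hhw _ (by omega))) ?_ ((Nat.div_le_self _ _).trans_lt hxw) h2h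
      have := Ev.shl (Ev.lit (M := M) (c := 1) (by omega)) eh (by
        have : h < 2 ^ h := Nat.lt_two_pow_self
        omega) (by simpa using h2h)
      simpa using this
    · rw [← hg.1]
      exact hc _ hg.2 _ ((hv s).add ((Ev.lit (by omega)).add (hv _) (by omega)) (by omega))
  | succ e ih =>
    intro r s h1 hrD h2 h3 hs
    rw [pow_succ] at h1 h3
    have hpos : 1 ≤ 2 ^ e := Nat.one_le_two_pow
    have hκ1 : 1 ≤ p.arg / 2 ^ (h * (r - 2 ^ e)) := by
      rw [Nat.le_div_iff_mul_le (by positivity), one_mul]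
      refine le_trans (Nat.pow_le_pow_right (by norm_num) ?_) hx
      rw [mul_comm D h]
      exact Nat.mul_le_mul_left _ (by omega)
    have hκw : p.arg / 2 ^ (h * (r - 2 ^ e)) < 2 ^ w := (Nat.div_le_self _ _).trans_lt hxw
    obtain ⟨s', es', hs'N, hiff, hpay⟩ :=
      ev_lookup (S := S) hw hNc hcw hc hseg hP hκw (hspec _ hκ1)
    refine Ev.bind (x := r - 2 ^ e) ((hv r).sub (Ev.lit (by omega)) (by omega) (by omega)) ?_
    refine Ev.bind (x := p.arg / 2 ^ (h * (r - 2 ^ e)))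
      (Ev.shr (hv _) (eh.mul (hv _) (hhw _ (by omega))) hxw (hhw _ (by omega))) ?_
    refine Ev.bind es' (Ev.bind (hc s' hs'N _ (hv s')) ?_)
    rw [hS _ (by omega) (by omega)] at hiff hpay
    by_cases hle : r₀ ≤ r - 2 ^ e
    · refine Ev.bind (Ev.ifEQ_true (hv _) (hv _) (hiff.2 hle) (hv _)) ?_
      refine Ev.bind (Ev.ifEQ_true (hv _) (hv _) (hiff.2 hle) (hv _)) ?_
      exact ih _ _ (by omega) (by omega) hle (by omega) (hpay hle)
    · have hne := mt hiff.1 hle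
      refine Ev.bind (Ev.ifEQ_false (hv _) (hv _) hne (hv _)) ?_
      refine Ev.bind (Ev.ifEQ_false (hv _) (hv _) hne (hv _)) ?_
      exact ih _ _ (by omega) hrD h2 (by omega) hs

/-- At most `D * k` prefixes (`k = Z.card`), each with `2 ^ h` child counts, hashed with `γ = h`,
need at most `7 * D * k * 2 ^ (3 * h)` cells; this explains the assumption `7 * 2 ^ e ≤ 2 ^ h`.
Zeros pad the dictionary to exactly `k * 2 ^ (4 * h)` cells, so that the position of a bucket
follows from the number of jumps before it and no pointers are needed. -/
theorem exists_bucket {e h : ℕ} {Z : Finset ℕ} (hh : 1 ≤ h) (hD : 7 * 2 ^ e ≤ 2 ^ h)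
    (hγ : (2 * (2 ^ e * h + 1) + 1 + h) * (2 ^ e * h + 2) ≤ 2 ^ (h - 1))
    (hZ : ∀ z ∈ Z, z < 2 ^ (2 ^ e * h)) :
    ∃ l : List ℕ, l.length = Z.card * 2 ^ (4 * h) ∧ (∀ v ∈ l, v < 2 ^ ((2 ^ e + 6) * h)) ∧
      (Z.Nonempty → ∀ (w : ℕ) (M : List (BitVec w)) (c : ℕ → ℕ) (Nc : ℕ) (p : BucketVars ℕ) (x : ℕ),
        2 ^ e * h + 1 < w → Nc < 2 ^ w → (∀ i, c i < 2 ^ w) → x < 2 ^ (2 ^ e * h) →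
        p.arg = 2 ^ (2 ^ e * h) + x → CellsOK M c Nc p → CellSeg c Nc p.start l →
        p.slot = 2 ^ h + 1 → p.step = h →
        Ev M (bucketCount e p) (Z.filter fun z => z < x).card) := by
  rcases Z.eq_empty_or_nonempty with rfl | hne
  -- An empty bucket has no root to look up; the evaluation of step functions skips it by comparing
  -- consecutive counts.
  · exact ⟨[], by simp, by simp, fun h => absurd h (by simp)⟩
  set D := 2 ^ e with hDdef
  have hD1 : 1 ≤ D := Nat.one_le_two_pow
  set L := D * h with hL
  have hLL : 2 ^ (D * h) = 2 ^ L := rfl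
  have hLpos : 1 ≤ L := Nat.mul_pos hD1 hh
  have hSne : (prefixes D h Z).Nonempty := by
    obtain ⟨z, hz⟩ := hne
    have := hZ z hz
    have := (mem_prefixes_iff (Z := Z) hh hZ (x := 2 ^ (D * h) + z) (r := 1) (by omega)
      (by rw [pow_succ]; omega) le_rfl hD1).2 ⟨z, hz, rfl⟩
    exact ⟨_, this⟩
  obtain ⟨dict, hlen, hent, hspec⟩ := exists_dictionary (S := prefixes D h Z) (b := L + 1) (γ := h)
    (2 ^ h) (childCount D h Z) (fun x hx => prefixes_lt hZ hx) hSne (by omega) hh hγ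
  have hk : 1 ≤ Z.card := hne.card_pos
  have hkL : Z.card ≤ 2 ^ L := by
    have : Z ⊆ Finset.range (2 ^ L) := fun x hx => Finset.mem_range.2 (hZ x hx)
    simpa using Finset.card_le_card this
  have hlen' : dict.length ≤ Z.card * 2 ^ (4 * h) := by
    have hN := card_prefixes_le (D := D) (h := h) (Z := Z)
    set N := (prefixes D h Z).card
    set k := Z.card
    have hH : 2 ≤ 2 ^ h := by
      calc 2 = 2 ^ 1 := rfl
        _ ≤ 2 ^ h := Nat.pow_le_pow_right (by norm_num) hh
    have e4 : 2 ^ (4 * h) = 2 ^ h * 2 ^ h * 2 ^ h * 2 ^ h := by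
      rw [← pow_add, ← pow_add, ← pow_add]; congr 1; ring
    rw [e4]
    generalize 2 ^ h = H at *
    have hA : 1 ≤ k * (D * (H * H * H)) :=
      Nat.mul_pos hk (Nat.mul_pos hD1 (by positivity))
    calc dict.length ≤ 1 + 2 * (N * H) + (H + 1) * H * (2 * N + N * H) := hlen
      _ = 1 + N * (2 * H + (H + 1) * H * (2 + H)) := by ring
      _ ≤ 1 + D * k * (6 * (H * H * H)) := by
          refine Nat.add_le_add_left (Nat.mul_le_mul hN ?_) _
          nlinarith [mul_nonneg (Nat.zero_le H) (Nat.zero_le H), mul_le_mul hH hH (by omega) (by omega),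
            Nat.mul_le_mul_right (H * H) hH, Nat.mul_le_mul_right H hH]
      _ ≤ k * (D * (H * H * H)) + D * k * (6 * (H * H * H)) := by omega
      _ = k * (H * H * H) * (7 * D) := by ring
      _ ≤ k * (H * H * H) * H := Nat.mul_le_mul_left _ hD
      _ = _ := by ring
  have hf : 2 ^ (L + 4 * h) < 2 ^ ((D + 6) * h) :=
    Nat.pow_lt_pow_right (by norm_num) (by rw [add_mul]; omega)
  have hlenf : dict.length < 2 ^ ((D + 6) * h) := by
    refine hlen'.trans_lt (lt_of_le_of_lt ?_ hf)
    rw [pow_add]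
    exact Nat.mul_le_mul_right _ hkL
  have hLf : 2 ^ (L + 1) < 2 ^ ((D + 6) * h) :=
    lt_of_le_of_lt (Nat.pow_le_pow_right (by norm_num) (by omega)) hf
  refine ⟨dict ++ List.replicate (Z.card * 2 ^ (4 * h) - dict.length) 0, by simp; omega, ?_, ?_⟩
  · intro v hv
    rcases List.mem_append.1 hv with hv | hv
    · rcases hent v hv with h1 | h1 | ⟨κ, g, rfl⟩
      · omega
      · omega
      · have : childCount D h Z κ g ≤ Z.card := Finset.card_filter_le _ _
        rw [pow_succ] at hLf
        omega
    · rw [List.eq_of_mem_replicate hv]; positivity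
  · intro _ w M c Nc p x hw hNc hcw hx hp hc hseg hslot hstep
    have hww : w < 2 ^ w := Nat.lt_two_pow_self
    have hDw : D < 2 ^ w := lt_of_le_of_lt (Nat.le_mul_of_pos_right D hh) (by omega)
    have hargw : p.arg < 2 ^ (L + 1) := by rw [hp, pow_succ]; omega
    have hLw : 2 ^ (L + 1) < 2 ^ w := Nat.pow_lt_pow_right (by norm_num) hw
    have hseg' : CellSeg c Nc p.start dict := fun i v hi => hseg i v (by
      obtain ⟨hlt, -⟩ := List.getElem?_eq_some_iff.1 hi
      rw [List.getElem?_append_left hlt]; exact hi)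
    obtain ⟨r₀, hr1, hrD, hS, hcount⟩ := exists_longest_prefix hh hD1 hne hZ (x := p.arg)
      (by rw [hp]; omega) hargw
    have hone : p.arg / 2 ^ (h * D) = 1 := by
      rw [mul_comm h D, ← hL]
      rw [pow_succ] at hargw
      exact Nat.div_eq_of_lt_le (by omega) (by omega)
    obtain ⟨s, es, -, -, hpay⟩ := ev_lookup (S := prefixes D h Z) (by omega) hNc hcw hc hseg' hslot
      (κ := 1) (by omega) (hspec 1 le_rfl)
    have h1S : 1 ∈ prefixes D h Z := by
      rw [← hone]; exact (hS D hD1 le_rfl).2 hrD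
    have hfin : (Z.filter fun z => z < x) = Z.filter fun z => 2 ^ (D * h) + z < p.arg :=
      Finset.filter_congr fun z _ => by rw [hp]; omega
    rw [hfin, ← hcount]
    refine Ev.bind (Ev.lit hDw) (Ev.bind (Ev.lit (by omega)) (Ev.bind es ?_))
    refine ev_search (by omega) hDw (by omega) hNc hcw (by omega) (by rw [hp]; omega) hc hseg' hslot hstep
      hspec hr1 hS e D s le_rfl le_rfl hrD (by omega) ?_
    rw [hone]
    exact hpay h1S

end Search

/-! ## Evaluation of step functions -/

/-- The value at `v` of the step function whose six header words start at address `H`. -/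
def stepValue {V : Type} (e H : ℕ) (v : V) : Tm V :=
  .ifEQ (.ld (.cst H)) (.cst 0) (access (.ld (.cst (H + 1))) (.var v)) <|
    .bind (.ld (.cst (H + 3))) fun cb =>
    .bind (.ld (.cst (H + 4))) fun f =>
    .bind (.ld (.cst (H + 5))) fun h =>
    .bind (Tm.ld (.cst 0) / .var f) fun q =>
    .bind ((Tm.cst 1).shl (.cst (2 ^ e) * .var h)) fun W =>
    .bind (.var v / .var W) fun j =>
    .bind (access (.ld (.cst (H + 1))) (.var j)) fun a =>
    .bind (access (.ld (.cst (H + 1))) (.var j + .cst 1)) fun b =>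
    .bind ((Tm.cst 1).shl (.var h) + .cst 1) fun s =>
    .bind (.var a * (Tm.cst 1).shl (.cst 4 * .var h)) fun R =>
    .bind (.var W + .var v % .var W) fun X =>
    .bind (.ifEQ (.var a) (.var b) (.cst 0) (bucketCount e ⟨cb, q, f, h, s, R, X⟩)) fun l =>
    access (.ld (.cst (H + 2))) (.var a + .var l)

/-- The header `hdr` and the body, placed at address `A`, represent `F` on `{0, …, m}`. -/
def Represents (w β e A m : ℕ) (row : (ℕ → ℕ) → ℕ) (F : ℕ → ℕ) (hdr body : List ℕ) : Prop :=
  hdr.length = 6 ∧ ∀ (M : List (BitVec w)) (H : ℕ), M.length ≤ 2 ^ w → Reads M 0 w → Reads M 1 β →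
    HasPatterns M β row → Holds M H hdr → Holds M A body → ∀ v ≤ m, Ev M (stepValue e H v) (F v)

theorem holds_monoArray_lt {w β A N : ℕ} {a : ℕ → ℕ} {row : (ℕ → ℕ) → ℕ} {M : List (BitVec w)}
    (hM : M.length ≤ 2 ^ w) (h : Holds M A (monoArray w β a N row A)) : A < 2 ^ w := by
  refine lt_of_lt_of_le (h.lt_length (i := 0) ?_) hM
  rw [monoArray, List.length_append, length_flatten_map_range, Finset.sum_range_succ]
  simp [blockEntry]

/-- Header flag `0`: all values of `F` are stored. This is cheap only when `m = O(n)` or `w` is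
bounded. -/
theorem represents_direct {w β e A m n : ℕ} {row : (ℕ → ℕ) → ℕ} {F : ℕ → ℕ} (hw : 3 ≤ w)
    (hβ : 4 ≤ β) (hm : m < 2 ^ w) (hn : n < 2 ^ w) (hF : Monotone F) (hFn : ∀ i, F i ≤ n) :
    Represents w β e A m row F [0, A, 0, 0, 0, 0] (monoArray w β F m row A) := by
  refine ⟨rfl, fun M H hM h0 h1 hp hH hA v hv => ?_⟩
  have hAw : A < 2 ^ w := holds_monoArray_lt hM hA
  have r0 : Reads M H 0 := hH.reads_head (by positivity)
  have r1 : Reads M (H + 1) A := hH.reads (i := 1) rfl hAw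
  have hHw : H + 1 < 2 ^ w := r1.lt_length.trans_le hM
  refine Ev.ifEQ_true ((Ev.lit (by omega)).load r0) (Ev.lit (by omega)) rfl ?_
  exact ev_access hβ hw hn hF hFn hM h0 h1 hp hA hv (by omega)
    ((Ev.lit (by omega)).load r1) (.var _)

/-! ### Step functions through their jumps. -/

section Structured

/-- The arguments below `m` at which `F` jumps. -/
def jumps (F : ℕ → ℕ) (m : ℕ) : Finset ℕ := (Finset.range m).filter fun v => F v < F (v + 1)

/-- The number of elements of `Y` below `v`. -/
def countBelow (Y : Finset ℕ) (v : ℕ) : ℕ := (Y.filter fun y => y < v).card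

/-- The elements of `Y` in the interval of length `W` from `a` on, relative to `a`. -/
def window (Y : Finset ℕ) (a W : ℕ) : Finset ℕ := (Finset.range W).filter fun z => a + z ∈ Y

/-- The largest value of `F` on `{0, …, m}` before its jump number `t + 1`. -/
def valueAfter (F : ℕ → ℕ) (m t : ℕ) : ℕ :=
  ((Finset.range (m + 1)).filter fun v => countBelow (jumps F m) v ≤ t).sup F

variable {F : ℕ → ℕ} {m n : ℕ}

theorem countBelow_mono (Y : Finset ℕ) : Monotone (countBelow Y) := fun _ _ h =>
  Finset.card_le_card fun y hy => by
    rw [Finset.mem_filter] at hy ⊢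
    exact ⟨hy.1, hy.2.trans_le h⟩

theorem countBelow_le (Y : Finset ℕ) (v : ℕ) : countBelow Y v ≤ Y.card :=
  Finset.card_filter_le _ _

theorem countBelow_add (Y : Finset ℕ) {a W x : ℕ} (hx : x ≤ W) :
    countBelow Y (a + x) = countBelow Y a + ((window Y a W).filter fun z => z < x).card := by
  have himg : ((window Y a W).filter fun z => z < x).card =
      (Y.filter fun y => a ≤ y ∧ y < a + x).card := by
    refine Finset.card_bij (fun z _ => a + z) ?_ ?_ ?_
    · intro z hz
      simp only [window, Finset.mem_filter, Finset.mem_range] at hz ⊢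
      exact ⟨hz.1.2, by omega, by omega⟩
    · intro z _ z' _ h; omega
    · intro y hy
      rw [Finset.mem_filter] at hy
      refine ⟨y - a, ?_, by omega⟩
      simp only [window, Finset.mem_filter, Finset.mem_range]
      rw [show a + (y - a) = y by omega]
      exact ⟨⟨by omega, hy.1⟩, by omega⟩
  rw [himg, countBelow, countBelow, ← Finset.card_union_of_disjoint]
  · congr 1
    ext y
    simp only [Finset.mem_union, Finset.mem_filter]
    constructor
    · rintro ⟨h1, h2⟩
      rcases lt_or_ge y a with h | h
      · exact Or.inl ⟨h1, h⟩
      · exact Or.inr ⟨h1, h, h2⟩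
    · rintro (⟨h1, h2⟩ | ⟨h1, h2, h3⟩)
      · exact ⟨h1, by omega⟩
      · exact ⟨h1, h3⟩
  · rw [Finset.disjoint_filter]
    intro y _ h1 h2; omega

theorem countBelow_window (Y : Finset ℕ) (a W : ℕ) :
    countBelow Y (a + W) = countBelow Y a + (window Y a W).card := by
  rw [countBelow_add Y le_rfl, Finset.filter_true_of_mem (s := window Y a W)]
  intro z hz
  simp only [window, Finset.mem_filter, Finset.mem_range] at hz
  exact hz.1

/-- Each jump raises `F` by at least one and the increments telescope to at most `n`. -/
theorem card_jumps_le (hF : Monotone F) (hFn : ∀ i, F i ≤ n) : (jumps F m).card ≤ n := by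
  have h1 : (jumps F m).card ≤ ∑ v ∈ Finset.range m, (F (v + 1) - F v) := by
    rw [jumps, Finset.card_filter]
    refine Finset.sum_le_sum fun v _ => ?_
    split_ifs <;> omega
  rw [Finset.sum_range_tsub hF] at h1
  exact h1.trans ((Nat.sub_le _ _).trans (hFn _))

theorem valueAfter_mono : Monotone (valueAfter F m) := fun _ _ h =>
  Finset.sup_mono fun v hv => by
    rw [Finset.mem_filter] at hv ⊢
    exact ⟨hv.1, hv.2.trans h⟩

theorem valueAfter_le (hFn : ∀ i, F i ≤ n) (t : ℕ) : valueAfter F m t ≤ n :=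
  Finset.sup_le fun v _ => hFn v

/-- A larger value at a later argument forces a jump in between, hence a larger count. A separate
array of values is needed because a jump may exceed one. -/
theorem valueAfter_countBelow (hF : Monotone F) {v : ℕ} (hv : v ≤ m) :
    valueAfter F m (countBelow (jumps F m) v) = F v := by
  refine le_antisymm (Finset.sup_le fun u hu => ?_) (Finset.le_sup (f := F) ?_)
  · rw [Finset.mem_filter, Finset.mem_range] at hu
    by_contra! hlt
    have huv : v < u := by
      by_contra! h
      exact absurd (hF h) (by omega)
    have : ∃ y, v ≤ y ∧ y < u ∧ F y < F (y + 1) := by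
      by_contra! hno
      have hle : ∀ y, v ≤ y → y ≤ u → F y ≤ F v := by
        intro y hy
        induction y, hy using Nat.le_induction with
        | base => intro; exact le_rfl
        | succ y hy ih =>
          intro hyu
          exact (hno y hy (by omega)).trans (ih (by omega))
      have := hle u huv.le le_rfl
      omega
    obtain ⟨y, h1, h2, h3⟩ := this
    have hlt : countBelow (jumps F m) v < countBelow (jumps F m) u := by
      refine Finset.card_lt_card ((Finset.ssubset_iff_of_subset ?_).2 ⟨y, ?_, ?_⟩)
      · intro z hz
        rw [Finset.mem_filter] at hz ⊢
        exact ⟨hz.1, by omega⟩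
      · simp only [jumps, Finset.mem_filter, Finset.mem_range]
        exact ⟨⟨by omega, h3⟩, h2⟩
      · rw [Finset.mem_filter]; omega
    omega
  · rw [Finset.mem_filter, Finset.mem_range]
    exact ⟨by omega, le_rfl⟩

/-- The body consists of the jump counts at window boundaries, the values between jumps, and the
packed cells of all buckets. The four summands before the last `w` pay for the first array, the
second array, the ranges `2 * n` of both, and the cells; rounding up the packed words costs one word
more. -/
theorem exists_structured {w β e h A : ℕ} {row : (ℕ → ℕ) → ℕ} (hβ : 4 ≤ β) (hm : m < 2 ^ w)
    (hF : Monotone F) (hFn : ∀ i, F i ≤ n) (hh : 1 ≤ h) (hD : 7 * 2 ^ e ≤ 2 ^ h)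
    (hγ : (2 * (2 ^ e * h + 1) + 1 + h) * (2 ^ e * h + 2) ≤ 2 ^ (h - 1))
    (hn : n * 2 ^ (4 * h) < 2 ^ w) (hf : (2 ^ e + 6) * h < w) :
    ∃ hdr body, Represents w β e A m row F hdr body ∧
      w * body.length ≤ ((m / 2 ^ (2 ^ e * h) + 1) / β + 1) * (5 * w + 4 * β) +
        (n / β + 1) * (5 * w + 4 * β) + 4 * n + 2 * ((2 ^ e + 6) * h) * (n * 2 ^ (4 * h)) + w := by
  set D := 2 ^ e with hDdef
  set L := D * h with hL
  set W := 2 ^ L with hW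
  set G := 2 ^ (4 * h) with hG
  set f := (D + 6) * h with hfdef
  have hD1 : 1 ≤ D := Nat.one_le_two_pow
  have hLL : 2 ^ e * h = L := rfl
  have hW1 : 1 ≤ W := Nat.one_le_two_pow
  have hG1 : 1 ≤ G := Nat.one_le_two_pow
  have hfL : f = L + 6 * h := by rw [hfdef, add_mul]
  have hw3 : 3 ≤ w := by omega
  have hww : w < 2 ^ w := Nat.lt_two_pow_self
  have hnw : n < 2 ^ w := lt_of_le_of_lt (Nat.le_mul_of_pos_right n hG1) hn
  set Y := jumps F m with hY
  have hYn : Y.card ≤ n := card_jumps_le hF hFn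
  let cnt : ℕ → ℕ := fun j => countBelow Y (j * W)
  have hcnt_mono : Monotone cnt := fun i j hij => countBelow_mono Y (Nat.mul_le_mul_right _ hij)
  have hcnt_le : ∀ j, cnt j ≤ n := fun j => (countBelow_le Y _).trans hYn
  have hcnt_succ : ∀ j, cnt (j + 1) = cnt j + (window Y (j * W) W).card := by
    intro j
    have := countBelow_window Y (j * W) W
    rwa [← Nat.succ_mul] at this
  have hb := fun j => exists_bucket (Z := window Y (j * W) W) hh hD hγ (by
    intro z hz
    simp only [window, Finset.mem_filter, Finset.mem_range] at hz
    exact hz.1)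
  choose bucket hlen hent hev using hb
  set NB := m / W + 1 with hNB
  let cells := ((List.range NB).map bucket).flatten
  -- Bucket lengths are proportional to their contents, so bucket `j` starts at cell `cnt j * G`.
  have hsum : ∀ j, ∑ i ∈ Finset.range j, (bucket i).length = cnt j * G := by
    intro j
    induction j with
    | zero => simp [cnt, countBelow]
    | succ j ih => rw [Finset.sum_range_succ, ih, hlen, hcnt_succ, add_mul]
  have hcells : cells.length = cnt NB * G := by
    rw [← hsum]; exact length_flatten_map_range _ _
  have hcells_le : cells.length ≤ n * G := by
    rw [hcells]; exact Nat.mul_le_mul_right _ (hcnt_le _)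
  let c : ℕ → ℕ := fun i => cells.getD i 0
  have hc : ∀ i, c i < 2 ^ f := by
    intro i
    simp only [c, List.getD_eq_getElem?_getD]
    cases hi : cells[i]? with
    | none => simp
    | some v =>
      obtain ⟨l, hl, hv⟩ := List.mem_flatten.1 (List.mem_of_getElem? hi)
      obtain ⟨j, -, rfl⟩ := List.mem_map.1 hl
      exact hent j v hv
  set A₂ := A + (monoArray w β cnt NB row A).length with hA₂
  set A₃ := A₂ + (monoArray w β (valueAfter F m) n row A₂).length with hA₃
  set body := monoArray w β cnt NB row A ++ (monoArray w β (valueAfter F m) n row A₂ ++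
    pack f (w / f) c cells.length) with hbody
  have hf1 : 1 ≤ f := by omega
  have hq1 : 1 ≤ w / f := (Nat.one_le_div_iff hf1).2 hf.le
  refine ⟨[1, A, A₂, A₃, f, h], body, ⟨rfl, fun M H hM h0 h1 hp hH hA v hv => ?_⟩, ?_⟩
  · have hB1 := hA.left
    have hB2 : Holds M A₂ _ := hA.right.left
    have hB3 : Holds M A₃ _ := hA.right.right
    have hA3w : A₃ < 2 ^ w := lt_of_lt_of_le
      (hB3.lt_length (i := 0) (by rw [length_pack]; exact Nat.succ_pos _)) hM
    have hv' : ∀ x : ℕ, Ev M (.var x) x := Ev.var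
    have hhw : h < 2 ^ w := by omega
    have h5w : 5 < 2 ^ w := by
      calc 5 < 2 ^ 3 := by norm_num
        _ ≤ 2 ^ w := Nat.pow_le_pow_right (by norm_num) hw3
    have r0 : Reads M H 1 := hH.reads_head (by omega)
    have r1 : Reads M (H + 1) A := hH.reads (i := 1) rfl (by omega)
    have r2 : Reads M (H + 2) A₂ := hH.reads (i := 2) rfl (by omega)
    have r3 : Reads M (H + 3) A₃ := hH.reads (i := 3) rfl hA3w
    have r4 : Reads M (H + 4) f := hH.reads (i := 4) rfl (by omega)
    have r5 : Reads M (H + 5) h := hH.reads (i := 5) rfl hhw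
    have hHw : H + 5 < 2 ^ w := r5.lt_length.trans_le hM
    have eA : Ev M (.ld (.cst (H + 1))) A := (Ev.lit (by omega)).load r1
    have eA2 : Ev M (.ld (.cst (H + 2))) A₂ := (Ev.lit (by omega)).load r2
    have pow_lt : ∀ x, x < w → Ev M (.cst 1) 1 ∧ 1 * 2 ^ x < 2 ^ w := fun x hx =>
      ⟨Ev.lit (by omega), by rw [one_mul]; exact Nat.pow_lt_pow_right (by norm_num) hx⟩
    have ev_pow : ∀ x t, x < w → Ev M t x → Ev M ((Tm.cst 1).shl t) (2 ^ x) := by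
      intro x t hx ht
      have := Ev.shl (pow_lt x hx).1 ht (by omega) (pow_lt x hx).2
      rwa [one_mul] at this
    have hWw : W < 2 ^ w := Nat.pow_lt_pow_right (by norm_num) (by omega)
    have hW2w : W * 2 < 2 ^ w := by
      rw [hW, ← pow_succ]; exact Nat.pow_lt_pow_right (by norm_num) (by omega)
    have hhh : 2 ^ h ≤ W := Nat.pow_le_pow_right (by norm_num) (Nat.le_mul_of_pos_left h hD1)
    set j := v / W with hj
    set x := v % W with hx
    have hjx : j * W + x = v := Nat.div_add_mod' v W
    have hxW : x < W := Nat.mod_lt _ hW1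
    have hvw : v < 2 ^ w := by omega
    have hjN : j < NB := Nat.lt_succ_of_le (Nat.div_le_div_right hv)
    have hjw : j + 1 < 2 ^ w := by
      have : j * 2 ≤ v := (Nat.mul_le_mul_left j (by
        have := Nat.one_le_two_pow (n := h); omega)).trans (Nat.div_mul_le_self v W)
      omega
    have hcount : countBelow Y v = cnt j + ((window Y (j * W) W).filter fun z => z < x).card := by
      rw [← hjx]; exact countBelow_add Y hxW.le
    refine Ev.ifEQ_false ((Ev.lit (by omega)).load r0) (Ev.lit (by omega)) one_ne_zero ?_
    refine Ev.bind ((Ev.lit (by omega)).load r3) ?_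
    refine Ev.bind ((Ev.lit (by omega)).load r4) ?_
    refine Ev.bind ((Ev.lit (by omega)).load r5) ?_
    refine Ev.bind (((Ev.lit (by omega)).load h0).div (hv' f) hww (by omega)) ?_
    refine Ev.bind (ev_pow L _ (by omega) ((Ev.lit
      ((Nat.le_mul_of_pos_right D hh).trans_lt (by omega))).mul (hv' h) (by omega))) ?_
    refine Ev.bind ((hv' v).div (hv' W) hvw hWw) ?_
    refine Ev.bind (ev_access hβ hw3 hnw hcnt_mono hcnt_le hM h0 h1 hp hB1 hjN.le (by omega) eA
      (hv' j)) ?_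
    refine Ev.bind (ev_access hβ hw3 hnw hcnt_mono hcnt_le hM h0 h1 hp hB1 hjN hjw eA
      ((hv' j).add (Ev.lit (by omega)) hjw)) ?_
    refine Ev.bind ((ev_pow h _ (by omega) (hv' h)).add (Ev.lit (by omega)) (by omega)) ?_
    have haG : cnt j * G < 2 ^ w := lt_of_le_of_lt (Nat.mul_le_mul_right _ (hcnt_le j)) hn
    refine Ev.bind ((hv' (cnt j)).mul (ev_pow (4 * h) _ (by omega)
      ((Ev.lit (by omega)).mul (hv' h) (by omega))) haG) ?_
    refine Ev.bind (x := W + x) ((hv' W).add ((hv' v).mod (hv' W) hvw hWw) (by omega)) ?_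
    refine Ev.bind (x := ((window Y (j * W) W).filter fun z => z < x).card) ?_ ?_
    · rcases (window Y (j * W) W).eq_empty_or_nonempty with he | he
      · have hab : cnt j = cnt (j + 1) := by rw [hcnt_succ, he, Finset.card_empty, add_zero]
        rw [he, Finset.filter_empty, Finset.card_empty]
        exact Ev.ifEQ_true (hv' _) (hv' _) hab (Ev.lit (by omega))
      · have hab : cnt j ≠ cnt (j + 1) := by
          rw [hcnt_succ]
          have := he.card_pos
          omega
        refine Ev.ifEQ_false (hv' _) (hv' _) hab ?_
        refine hev j he w M c cells.length _ x (by omega) (by omega) (fun i => (hc i).trans_le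
          (Nat.pow_le_pow_right (by norm_num) hf.le)) hxW rfl ?_ ?_ rfl rfl
        · intro i hi t ht
          exact ev_readCell hf1 hf hq1 (Nat.mul_div_le w f) hc hM hB3 hi (by omega) (hv' _) (hv' _)
            (hv' _) ht
        · intro i v hi
          have := seg_flatten bucket NB j hjN i v hi
          rw [hsum] at this
          have hlt := (List.getElem?_eq_some_iff.1 this).1
          exact ⟨by simp only [c, List.getD_eq_getElem?_getD]; rw [this]; rfl, hlt.le⟩
    · have hle : countBelow Y v ≤ n := (countBelow_le Y v).trans hYn
      have hfin := ev_access (i := countBelow Y v) hβ hw3 hnw valueAfter_mono (valueAfter_le hFn)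
        hM h0 h1 hp hB2 hle (by omega) eA2
        (ti := .var (cnt j) + .var ((window Y (j * W) W).filter fun z => z < x).card)
        (by rw [hcount] at hle ⊢; exact (hv' _).add (hv' _) (by omega))
      rwa [valueAfter_countBelow hF hv] at hfin
  · have e1 := length_monoArray_le (N := NB) (A := A) (row := row) hβ (by omega) hnw hcnt_mono
      hcnt_le 0
    have e2 := length_monoArray_le (N := n) (A := A₂) (row := row) hβ (by omega) hnw
      (valueAfter_mono (F := F) (m := m)) (valueAfter_le hFn) 0
    have e3 : w * (pack f (w / f) c cells.length).length ≤ 2 * f * (n * G) + w := by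
      rw [length_pack]
      set q := w / f with hq
      have h1 : w ≤ q * f + f := (Nat.lt_div_mul_add hf1).le
      have h2 : f ≤ q * f := Nat.le_mul_of_pos_left f hq1
      have h3 : cells.length / q * q ≤ n * G := (Nat.div_mul_le_self _ _).trans hcells_le
      have h4 : cells.length / q * w ≤ cells.length / q * (2 * (q * f)) :=
        Nat.mul_le_mul_left _ (by omega)
      have h5 : cells.length / q * (2 * (q * f)) = 2 * f * (cells.length / q * q) := by ring
      have h6 : 2 * f * (cells.length / q * q) ≤ 2 * f * (n * G) := Nat.mul_le_mul_left _ h3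
      calc w * (cells.length / q + 1) = cells.length / q * w + w := by ring
        _ ≤ _ := by omega
    rw [hbody, List.length_append, List.length_append, mul_add, mul_add]
    simp only [pow_zero, Nat.div_one, zero_add] at e1 e2
    have e4 : 2 * (β * 2) = 4 * β := by ring
    rw [e4] at e1 e2
    omega

end Structured

/-! ## Rank and select -/

section Rank

variable {m : ℕ} (b : Bool) (S : Fin m → Bool)

theorem bitRank_mono : Monotone (bitRank b S) := fun _ _ h =>
  Finset.card_le_card fun j hj => by
    simp only [Finset.mem_filter, Finset.mem_univ, true_and] at hj ⊢
    exact ⟨hj.1.trans_le h, hj.2⟩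

theorem bitRank_zero : bitRank b S 0 = 0 := by simp [bitRank]

theorem bitRank_succ {i : ℕ} (hi : i < m) :
    bitRank b S (i + 1) = bitRank b S i + if S ⟨i, hi⟩ = b then 1 else 0 := by
  have h : (Finset.univ.filter fun j : Fin m => (j : ℕ) < i + 1 ∧ S j = b) =
      (Finset.univ.filter fun j : Fin m => (j : ℕ) < i ∧ S j = b) ∪
        (if S ⟨i, hi⟩ = b then {⟨i, hi⟩} else ∅) := by
    ext j
    by_cases hj : j = ⟨i, hi⟩
    · subst hj; split_ifs with hS <;> simp [hS]
    · have : (j : ℕ) ≠ i := fun he => hj (Fin.ext he)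
      have h2 : j ∉ (if S ⟨i, hi⟩ = b then ({⟨i, hi⟩} : Finset (Fin m)) else ∅) := by
        split_ifs <;> simp [hj]
      simp only [Finset.mem_union, h2, or_false, Finset.mem_filter, Finset.mem_univ, true_and]
      constructor
      · rintro ⟨h1, h3⟩; exact ⟨by omega, h3⟩
      · rintro ⟨h1, h3⟩; exact ⟨by omega, h3⟩
  rw [bitRank, h, Finset.card_union_of_disjoint, bitRank]
  · split_ifs <;> simp
  · split_ifs <;> simp

theorem bitRank_le_numOnes (i : ℕ) : bitRank true S i ≤ numOnes S :=
  Finset.card_le_card fun j hj => by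
    simp only [Finset.mem_filter, Finset.mem_univ, true_and] at hj ⊢
    exact hj.2

theorem bitRank_full : bitRank true S m = numOnes S := by
  simp [bitRank, numOnes]

theorem bitRank_false_add_true {i : ℕ} (hi : i ≤ m) :
    bitRank false S i + bitRank true S i = i := by
  induction i with
  | zero => simp [bitRank_zero]
  | succ i ih =>
    rw [bitRank_succ _ _ (by omega), bitRank_succ _ _ (by omega)]
    have := ih (by omega)
    cases S ⟨i, by omega⟩ <;> simp <;> omega

/-- The number of prefixes with fewer than `i` occurrences of `b`. -/
def selectPos (i : ℕ) : ℕ := ((Finset.range m).filter fun p => bitRank b S p < i).card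

theorem selectPos_mono : Monotone (selectPos b S) := fun _ _ h =>
  Finset.card_le_card fun j hj => by
    rw [Finset.mem_filter] at hj ⊢
    exact ⟨hj.1, hj.2.trans_le h⟩

theorem selectPos_le (i : ℕ) : selectPos b S i ≤ m :=
  (Finset.card_filter_le _ _).trans (Finset.card_range m).le

variable {b S}

/-- The rank grows by at most one per position, so the first prefix with at least `i` occurrences
has exactly `i`. -/
theorem bitSelect_spec {i : ℕ} (h1 : 1 ≤ i) (h2 : i ≤ bitRank b S m) :
    bitSelect b S i ≤ m ∧ bitRank b S (bitSelect b S i) = i ∧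
      ∀ p, p < bitSelect b S i ↔ bitRank b S p < i := by
  classical
  have hex : ∃ p, i ≤ bitRank b S p := ⟨m, h2⟩
  have hle : Nat.find hex ≤ m := Nat.find_min' hex h2
  have heq : bitRank b S (Nat.find hex) = i := by
    refine le_antisymm ?_ (Nat.find_spec hex)
    rcases Nat.eq_zero_or_pos (Nat.find hex) with h0 | h0
    · rw [h0, bitRank_zero]; omega
    · have h3 := Nat.find_min hex (m := Nat.find hex - 1) (by omega)
      have h4 := bitRank_succ b S (i := Nat.find hex - 1) (by omega)
      rw [Nat.sub_add_cancel h0] at h4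
      rw [h4]
      split_ifs <;> omega
  have hsel : bitSelect b S i = Nat.find hex := by
    refine le_antisymm (Nat.sInf_le heq) (Nat.find_min' hex ?_)
    have : bitRank b S (bitSelect b S i) = i :=
      Nat.sInf_mem (s := {p | bitRank b S p = i}) ⟨_, heq⟩
    exact this.ge
  rw [hsel]
  refine ⟨hle, heq, fun p => ⟨fun hp => ?_, fun hp => ?_⟩⟩
  · have := Nat.find_min hex hp; omega
  · by_contra! hge
    have := bitRank_mono b S hge
    omega

/-- Unlike `bitSelect`, `selectPos` is monotone and bounded by `m` at every argument, as a monotone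
array requires. -/
theorem selectPos_eq {i : ℕ} (h1 : 1 ≤ i) (h2 : i ≤ bitRank b S m) :
    selectPos b S i = bitSelect b S i := by
  obtain ⟨hle, -, hlt⟩ := bitSelect_spec h1 h2
  have : ((Finset.range m).filter fun p => bitRank b S p < i) = Finset.range (bitSelect b S i) := by
    ext p
    rw [Finset.mem_filter, Finset.mem_range, Finset.mem_range, ← hlt]
    omega
  rw [selectPos, this, Finset.card_range]

/-- The number of ones before the `i`-th zero. -/
def onesBefore (S : Fin m → Bool) (i : ℕ) : ℕ :=
  (Finset.univ.filter fun j : Fin m => bitRank false S j < i ∧ S j = true).card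

theorem onesBefore_mono : Monotone (onesBefore S) := fun _ _ h =>
  Finset.card_le_card fun j hj => by
    simp only [Finset.mem_filter, Finset.mem_univ, true_and] at hj ⊢
    exact ⟨hj.1.trans_le h, hj.2⟩

theorem onesBefore_le (i : ℕ) : onesBefore S i ≤ numOnes S :=
  Finset.card_le_card fun j hj => by
    simp only [Finset.mem_filter, Finset.mem_univ, true_and] at hj ⊢
    exact hj.2

/-- The zeros may far outnumber the ones, so their positions cannot be tabulated within the budget;
the correction `onesBefore` takes values at most `n` only. -/
theorem bitSelect_false {i : ℕ} (h1 : 1 ≤ i) (h2 : i ≤ bitRank false S m) :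
    bitSelect false S i = i + onesBefore S i := by
  obtain ⟨hle, heq, hlt⟩ := bitSelect_spec h1 h2
  have h3 : onesBefore S i = bitRank true S (bitSelect false S i) :=
    congrArg Finset.card (Finset.filter_congr fun j _ => by rw [← hlt])
  have := bitRank_false_add_true S hle
  omega

end Rank

/-! ## Scanning short bitstrings -/

/-- Adds one to the count if the bit at address `j` is `b`. -/
def tally {V : Type} (b : Bool) (j cnt : V) : Tm V :=
  .ifEQ (.ld (.var j)) (.cst b.toNat) (.var cnt + .cst 1) (.var cnt)

/-- The number of bits `b` at addresses below `i`, for at most `k` addresses from `j` on. -/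
def scanRank {V : Type} (b : Bool) : ℕ → V → V → V → Tm V
  | 0, _, _, cnt => .var cnt
  | k + 1, i, j, cnt =>
    .ifLT (.var j) (.var i)
      (.bind (tally b j cnt) fun cnt' => .bind (.var j + .cst 1) fun j' => scanRank b k i j' cnt')
      (.var cnt)

/-- The first address, among the next `k` from `j` on, before which there are `i` bits `b`. -/
def scanSelect {V : Type} (b : Bool) : ℕ → V → V → V → Tm V
  | 0, _, j, _ => .var j
  | k + 1, i, j, cnt =>
    .ifEQ (.var cnt) (.var i) (.var j)
      (.bind (tally b j cnt) fun cnt' => .bind (.var j + .cst 1) fun j' => scanSelect b k i j' cnt')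

/-- The bits of `S`, one to a word. -/
def bitWords {m : ℕ} (w : ℕ) (S : Fin m → Bool) : List (BitVec w) :=
  List.ofFn fun j => BitVec.ofNat w (S j).toNat

section Scan

variable {w m : ℕ} {b : Bool} {S : Fin m → Bool}

theorem ev_tally (hm : m < 2 ^ w) {j : ℕ} (hj : j < m) :
    Ev (bitWords w S) (tally b j (bitRank b S j)) (bitRank b S (j + 1)) := by
  have hle : bitRank b S (j + 1) ≤ m := by
    have h1 := bitRank_false_add_true S (i := j + 1) hj
    cases b <;> omega
  have hld : Ev (bitWords w S) (.ld (.var j)) (S ⟨j, hj⟩).toNat := by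
    refine (Ev.var j).load ⟨BitVec.ofNat w (S ⟨j, hj⟩).toNat, by simp [bitWords, hj], ?_⟩
    have : (S ⟨j, hj⟩).toNat ≤ 1 := by cases S ⟨j, hj⟩ <;> simp
    rw [BitVec.toNat_ofNat, Nat.mod_eq_of_lt (by omega)]
  have hb : Ev (bitWords w S) (.cst b.toNat) b.toNat := Ev.lit ((Bool.toNat_le b).trans_lt (by omega))
  rw [bitRank_succ b S hj] at hle ⊢
  by_cases h : S ⟨j, hj⟩ = b
  · rw [if_pos h] at hle ⊢
    exact Ev.ifEQ_true hld hb (by rw [h]) ((Ev.var _).add (Ev.lit (by omega)) (by omega))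
  · rw [if_neg h]
    exact Ev.ifEQ_false hld hb (fun he => h (by
      revert he; cases S ⟨j, hj⟩ <;> cases b <;> simp)) (Ev.var _)

theorem ev_scanRank (hm : m < 2 ^ w) {i : ℕ} (hi : i ≤ m) (k : ℕ) :
    ∀ j, j ≤ i → i ≤ j + k →
      Ev (bitWords w S) (scanRank b k i j (bitRank b S j)) (bitRank b S i) := by
  induction k with
  | zero =>
    intro j h1 h2
    obtain rfl : j = i := by omega
    exact Ev.var _
  | succ k ih =>
    intro j h1 h2
    rcases Nat.lt_or_ge j i with h | h
    · exact Ev.ifLT_true (.var _) (.var _) h (Ev.bind (ev_tally hm (by omega))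
        (Ev.bind ((Ev.var _).add (Ev.lit (by omega)) (by omega)) (ih (j + 1) h (by omega))))
    · obtain rfl : j = i := by omega
      exact Ev.ifLT_false (.var _) (.var _) (by omega) (.var _)

theorem ev_scanSelect (hm : m < 2 ^ w) {i : ℕ} (h1 : 1 ≤ i) (h2 : i ≤ bitRank b S m) (k : ℕ) :
    ∀ j, j ≤ bitSelect b S i → bitSelect b S i ≤ j + k →
      Ev (bitWords w S) (scanSelect b k i j (bitRank b S j)) (bitSelect b S i) := by
  obtain ⟨hle, heq, hlt⟩ := bitSelect_spec h1 h2
  induction k with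
  | zero =>
    intro j h1 h2
    obtain rfl : j = bitSelect b S i := by omega
    exact Ev.var _
  | succ k ih =>
    intro j h1 h2
    rcases Nat.lt_or_ge j (bitSelect b S i) with h | h
    · have hne : bitRank b S j ≠ i := ((hlt j).1 h).ne
      exact Ev.ifEQ_false (.var _) (.var _) hne (Ev.bind (ev_tally hm (by omega))
        (Ev.bind ((Ev.var _).add (Ev.lit (by omega)) (by omega)) (ih (j + 1) h (by omega))))
    · obtain rfl : j = bitSelect b S i := by omega
      exact Ev.ifEQ_true (.var _) (.var _) heq (.var _)

end Scan

/-! ## The query programs -/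

/-- The query `rank_b`; words of at most `t` bits are treated by scanning. -/
def rankQuery (e t : ℕ) (b : Bool) {V : Type} (i : V) : Tm V :=
  -- Constants are reduced modulo `2 ^ w`, so this one is zero exactly when `w ≤ t`: the program
  -- detects short words without reading the memory.
  .ifEQ (.cst (2 ^ t)) (.cst 0)
    (.bind (.cst 0) fun j => .bind (.cst 0) fun cnt => scanRank b (2 ^ t) i j cnt)
    (if b then stepValue e 3 i else .var i - stepValue e 3 i)

/-- The query `select_b`. -/
def selectQuery (e t : ℕ) (b : Bool) {V : Type} (i : V) : Tm V :=
  .ifEQ (.cst (2 ^ t)) (.cst 0)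
    (.bind (.cst 0) fun j => .bind (.cst 0) fun cnt => scanSelect b (2 ^ t) i j cnt)
    (if b then access (.ld (.cst 2)) (.var i) else .var i + stepValue e 9 i)

/-- The query programs. -/
def queryPrograms (e t : ℕ) : FIDPrograms where
  rank b := program fun _ => rankQuery e t b
  select b := program fun _ => selectQuery e t b

/-! ### The query terms are parametric in their variables. -/

section Parametricity

variable {Γ : Set (ℕ × ℕ)}

theorem WF.add {a a' b b' : Tm ℕ} (h : WF Γ a a') (h' : WF Γ b b') : WF Γ (a + b) (a' + b') :=
  .op h h'
theorem WF.sub {a a' b b' : Tm ℕ} (h : WF Γ a a') (h' : WF Γ b b') : WF Γ (a - b) (a' - b') :=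
  .op h h'
theorem WF.mul {a a' b b' : Tm ℕ} (h : WF Γ a a') (h' : WF Γ b b') : WF Γ (a * b) (a' * b') :=
  .op h h'
theorem WF.div {a a' b b' : Tm ℕ} (h : WF Γ a a') (h' : WF Γ b b') : WF Γ (a / b) (a' / b') :=
  .op h h'
theorem WF.mod {a a' b b' : Tm ℕ} (h : WF Γ a a') (h' : WF Γ b b') : WF Γ (a % b) (a' % b') :=
  .op h h'

theorem wf_readCell {b b' q q' f f' i i' : Tm ℕ} (hb : WF Γ b b') (hq : WF Γ q q')
    (hf : WF Γ f f') (hi : WF Γ i i') : WF Γ (readCell b q f i) (readCell b' q' f' i') :=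
  .mod (.op (.ld (.add hb (.div hi hq))) (.mul hf (.mod hi hq))) (.op .cst hf)

theorem wf_access {b b' i i' : Tm ℕ} (hb : WF Γ b b') (hi : WF Γ i i') :
    WF Γ (access b i) (access b' i') := by
  refine .bind (.add hb (.mul .cst (.div hi (.ld .cst)))) fun p p' => ?_
  refine .bind (.mod hi.weaken (.ld .cst)) fun t t' => ?_
  refine .bind (.ld (.add (.var (by simp)) .cst)) fun s s' => ?_
  have hp : WF (insert (s, s') (insert (t, t') (insert (p, p') Γ))) (.var p) (.var p') :=
    .var (by simp)
  have ht : WF (insert (s, s') (insert (t, t') (insert (p, p') Γ))) (.var t) (.var t') :=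
    .var (by simp)
  have hs : WF (insert (s, s') (insert (t, t') (insert (p, p') Γ))) (.var s) (.var s') :=
    .var (by simp)
  exact .add (.add (.ld hp) (.op (.ld (.add (.ld (.add hp .cst)) ht)) hs))
    (wf_readCell (.ld (.add hp .cst)) (.div (.ld .cst) hs) hs ht)

/-- Related variables of a search. -/
def BucketRel (Γ : Set (ℕ × ℕ)) (p p' : BucketVars ℕ) : Prop :=
  (p.base, p'.base) ∈ Γ ∧ (p.perWord, p'.perWord) ∈ Γ ∧ (p.width, p'.width) ∈ Γ ∧
    (p.step, p'.step) ∈ Γ ∧ (p.slot, p'.slot) ∈ Γ ∧ (p.start, p'.start) ∈ Γ ∧ (p.arg, p'.arg) ∈ Γ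

theorem BucketRel.weaken {p p' : BucketVars ℕ} (h : BucketRel Γ p p') (x : ℕ × ℕ) :
    BucketRel (insert x Γ) p p' := by
  obtain ⟨h1, h2, h3, h4, h5, h6, h7⟩ := h
  exact ⟨.inr h1, .inr h2, .inr h3, .inr h4, .inr h5, .inr h6, .inr h7⟩

theorem wf_cell {p p' : BucketVars ℕ} {i i' : Tm ℕ} (h : BucketRel Γ p p') (hi : WF Γ i i') :
    WF Γ (cell p i) (cell p' i') :=
  wf_readCell (.var h.1) (.var h.2.1) (.var h.2.2.1) hi

theorem wf_lookup {p p' : BucketVars ℕ} {κ κ' : ℕ} (h : BucketRel Γ p p') (hκ : (κ, κ') ∈ Γ) :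
    WF Γ (lookup p κ) (lookup p' κ') := by
  refine .bind (.mod (.var hκ) (wf_cell h (.var h.2.2.2.2.2.1))) fun r r' => ?_
  have h' := h.weaken (r, r')
  obtain ⟨-, -, -, -, h5, h6, -⟩ := id h'
  exact .add (.var h6) (.add (wf_cell h' (.add (.var h6) (.add .cst (.mul .cst (.var (by simp))))))
    (.mul (.mod (.var (.inr hκ)) (wf_cell h' (.add (.var h6) (.add .cst
      (.mul .cst (.var (by simp))))))) (.var h5)))

theorem wf_search {p p' : BucketVars ℕ} (e : ℕ) : ∀ {Γ : Set (ℕ × ℕ)} {r r' s s' : ℕ},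
    BucketRel Γ p p' → (r, r') ∈ Γ → (s, s') ∈ Γ → WF Γ (search p e r s) (search p' e r' s') := by
  induction e with
  | zero =>
    intro Γ r r' s s' h hr hs
    obtain ⟨-, -, -, h4, -, -, h7⟩ := id h
    refine .bind (.mod (.op (.var h7) (.mul (.var h4) (.sub (.var hr) .cst)))
      (.op .cst (.var h4))) fun g g' => ?_
    exact wf_cell (h.weaken _) (.add (.var (.inr hs)) (.add .cst (.var (by simp))))
  | succ e ih =>
    intro Γ r r' s s' h hr hs
    obtain ⟨-, -, -, h4, -, -, h7⟩ := id h
    refine .bind (.sub (.var hr) .cst) fun a a' => ?_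
    refine .bind (.op (.var (.inr h7)) (.mul (.var (.inr h4)) (.var (by simp)))) fun κ κ' => ?_
    refine .bind (wf_lookup ((h.weaken _).weaken _) (by simp)) fun t t' => ?_
    refine .bind (wf_cell (((h.weaken _).weaken _).weaken _) (.var (by simp))) fun l l' => ?_
    refine .bind (.ifEQ (.var (by simp)) (.var (by simp)) (.var (by simp)) (.var (by simp [hr])))
      fun r₂ r₂' => ?_
    refine .bind (.ifEQ (.var (by simp)) (.var (by simp)) (.var (by simp)) (.var (by simp [hs])))
      fun s₂ s₂' => ?_
    exact ih ((((((h.weaken _).weaken _).weaken _).weaken _).weaken _).weaken _) (by simp) (by simp)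

theorem wf_bucketCount {e : ℕ} {p p' : BucketVars ℕ} (h : BucketRel Γ p p') :
    WF Γ (bucketCount e p) (bucketCount e p') := by
  refine .bind .cst fun D D' => .bind .cst fun o o' => ?_
  refine .bind (wf_lookup ((h.weaken _).weaken _) (by simp)) fun s s' => ?_
  exact wf_search e (((h.weaken _).weaken _).weaken _) (by simp) (by simp)

theorem wf_stepValue {e H v v' : ℕ} (hv : (v, v') ∈ Γ) :
    WF Γ (stepValue e H v) (stepValue e H v') := by
  refine .ifEQ (.ld .cst) .cst (wf_access (.ld .cst) (.var hv)) ?_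
  refine .bind (.ld .cst) fun cb cb' => .bind (.ld .cst) fun f f' => .bind (.ld .cst) fun h h' => ?_
  refine .bind (.div (.ld .cst) (.var (by simp))) fun q q' => ?_
  refine .bind (.op .cst (.mul .cst (.var (by simp)))) fun W W' => ?_
  refine .bind (.div (.var (by simp [hv])) (.var (by simp))) fun j j' => ?_
  refine .bind (wf_access (.ld .cst) (.var (by simp))) fun a a' => ?_
  refine .bind (wf_access (.ld .cst) (.add (.var (by simp)) .cst)) fun b b' => ?_
  refine .bind (.add (.op .cst (.var (by simp))) .cst) fun s s' => ?_
  refine .bind (.mul (.var (by simp)) (.op .cst (.mul .cst (.var (by simp))))) fun R R' => ?_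
  refine .bind (.add (.var (by simp)) (.mod (.var (by simp [hv])) (.var (by simp)))) fun X X' => ?_
  refine .bind (.ifEQ (.var (by simp)) (.var (by simp)) .cst (wf_bucketCount ?_)) fun l l' => ?_
  · refine ⟨?_, ?_, ?_, ?_, ?_, ?_, ?_⟩ <;> simp
  · exact wf_access (.ld .cst) (.add (.var (by simp)) (.var (by simp)))

theorem wf_tally {b : Bool} {j j' c c' : ℕ} (hj : (j, j') ∈ Γ) (hc : (c, c') ∈ Γ) :
    WF Γ (tally b j c) (tally b j' c') :=
  .ifEQ (.ld (.var hj)) .cst (.add (.var hc) .cst) (.var hc)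

theorem wf_scanRank {b : Bool} (k : ℕ) : ∀ {Γ : Set (ℕ × ℕ)} {i i' j j' c c' : ℕ},
    (i, i') ∈ Γ → (j, j') ∈ Γ → (c, c') ∈ Γ → WF Γ (scanRank b k i j c) (scanRank b k i' j' c') := by
  induction k with
  | zero => intro Γ i i' j j' c c' _ _ hc; exact .var hc
  | succ k ih =>
    intro Γ i i' j j' c c' hi hj hc
    refine .ifLT (.var hj) (.var hi) (.bind (wf_tally hj hc) fun d d' => ?_) (.var hc)
    refine .bind (.add (.var (.inr hj)) .cst) fun l l' => ?_
    exact ih (by simp [hi]) (by simp) (by simp)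

theorem wf_scanSelect {b : Bool} (k : ℕ) : ∀ {Γ : Set (ℕ × ℕ)} {i i' j j' c c' : ℕ},
    (i, i') ∈ Γ → (j, j') ∈ Γ → (c, c') ∈ Γ →
      WF Γ (scanSelect b k i j c) (scanSelect b k i' j' c') := by
  induction k with
  | zero => intro Γ i i' j j' c c' _ hj _; exact .var hj
  | succ k ih =>
    intro Γ i i' j j' c c' hi hj hc
    refine .ifEQ (.var hc) (.var hi) (.var hj) (.bind (wf_tally hj hc) fun d d' => ?_)
    refine .bind (.add (.var (.inr hj)) .cst) fun l l' => ?_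
    exact ih (by simp [hi]) (by simp) (by simp)

theorem wf_rankQuery {e t : ℕ} {b : Bool} {i i' : ℕ} (hi : (i, i') ∈ Γ) :
    WF Γ (rankQuery e t b i) (rankQuery e t b i') := by
  refine .ifEQ .cst .cst (.bind .cst fun j j' => .bind .cst fun c c' => ?_) ?_
  · exact wf_scanRank _ (by simp [hi]) (by simp) (by simp)
  · cases b
    · exact .sub (.var hi) (wf_stepValue hi)
    · exact wf_stepValue hi

theorem wf_selectQuery {e t : ℕ} {b : Bool} {i i' : ℕ} (hi : (i, i') ∈ Γ) :
    WF Γ (selectQuery e t b i) (selectQuery e t b i') := by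
  refine .ifEQ .cst .cst (.bind .cst fun j j' => .bind .cst fun c c' => ?_) ?_
  · exact wf_scanSelect _ (by simp [hi]) (by simp) (by simp)
  · cases b
    · exact .add (.var hi) (wf_stepValue hi)
    · exact wf_access (.ld .cst) (.var hi)

end Parametricity

/-! ### Code length, linear in the number of search rounds. -/

section Cost

variable (d : ℕ)

theorem cost_sub (a b : Tm ℕ) : (a - b).cost d = a.cost d + b.cost (d + 1) + 1 := rfl

theorem cost_div (a b : Tm ℕ) : (a / b).cost d = a.cost d + b.cost (d + 1) + 1 := rfl

theorem cost_lookup (p : BucketVars ℕ) (κ : ℕ) : (lookup p κ).cost d ≤ 100 := by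
  simp only [lookup, cell, readCell, Tm.cost, cost_div]
  norm_num

theorem cost_search (p : BucketVars ℕ) (e : ℕ) :
    ∀ d r s, (search p e r s).cost d ≤ 200 * (e + 1) := by
  induction e with
  | zero =>
    intro d r s
    simp only [search, cell, readCell, Tm.cost, cost_sub, cost_div]
    norm_num
  | succ e ih =>
    intro d r s
    simp only [search, cell, readCell, Tm.cost, cost_sub, cost_div]
    generalize h1 : (lookup p _).cost _ = x
    generalize h2 : (search p e _ _).cost _ = y
    have h3 : x ≤ 100 := h1 ▸ cost_lookup _ _ _
    have h4 : y ≤ 200 * (e + 1) := h2 ▸ ih _ _ _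
    omega

theorem cost_bucketCount (p : BucketVars ℕ) (e : ℕ) :
    (bucketCount e p).cost d ≤ 200 * (e + 1) + 200 := by
  simp only [bucketCount, Tm.cost]
  generalize h1 : (lookup p _).cost _ = x
  generalize h2 : (search p e _ _).cost _ = y
  have h3 : x ≤ 100 := h1 ▸ cost_lookup _ _ _
  have h4 : y ≤ 200 * (e + 1) := h2 ▸ cost_search _ _ _ _ _
  omega

theorem cost_stepValue (e H v : ℕ) : (stepValue e H v).cost d ≤ 200 * e + 1000 := by
  simp only [stepValue, access, readCell, Tm.cost, cost_div]
  generalize h1 : (bucketCount e _).cost _ = x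
  have h2 : x ≤ 200 * (e + 1) + 200 := h1 ▸ cost_bucketCount _ _ _
  omega

theorem cost_scanRank (b : Bool) (k : ℕ) :
    ∀ d i j c, (scanRank b k i j c).cost d ≤ 20 * (k + 1) := by
  induction k with
  | zero => intro d i j c; simp only [scanRank, Tm.cost]; omega
  | succ k ih =>
    intro d i j c
    have := ih (d + 1 + 1) i (d + 1) d
    simp only [scanRank, tally, Tm.cost]
    omega

theorem cost_scanSelect (b : Bool) (k : ℕ) :
    ∀ d i j c, (scanSelect b k i j c).cost d ≤ 20 * (k + 1) := by
  induction k with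
  | zero => intro d i j c; simp only [scanSelect, Tm.cost]; omega
  | succ k ih =>
    intro d i j c
    have := ih (d + 1 + 1) i (d + 1) d
    simp only [scanSelect, tally, Tm.cost]
    omega

theorem cost_rankQuery (e t : ℕ) (b : Bool) (i : ℕ) :
    (rankQuery e t b i).cost d + 2 ≤ 20 * 2 ^ t + 2000 + 200 * e := by
  have h1 := cost_scanRank b (2 ^ t) (d + 1 + 1) i d (d + 1)
  have h2 := cost_stepValue d e 3 i
  have h3 := cost_stepValue (d + 1) e 3 i
  cases b <;> simp only [rankQuery, Tm.cost, cost_sub, if_true, Bool.false_eq_true, if_false] <;> omega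

theorem cost_selectQuery (e t : ℕ) (b : Bool) (i : ℕ) :
    (selectQuery e t b i).cost d + 2 ≤ 20 * 2 ^ t + 2000 + 200 * e := by
  have h1 := cost_scanSelect b (2 ^ t) (d + 1 + 1) i d (d + 1)
  have h2 := cost_stepValue d e 9 i
  have h3 := cost_stepValue (d + 1) e 9 i
  cases b <;> simp only [selectQuery, access, readCell, Tm.cost, cost_div, if_true, Bool.false_eq_true,
    if_false] <;> omega

end Cost

/-- A memory from which the four query terms evaluate correctly is a dictionary. -/
theorem isFID_of_ev {w m e t : ℕ} {S : Fin m → Bool} {M : List (BitVec w)} (hm : m < 2 ^ w)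
    (hr : ∀ b, ∀ i ≤ m, Ev M (rankQuery e t b i) (bitRank b S i))
    (hs : ∀ b i, 1 ≤ i → i ≤ bitRank b S m → Ev M (selectQuery e t b i) (bitSelect b S i)) :
    IsFID (queryPrograms e t) M S (20 * 2 ^ t + 2000 + 200 * e) where
  rank_answers b i hi :=
    answers_mono (program_answers (by omega) (wf_rankQuery (Set.mem_singleton _)) (hr b i hi))
      (cost_rankQuery _ _ _ _ _)
  select_answers b i h1 h2 := by
    have hle : bitRank b S m ≤ m := by
      have := bitRank_false_add_true S le_rfl
      cases b <;> omega
    exact answers_mono (program_answers (by omega) (wf_selectQuery (Set.mem_singleton _))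
      (hs b i h1 h2)) (cost_selectQuery _ _ _ _ _)

/-- Bitstrings for short words are stored verbatim. -/
theorem isFID_bitWords {w m e t : ℕ} {S : Fin m → Bool} (hm : m < 2 ^ w) (hw : w ≤ t) :
    IsFID (queryPrograms e t) (bitWords w S) S (20 * 2 ^ t + 2000 + 200 * e) := by
  have hmt : m ≤ 0 + 2 ^ t := by
    have := Nat.pow_le_pow_right (show 0 < 2 by norm_num) hw
    omega
  have h0 : Ev (bitWords w S) (.cst 0) 0 := Ev.lit (by positivity)
  have ht : Ev (bitWords w S) (.cst (2 ^ t)) 0 :=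
    (Ev.cst _).congr (Nat.mod_eq_zero_of_dvd (pow_dvd_pow 2 hw))
  refine isFID_of_ev hm (fun b i hi => ?_) fun b i h1 h2 => ?_
  · refine Ev.ifEQ_true ht h0 rfl (Ev.bind h0 (Ev.bind h0 ?_))
    have := ev_scanRank (b := b) (S := S) hm hi (2 ^ t) 0 (by omega) (by omega)
    rwa [bitRank_zero] at this
  · refine Ev.ifEQ_true ht h0 rfl (Ev.bind h0 (Ev.bind h0 ?_))
    have hle := (bitSelect_spec h1 h2).1
    have := ev_scanSelect (b := b) (S := S) hm h1 h2 (2 ^ t) 0 (by omega) (by omega)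
    rwa [bitRank_zero] at this

/-- The dictionary assembled from representations of the two step functions. -/
theorem exists_memory {w m n e t β B : ℕ} {S : Fin m → Bool} (hm : m < 2 ^ w) (htw : t < w)
    (ht : 4 ≤ t) (hβ : 4 ≤ β) (hβw : β < 2 ^ w) (hn : numOnes S = n) (σ : ℕ)
    (hF : ∀ F : ℕ → ℕ, Monotone F → (∀ i, F i ≤ n) → ∀ (A : ℕ) (row : (ℕ → ℕ) → ℕ),
      ∃ hdr body, Represents w β e A m row F hdr body ∧ w * body.length ≤ B) :
    ∃ l : List ℕ, w * l.length ≤ 15 * w + w * (4 ^ β * β) +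
        ((n / β + 1) * (5 * w + 2 * (β * (σ + 2))) + 2 * (m / 2 ^ σ)) + 2 * B ∧
      (l.length ≤ 2 ^ w →
        IsFID (queryPrograms e t) (l.map (BitVec.ofNat w)) S (20 * 2 ^ t + 2000 + 200 * e)) := by
  -- The pattern table starts after three global words and two headers of six words, at addresses
  -- `3` and `9`.
  obtain ⟨row, hrow⟩ := exists_row β 15
  set T := patternTable β with hT
  have hXm := selectPos_mono true S
  have hXle := selectPos_le true S
  set X := monoArray w β (selectPos true S) n row (15 + T.length) with hX
  have hn1 : ∀ i, bitRank true S i ≤ n := fun i => hn ▸ bitRank_le_numOnes S i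
  have hn0 : ∀ i, onesBefore S i ≤ n := fun i => hn ▸ onesBefore_le i
  have hnm : n ≤ m := by
    have := bitRank_false_add_true S le_rfl
    rw [bitRank_full, hn] at this
    omega
  obtain ⟨hdr₁, body₁, ⟨hl₁, hrep₁⟩, hB₁⟩ := hF _ (bitRank_mono true S) hn1 (15 + T.length + X.length) row
  obtain ⟨hdr₂, body₂, ⟨hl₂, hrep₂⟩, hB₂⟩ := hF _ (onesBefore_mono (S := S)) hn0
    (15 + T.length + X.length + body₁.length) row
  refine ⟨[w, β, 15 + T.length] ++ (hdr₁ ++ (hdr₂ ++ (T ++ (X ++ (body₁ ++ body₂))))), ?_, ?_⟩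
  · have hTl := Nat.mul_le_mul_left w (length_patternTable_le β)
    have hXl := length_monoArray_le (N := n) (A := 15 + T.length) (row := row) hβ
      (show 2 ≤ w by omega) hm hXm hXle σ
    simp only [List.length_append, List.length_cons, List.length_nil, hl₁, hl₂, mul_add]
    rw [← hT] at hTl
    rw [← hX] at hXl
    simp only [mul_add] at hXl
    omega
  · intro hlen
    set l := [w, β, 15 + T.length] ++ (hdr₁ ++ (hdr₂ ++ (T ++ (X ++ (body₁ ++ body₂))))) with hl
    set M := l.map (BitVec.ofNat w) with hMdef
    have hM : M.length ≤ 2 ^ w := by simpa [hMdef] using hlen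
    have hw3 : 3 ≤ w := by omega
    have hww : w < 2 ^ w := Nat.lt_two_pow_self
    have hall : Holds M 0 l := Seg.refl _
    have k1 := hall.right
    have k2 := k1.right
    have k3 := k2.right
    have k4 := k3.right
    have k5 := k4.right
    have hdrH1 := k1.left
    have hdrH2 := k2.left
    have hTH := k3.left
    have hXH := k4.left
    have hb1H := k5.left
    have hb2H := k5.right
    simp only [List.length_cons, List.length_nil, hl₁, hl₂, zero_add, Nat.reduceAdd] at *
    have hAX : 15 + T.length < 2 ^ w := holds_monoArray_lt hM hXH
    have r0 : Reads M 0 w := hall.left.reads_head hww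
    have r1 : Reads M 1 β := by simpa using hall.left.reads (i := 1) rfl hβw
    have r2 : Reads M 2 (15 + T.length) := by simpa using hall.left.reads (i := 2) rfl hAX
    have hp : HasPatterns M β row := hrow w M hβw.le hTH
    have e1 := hrep₁ M 3 hM r0 r1 hp hdrH1 hb1H
    have e2 := hrep₂ M 9 hM r0 r1 hp hdrH2 hb2H
    have hpow : 2 ^ t < 2 ^ w := Nat.pow_lt_pow_right (by norm_num) htw
    have hbig : Ev M (.cst (2 ^ t)) (2 ^ t) := Ev.lit hpow
    have hne : 2 ^ t ≠ 0 := by positivity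
    have hz : Ev M (.cst 0) 0 := Ev.lit (by positivity)
    have hv : ∀ x : ℕ, Ev M (.var x) x := Ev.var
    refine isFID_of_ev hm (fun b i hi => Ev.ifEQ_false hbig hz hne ?_)
      fun b i h1 h2 => Ev.ifEQ_false hbig hz hne ?_
    · have hsum := bitRank_false_add_true S hi
      cases b
      · have := (hv i).sub (e1 i hi) (by omega) (by omega)
        rwa [show i - bitRank true S i = bitRank false S i by omega] at this
      · exact e1 i hi
    · have hsum := bitRank_false_add_true S (le_refl m)
      have hpos := (bitSelect_spec h1 h2).1
      cases b
      · rw [bitSelect_false h1 h2] at hpos ⊢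
        exact (hv i).add (e2 i (by omega)) (by omega)
      · rw [← selectPos_eq h1 h2]
        rw [bitRank_full, hn] at h2
        have h2w : 2 < 2 ^ w := by omega
        exact ev_access hβ hw3 hm hXm hXle hM r0 r1 hp hXH h2 (by omega)
          ((Ev.lit h2w).load r2) (hv i)

/-! ## Space -/

/-- An exponential beats a polynomial: from `h₀` on, the hashing conditions hold. For `h < h₀` the
ratio `m / n` is bounded and direct storage suffices. -/
theorem exists_step_threshold (D : ℕ) (hD : 1 ≤ D) : ∃ h₀, 1 ≤ h₀ ∧ ∀ h, h₀ ≤ h →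
    7 * D ≤ 2 ^ h ∧ (2 * (D * h + 1) + 1 + h) * (D * h + 2) ≤ 2 ^ (h - 1) := by
  have ht := tendsto_pow_const_div_const_pow_of_one_lt 2 (show (1 : ℝ) < 2 by norm_num)
  -- The factor is `36 = 2 * 6 * 3`, from bounding the two factors by `6 * (D * h)` and `3 * (D *
  -- h)` and halving the power of two.
  have hpos : (0 : ℝ) < 1 / (36 * (D : ℝ) ^ 2) := by positivity
  obtain ⟨N, hN⟩ := Filter.eventually_atTop.1 (ht.eventually_lt_const hpos)
  refine ⟨N + 1, by omega, fun h hh => ?_⟩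
  have h1 := hN h (by omega)
  have hD' : (1 : ℝ) ≤ D := by exact_mod_cast hD
  rw [div_lt_div_iff₀ (by positivity) (by positivity), one_mul] at h1
  have h2 : h ^ 2 * (36 * D ^ 2) ≤ 2 ^ h := by exact_mod_cast h1.le
  have hh1 : 1 ≤ h := by omega
  have hDh : 1 ≤ D * h := Nat.mul_pos hD hh1
  have hle : h ≤ D * h := Nat.le_mul_of_pos_left h hD
  constructor
  · nlinarith [Nat.mul_le_mul hD (Nat.mul_le_mul hDh hDh)]
  · have h3 : 2 ^ h = 2 * 2 ^ (h - 1) := by rw [← pow_succ']; congr 1; omega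
    have h4 : (2 * (D * h + 1) + 1 + h) * (D * h + 2) ≤ (6 * (D * h)) * (3 * (D * h)) :=
      Nat.mul_le_mul (by omega) (by omega)
    have h5 : 2 * ((6 * (D * h)) * (3 * (D * h))) = h ^ 2 * (36 * D ^ 2) := by ring
    omega

/-- Since `w = O(β)`, an overhead of `O(w)` bits per block is `O(1)` bits per entry. -/
theorem div_add_one_mul_le {N β w E c : ℕ} (hw : w ≤ E * β) :
    (N / β + 1) * (5 * w + c * β) ≤ (N + β) * (5 * E + c) := by
  calc (N / β + 1) * (5 * w + c * β) ≤ (N / β + 1) * (5 * (E * β) + c * β) :=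
        Nat.mul_le_mul_left _ (by omega)
    _ = (N / β * β + β) * (5 * E + c) := by ring
    _ ≤ _ := Nat.mul_le_mul_right _ (Nat.add_le_add_right (Nat.div_mul_le_self _ _) _)

/-- The dictionary fits into the address space when it consists of monotone arrays only. -/
theorem direct_space_le {w m n β : ℕ} (hw : 1000 ≤ w) (hm : m < 2 ^ w) (hn : n ≤ m)
    (hβ : 100 ≤ β) (hβw : β ≤ w / 8) :
    15 * w + w * (4 ^ β * β) + ((n / β + 1) * (5 * w + 2 * (β * (0 + 2))) + 2 * (m / 2 ^ 0)) +
      2 * ((m / β + 1) * (5 * w + 4 * β) + 2 * n) ≤ w * 2 ^ w := by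
  have hpat : 4 ^ β * β * 8 ≤ 2 ^ w := by
    have h1 : β ≤ 2 ^ β := Nat.lt_two_pow_self.le
    calc 4 ^ β * β * 8 ≤ 4 ^ β * 2 ^ β * 8 :=
          Nat.mul_le_mul_right _ (Nat.mul_le_mul_left _ h1)
      _ = 2 ^ (3 * β + 3) := by
          rw [show (4 : ℕ) = 2 ^ 2 by norm_num, ← pow_mul, ← pow_add,
            show (8 : ℕ) = 2 ^ 3 by norm_num, ← pow_add]
          congr 1; ring
      _ ≤ 2 ^ w := Nat.pow_le_pow_right (by norm_num) (by omega)
  have hblock : ∀ N ≤ 2 ^ w, 100 * ((N / β + 1) * (5 * w + 4 * β)) ≤ 6 * (w * 2 ^ w) + 600 * w := by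
    intro N hN
    have h1 : N / β ≤ 2 ^ w / 100 := Nat.div_le_div hN hβ (by norm_num)
    have h2 : 5 * w + 4 * β ≤ 6 * w := by omega
    calc 100 * ((N / β + 1) * (5 * w + 4 * β)) ≤ 100 * ((2 ^ w / 100 + 1) * (6 * w)) :=
          Nat.mul_le_mul_left _ (Nat.mul_le_mul (by omega) h2)
      _ = 6 * w * (2 ^ w / 100 * 100) + 600 * w := by ring
      _ ≤ 6 * w * 2 ^ w + 600 * w :=
          Nat.add_le_add_right (Nat.mul_le_mul_left _ (Nat.div_mul_le_self _ _)) _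
      _ = _ := by ring
  have b1 := hblock n (by omega)
  have b2 := hblock m hm.le
  have b3 : w * (4 ^ β * β) * 8 ≤ w * 2 ^ w := by
    rw [mul_assoc]; exact Nat.mul_le_mul_left _ hpat
  have b4 : 1000 * 2 ^ w ≤ w * 2 ^ w := Nat.mul_le_mul_right _ hw
  have b5 : w < 2 ^ w := Nat.lt_two_pow_self
  have b6 : w * 1000 ≤ w * 2 ^ w := Nat.mul_le_mul_left _ (by omega)
  rw [pow_zero, Nat.div_one, show 2 * (β * (0 + 2)) = 4 * β by ring]
  generalize w * 2 ^ w = P at *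
  generalize 2 ^ w = W at *
  generalize (n / β + 1) * (5 * w + 4 * β) = x at *
  generalize (m / β + 1) * (5 * w + 4 * β) = y at *
  generalize w * (4 ^ β * β) = z at *
  omega

/-! ### Comparison of all parts with `n * 2 ^ (8 * h) + 2 ^ (4 * a)`. -/

section Accounting

variable {m n w K D a h β : ℕ}

/-- The pattern table costs `w * 4 ^ β * β` bits; the three factors are of order `2 ^ a`, `2 ^ (2 *
a)` and `2 ^ a`, hence the exponent `4 * a`. The array for `select_1` costs `O(n (lam + 1))` bits up
to `β`-terms, where `lam = log (m / n)` is `O(h + 1)`. -/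
theorem common_space_le (hD : 1 ≤ D) (ha : a = Nat.log 2 m / D)
    (hh : h = Nat.log 2 (m / n) / (D + 8)) (hβ : β = a + 100) (hn : 1 ≤ n) (hnm : n ≤ m)
    (hw : w ≤ K * (Nat.log 2 m + 1)) :
    15 * w + w * (4 ^ β * β) +
      ((n / β + 1) * (5 * w + 2 * (β * (Nat.log 2 (m / n) + 2))) +
        2 * (m / 2 ^ Nat.log 2 (m / n))) ≤
      (15 * (K * D) + K * D * 100 * 4 ^ 100 + 101 * (5 * (K * D) + 4) + 2 * (D + 8) + 200 * D + 4) *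
        (n * 2 ^ (8 * h) + 2 ^ (4 * a)) := by
  set ℓ := Nat.log 2 m with hℓ
  set lam := Nat.log 2 (m / n) with hlam
  set E := K * D with hE
  have hmn : 1 ≤ m / n := Nat.div_pos hnm hn
  have ha1 : a + 1 ≤ 2 ^ a := Nat.lt_two_pow_self
  have hℓa : ℓ + 1 ≤ D * (a + 1) := by
    rw [ha]; exact Nat.lt_mul_div_succ ℓ hD
  have hwa : w ≤ E * (a + 1) := by
    rw [hE, mul_assoc]; exact hw.trans (Nat.mul_le_mul_left _ hℓa)
  have hwβ : w ≤ E * β := hwa.trans (Nat.mul_le_mul_left _ (by omega))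
  have hlamℓ : lam ≤ ℓ := Nat.log_mono_right (Nat.div_le_self _ _)
  have hlamh : lam ≤ (D + 8) * (h + 1) := by
    rw [hh]; exact (Nat.lt_mul_div_succ lam (by omega)).le
  have hq : 2 ^ (4 * a) = 2 ^ a * 2 ^ a * (2 ^ a * 2 ^ a) := by
    rw [← pow_add, ← pow_add]; congr 1; ring
  have hH : h + 1 ≤ 2 ^ (8 * h) :=
    (show h + 1 ≤ 2 ^ h from Nat.lt_two_pow_self).trans
      (Nat.pow_le_pow_right (by norm_num) (by omega))
  have h4β : 4 ^ β = 4 ^ 100 * (2 ^ a * 2 ^ a) := by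
    rw [hβ, pow_add, mul_comm, ← mul_pow, show 2 * 2 = 4 from rfl]
  have hβq : β ≤ 100 * 2 ^ a := by omega
  have hm2 : m / 2 ^ lam ≤ 2 * n := by
    refine Nat.div_le_of_le_mul ?_
    have h1 : m / n < 2 ^ (lam + 1) := Nat.lt_pow_succ_log_self (by norm_num) _
    have h2 := (Nat.div_lt_iff_lt_mul hn).1 h1
    calc m ≤ 2 ^ (lam + 1) * n := h2.le
      _ = 2 ^ lam * (2 * n) := by ring
  have hblock := div_add_one_mul_le (N := n) (c := 2 * (lam + 2)) (β := β) hwβ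
  rw [show 2 * (lam + 2) * β = 2 * (β * (lam + 2)) by ring] at hblock
  rw [h4β]
  generalize (4 : ℕ) ^ 100 = c100 at *
  rw [hq]
  set q := 2 ^ a with hqdef
  have hq1 : 1 ≤ q := Nat.one_le_two_pow
  have hqq : 1 ≤ q * q := Nat.mul_pos hq1 hq1
  set X := 2 ^ (8 * h) with hX
  have hX1 : 1 ≤ X := Nat.one_le_two_pow
  set Q := n * X + q * q * (q * q) with hQ
  have hnX : n * X ≤ Q := Nat.le_add_right _ _
  have hq4 : q * q * (q * q) ≤ Q := Nat.le_add_left _ _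
  have hq2 : q * q ≤ Q := (Nat.le_mul_of_pos_right _ hqq).trans hq4
  have hqQ : q ≤ Q := (Nat.le_mul_of_pos_right _ hq1).trans hq2
  have hnQ : n ≤ Q := (Nat.le_mul_of_pos_right _ hX1).trans hnX
  have b0 : w ≤ E * Q := hwa.trans (Nat.mul_le_mul_left _ (ha1.trans hqQ))
  have b1 : w * (c100 * (q * q) * β) ≤ E * 100 * c100 * Q := by
    calc w * (c100 * (q * q) * β) ≤ (E * q) * (c100 * (q * q) * (100 * q)) :=
          Nat.mul_le_mul (hwa.trans (Nat.mul_le_mul_left _ ha1)) (Nat.mul_le_mul_left _ hβq)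
      _ = E * 100 * c100 * (q * q * (q * q)) := by ring
      _ ≤ _ := Nat.mul_le_mul_left _ hq4
  have b2 : (n + β) * (5 * E + 4) ≤ 101 * (5 * E + 4) * Q := by
    calc (n + β) * (5 * E + 4) ≤ (101 * Q) * (5 * E + 4) := Nat.mul_le_mul_right _ (by omega)
      _ = _ := by ring
  have b3 : 2 * (n * lam) ≤ 2 * (D + 8) * Q := by
    calc 2 * (n * lam) ≤ 2 * (n * ((D + 8) * X)) := Nat.mul_le_mul_left _ (Nat.mul_le_mul_left _
          (hlamh.trans (Nat.mul_le_mul_left _ hH)))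
      _ = 2 * (D + 8) * (n * X) := by ring
      _ ≤ _ := Nat.mul_le_mul_left _ hnX
  have b4 : 2 * (β * lam) ≤ 200 * D * Q := by
    calc 2 * (β * lam) ≤ 2 * ((100 * q) * (D * q)) := Nat.mul_le_mul_left _ (Nat.mul_le_mul hβq
          (hlamℓ.trans ((Nat.le_succ _).trans (hℓa.trans (Nat.mul_le_mul_left _ ha1)))))
      _ = 200 * D * (q * q) := by ring
      _ ≤ _ := Nat.mul_le_mul_left _ hq2
  have b5 : (n + β) * (5 * E + 2 * (lam + 2)) =
      (n + β) * (5 * E + 4) + 2 * (n * lam) + 2 * (β * lam) := by ring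
  rw [b5] at hblock
  calc _ ≤ 15 * (E * Q) + E * 100 * c100 * Q +
        ((101 * (5 * E + 4) * Q + 2 * (D + 8) * Q + 200 * D * Q) + 2 * (2 * Q)) := by omega
    _ = _ := by ring

/-- As `m / n < 2 ^ ((D + 8) * (h + 1))`, there are `O(n * 2 ^ (8 * h))` windows. The cells use `n *
2 ^ (4 * h)` times `O(h)` bits, and `h ≤ 2 ^ (4 * h)`. -/
theorem structured_space_le (hD : 1 ≤ D) (ha : a = Nat.log 2 m / D)
    (hh : h = Nat.log 2 (m / n) / (D + 8)) (hβ : β = a + 100) (hn : 1 ≤ n)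
    (hw : w ≤ K * (Nat.log 2 m + 1)) :
    ((m / 2 ^ (D * h) + 1) / β + 1) * (5 * w + 4 * β) + (n / β + 1) * (5 * w + 4 * β) + 4 * n +
        2 * ((D + 6) * h) * (n * 2 ^ (4 * h)) + w ≤
      ((2 ^ (D + 8) + 202) * (5 * (K * D) + 4) + 4 + 2 * (D + 6) + K * D) *
        (n * 2 ^ (8 * h) + 2 ^ (4 * a)) := by
  set ℓ := Nat.log 2 m with hℓ
  set lam := Nat.log 2 (m / n) with hlam
  set E := K * D with hE
  have ha1 : a + 1 ≤ 2 ^ a := Nat.lt_two_pow_self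
  have hℓa : ℓ + 1 ≤ D * (a + 1) := by
    rw [ha]; exact Nat.lt_mul_div_succ ℓ hD
  have hwa : w ≤ E * (a + 1) := by
    rw [hE, mul_assoc]; exact hw.trans (Nat.mul_le_mul_left _ hℓa)
  have hwβ : w ≤ E * β := hwa.trans (Nat.mul_le_mul_left _ (by omega))
  have hlamh : lam + 1 ≤ (D + 8) * (h + 1) := by
    rw [hh]; exact Nat.lt_mul_div_succ lam (by omega)
  have h2a : 2 ^ a ≤ 2 ^ (4 * a) := Nat.pow_le_pow_right (by norm_num) (by omega)
  have hm2 : m / 2 ^ (D * h) ≤ 2 ^ (D + 8) * (n * 2 ^ (8 * h)) := by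
    refine Nat.div_le_of_le_mul ?_
    have h1 : m / n < 2 ^ (lam + 1) := Nat.lt_pow_succ_log_self (by norm_num) _
    have h2 := (Nat.div_lt_iff_lt_mul hn).1 h1
    calc m ≤ 2 ^ (lam + 1) * n := h2.le
      _ ≤ 2 ^ ((D + 8) * (h + 1)) * n :=
          Nat.mul_le_mul_right _ (Nat.pow_le_pow_right (by norm_num) hlamh)
      _ = 2 ^ (D * h) * (2 ^ (D + 8) * (n * 2 ^ (8 * h))) := by
          rw [show (D + 8) * (h + 1) = D * h + (D + 8) + 8 * h by ring, pow_add, pow_add]; ring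
  have hf : h * 2 ^ (4 * h) ≤ 2 ^ (8 * h) := by
    rw [show 8 * h = 4 * h + 4 * h by ring, pow_add]
    exact Nat.mul_le_mul_right _ ((show h ≤ 2 ^ h from Nat.lt_two_pow_self.le).trans
      (Nat.pow_le_pow_right (by norm_num) (by omega)))
  have c1 := div_add_one_mul_le (N := m / 2 ^ (D * h) + 1) (c := 4) (β := β) hwβ
  have c2 := div_add_one_mul_le (N := n) (c := 4) (β := β) hwβ
  set X := 2 ^ (8 * h) with hX
  have hX1 : 1 ≤ X := Nat.one_le_two_pow
  set Q := n * X + 2 ^ (4 * a) with hQ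
  have hnX : n * X ≤ Q := Nat.le_add_right _ _
  have hqQ : 2 ^ a ≤ Q := h2a.trans (Nat.le_add_left _ _)
  have hnQ : n ≤ Q := (Nat.le_mul_of_pos_right _ hX1).trans hnX
  have b0 : w ≤ E * Q := hwa.trans (Nat.mul_le_mul_left _ (ha1.trans hqQ))
  have b1 : m / 2 ^ (D * h) ≤ 2 ^ (D + 8) * Q := hm2.trans (Nat.mul_le_mul_left _ hnX)
  have b2 : (m / 2 ^ (D * h) + 1 + β) * (5 * E + 4) ≤ (2 ^ (D + 8) * Q + 101 * Q) * (5 * E + 4) :=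
    Nat.mul_le_mul_right _ (by omega)
  have b3 : (n + β) * (5 * E + 4) ≤ (101 * Q) * (5 * E + 4) := Nat.mul_le_mul_right _ (by omega)
  have b4 : 2 * ((D + 6) * h) * (n * 2 ^ (4 * h)) ≤ 2 * (D + 6) * Q := by
    calc 2 * ((D + 6) * h) * (n * 2 ^ (4 * h)) = 2 * (D + 6) * (n * (h * 2 ^ (4 * h))) := by ring
      _ ≤ 2 * (D + 6) * (n * X) := Nat.mul_le_mul_left _ (Nat.mul_le_mul_left _ hf)
      _ ≤ _ := Nat.mul_le_mul_left _ hnX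
  calc _ ≤ (2 ^ (D + 8) * Q + 101 * Q) * (5 * E + 4) + (101 * Q) * (5 * E + 4) + 4 * Q +
        2 * (D + 6) * Q + E * Q := by omega
    _ = _ := by ring

theorem dense_space_le {h₀ : ℕ} (hD : 1 ≤ D) (ha : a = Nat.log 2 m / D)
    (hh : h = Nat.log 2 (m / n) / (D + 8)) (hh₀ : h < h₀) (hβ : β = a + 100) (hn : 1 ≤ n)
    (hw : w ≤ K * (Nat.log 2 m + 1)) :
    (m / β + 1) * (5 * w + 4 * β) + 2 * n ≤
      ((2 ^ ((D + 8) * h₀) + 100) * (5 * (K * D) + 4) + 2) * (n * 2 ^ (8 * h) + 2 ^ (4 * a)) := by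
  set E := K * D with hE
  have ha1 : a + 1 ≤ 2 ^ a := Nat.lt_two_pow_self
  have hℓa : Nat.log 2 m + 1 ≤ D * (a + 1) := by
    rw [ha]; exact Nat.lt_mul_div_succ _ hD
  have hwβ : w ≤ E * β := by
    rw [hE, mul_assoc]
    exact hw.trans (Nat.mul_le_mul_left _ (hℓa.trans (Nat.mul_le_mul_left _ (by omega))))
  have hlamh : Nat.log 2 (m / n) + 1 ≤ (D + 8) * h₀ := by
    refine le_trans ?_ (Nat.mul_le_mul_left _ hh₀)
    rw [hh]; exact Nat.lt_mul_div_succ _ (by omega)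
  have h2a : 2 ^ a ≤ 2 ^ (4 * a) := Nat.pow_le_pow_right (by norm_num) (by omega)
  have hm2 : m ≤ 2 ^ ((D + 8) * h₀) * n := by
    have h1 : m / n < 2 ^ (Nat.log 2 (m / n) + 1) := Nat.lt_pow_succ_log_self (by norm_num) _
    have h2 := (Nat.div_lt_iff_lt_mul hn).1 h1
    exact h2.le.trans (Nat.mul_le_mul_right _ (Nat.pow_le_pow_right (by norm_num) hlamh))
  have c1 := div_add_one_mul_le (N := m) (c := 4) (β := β) hwβ
  set X := 2 ^ (8 * h) with hX
  have hX1 : 1 ≤ X := Nat.one_le_two_pow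
  set Q := n * X + 2 ^ (4 * a) with hQ
  have hnQ : n ≤ Q := (Nat.le_mul_of_pos_right _ hX1).trans (Nat.le_add_right _ _)
  have hqQ : 2 ^ a ≤ Q := h2a.trans (Nat.le_add_left _ _)
  have b1 : m ≤ 2 ^ ((D + 8) * h₀) * Q := hm2.trans (Nat.mul_le_mul_left _ hnQ)
  have b2 : (m + β) * (5 * E + 4) ≤ (2 ^ ((D + 8) * h₀) * Q + 100 * Q) * (5 * E + 4) :=
    Nat.mul_le_mul_right _ (by omega)
  calc _ ≤ (2 ^ ((D + 8) * h₀) * Q + 100 * Q) * (5 * E + 4) + 2 * Q := by omega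
    _ = _ := by ring

end Accounting

/-- Four regimes: `w ≤ t`, bits stored verbatim; `t < w < 2 * C₁`, direct storage, all sizes being
bounded; `h < h₀`, direct storage with `m / n` bounded; otherwise the structured representation. -/
theorem exists_fid (e t K : ℕ) (he : 6 ≤ e) (ht : 1000 ≤ t) : ∃ C : ℕ,
    ∀ (m n w : ℕ) (S : Fin m → Bool), 1 ≤ n → numOnes S = n → Nat.log 2 m + 1 ≤ w →
      w ≤ K * (Nat.log 2 m + 1) → ∃ M : List (BitVec w),
        w * M.length ≤ C * (n * 2 ^ (8 * (Nat.log 2 (m / n) / (2 ^ e + 8))) +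
          2 ^ (4 * (Nat.log 2 m / 2 ^ e))) ∧
        IsFID (queryPrograms e t) M S (20 * 2 ^ t + 2000 + 200 * e) := by
  obtain ⟨h₀, hh₀, hthr⟩ := exists_step_threshold (2 ^ e) Nat.one_le_two_pow
  have hD64 : 64 ≤ 2 ^ e := by
    calc 64 = 2 ^ 6 := by norm_num
      _ ≤ 2 ^ e := Nat.pow_le_pow_right (by norm_num) he
  set D := 2 ^ e with hD
  set Cc := 15 * (K * D) + K * D * 100 * 4 ^ 100 + 101 * (5 * (K * D) + 4) + 2 * (D + 8) +
    200 * D + 4 with hCc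
  set Cs := (2 ^ (D + 8) + 202) * (5 * (K * D) + 4) + 4 + 2 * (D + 6) + K * D with hCs
  set Cd := (2 ^ ((D + 8) * h₀) + 100) * (5 * (K * D) + 4) + 2 with hCd
  clear_value Cc Cs Cd
  set C₁ := Cc + 2 * Cs + 2 * Cd with hC₁
  refine ⟨C₁ + 2 * C₁ * 2 ^ (2 * C₁) + t * 2 ^ t, ?_⟩
  intro m n w S hn hS hw hwK
  obtain ⟨a, ha⟩ : ∃ a, a = Nat.log 2 m / D := ⟨_, rfl⟩
  obtain ⟨h, hh⟩ : ∃ h, h = Nat.log 2 (m / n) / (D + 8) := ⟨_, rfl⟩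
  rw [← ha, ← hh]
  set lam := Nat.log 2 (m / n) with hlam
  set Q := n * 2 ^ (8 * h) + 2 ^ (4 * a) with hQ
  have hQ1 : 1 ≤ Q := by
    have := Nat.one_le_two_pow (n := 4 * a)
    omega
  have hm : m < 2 ^ w := lt_of_lt_of_le (Nat.lt_pow_succ_log_self (by norm_num) m)
    (Nat.pow_le_pow_right (by norm_num) hw)
  have hnm : n ≤ m := by
    have := bitRank_false_add_true S le_rfl
    rw [bitRank_full, hS] at this
    omega
  have hm0 : m ≠ 0 := by omega
  rw [show (C₁ + 2 * C₁ * 2 ^ (2 * C₁) + t * 2 ^ t) * Q =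
    C₁ * Q + 2 * C₁ * 2 ^ (2 * C₁) * Q + t * 2 ^ t * Q by ring]
  rcases le_or_gt w t with hwt | hwt
  · refine ⟨bitWords w S, ?_, isFID_bitWords hm hwt⟩
    have h1 : w * (bitWords w S).length ≤ t * 2 ^ t := by
      simp only [bitWords, List.length_ofFn]
      exact Nat.mul_le_mul hwt (hm.le.trans (Nat.pow_le_pow_right (by norm_num) hwt))
    have h2 : t * 2 ^ t ≤ t * 2 ^ t * Q := Nat.le_mul_of_pos_right _ hQ1
    omega
  obtain ⟨β, hβ⟩ : ∃ β, β = a + 100 := ⟨_, rfl⟩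
  have hn2 : n < 2 ^ w := by omega
  have ha64 : a ≤ Nat.log 2 m / 64 := ha ▸ Nat.div_le_div_left hD64 (by norm_num)
  -- Here `a ≤ w / 64` and `w > 1000` leave room for the summand `100` of `β`.
  have hβw : β ≤ w / 8 := by omega
  have hβw' : β < 2 ^ w := by
    have : w < 2 ^ w := Nat.lt_two_pow_self
    omega
  have hdir : ∀ F : ℕ → ℕ, Monotone F → (∀ i, F i ≤ n) → ∀ (A : ℕ) (row : (ℕ → ℕ) → ℕ),
      ∃ hdr body, Represents w β e A m row F hdr body ∧
        w * body.length ≤ (m / β + 1) * (5 * w + 4 * β) + 2 * n := by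
    intro F hF hFn A row
    refine ⟨_, _, represents_direct (by omega) (by omega) hm hn2 hF hFn, ?_⟩
    have := length_monoArray_le (w := w) (β := β) (N := m) (A := A) (row := row) (by omega)
      (by omega) hn2 hF hFn 0
    rw [pow_zero, Nat.div_one, show 2 * (β * (0 + 2)) = 4 * β by ring] at this
    exact this
  have hcommon := common_space_le (K := K) (by omega) ha hh hβ hn hnm hwK
  rw [← hCc, ← hlam, ← hQ] at hcommon
  -- For `w ≥ 2 * C₁` the bound `C₁ * Q ≤ 2 * C₁ * m` implies that all addresses fit into a word.
  -- For smaller `w` this follows from the explicit estimate `direct_space_le`.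
  rcases lt_or_ge w (2 * C₁) with hwC | hwC
  · obtain ⟨l, hl, hfid⟩ := exists_memory hm hwt (by omega) (by omega) hβw' hS 0 hdir
    have hsp := hl.trans (direct_space_le (by omega) hm hnm (by omega) hβw)
    refine ⟨l.map (BitVec.ofNat w), ?_, hfid (Nat.le_of_mul_le_mul_left hsp (by omega))⟩
    rw [List.length_map]
    have h1 : w * 2 ^ w ≤ 2 * C₁ * 2 ^ (2 * C₁) :=
      Nat.mul_le_mul hwC.le (Nat.pow_le_pow_right (by norm_num) hwC.le)
    have h2 : 2 * C₁ * 2 ^ (2 * C₁) ≤ 2 * C₁ * 2 ^ (2 * C₁) * Q := Nat.le_mul_of_pos_right _ hQ1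
    omega
  have hlam2 : n * 2 ^ lam ≤ m := by
    have h1 : 2 ^ lam ≤ m / n :=
      Nat.pow_log_le_self 2 (Nat.div_pos hnm hn).ne'
    calc n * 2 ^ lam ≤ n * (m / n) := Nat.mul_le_mul_left _ h1
      _ ≤ m := Nat.mul_div_le _ _
  have hDh : (D + 8) * h ≤ lam := hh ▸ Nat.mul_div_le _ _
  have hDh' : (D + 8) * h = D * h + 8 * h := by ring
  have hQm : Q ≤ 2 * m := by
    have h1 : n * 2 ^ (8 * h) ≤ m :=
      (Nat.mul_le_mul_left _ (Nat.pow_le_pow_right (by norm_num) (by omega))).trans hlam2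
    have h2 : 2 ^ (4 * a) ≤ m := by
      refine le_trans (Nat.pow_le_pow_right (by norm_num) ?_) (Nat.pow_log_le_self 2 hm0)
      calc 4 * a ≤ D * a := Nat.mul_le_mul_right _ (by omega)
        _ ≤ _ := ha ▸ Nat.mul_div_le _ _
    omega
  have hfits : ∀ l : List ℕ, w * l.length ≤ C₁ * Q → l.length ≤ 2 ^ w := by
    intro l hl
    refine Nat.le_of_mul_le_mul_left (c := w) ?_ (by omega)
    calc w * l.length ≤ C₁ * Q := hl
      _ ≤ C₁ * (2 * 2 ^ w) := Nat.mul_le_mul_left _ (by omega)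
      _ = 2 * C₁ * 2 ^ w := by ring
      _ ≤ w * 2 ^ w := Nat.mul_le_mul_right _ hwC
  have hC₁Q : C₁ * Q = Cc * Q + 2 * (Cs * Q) + 2 * (Cd * Q) := by rw [hC₁]; ring
  rcases lt_or_ge h h₀ with hlt | hge
  · obtain ⟨l, hl, hfid⟩ := exists_memory hm hwt (by omega) (by omega) hβw' hS lam hdir
    have hsp := dense_space_le (K := K) (by omega) ha hh hlt hβ hn hwK
    rw [← hCd, ← hQ] at hsp
    have htot : w * l.length ≤ C₁ * Q := by omega
    exact ⟨l.map (BitVec.ofNat w), by rw [List.length_map]; omega, hfid (hfits l htot)⟩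
  · obtain ⟨ht1, ht2⟩ := hthr h hge
    have hlamw : lam < w := by
      have : lam ≤ Nat.log 2 m := Nat.log_mono_right (Nat.div_le_self _ _)
      omega
    have hnG : n * 2 ^ (4 * h) < 2 ^ w :=
      ((Nat.mul_le_mul_left _ (Nat.pow_le_pow_right (by norm_num) (by omega))).trans
        hlam2).trans_lt hm
    have hfw : (2 ^ e + 6) * h < w := by
      rw [← hD, add_mul]; omega
    obtain ⟨l, hl, hfid⟩ := exists_memory hm hwt (by omega) (by omega) hβw' hS lam
      (fun F hF hFn A row => exists_structured (e := e) (A := A) (row := row) (show 4 ≤ β by omega)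
        hm hF hFn (by omega) ht1 ht2 hnG hfw)
    have hsp := structured_space_le (K := K) (by omega) ha hh hβ hn hwK
    rw [← hCs, ← hQ] at hsp
    rw [← hD] at hl
    have htot : w * l.length ≤ C₁ * Q := by omega
    exact ⟨l.map (BitVec.ofNat w), by rw [List.length_map]; omega, hfid (hfits l htot)⟩

/-! ## The bound in real numbers -/

/-- With `D * δ ≥ 8`, the two powers of two are at most `(m/n)^δ` and `m^δ`. The latter is at most
`n (m/n)^δ` because `δ ≤ 1`, which is why `ε` is truncated at `1`. -/
theorem budget_le {m n D : ℕ} {ε δ : ℝ} (hδ : 0 < δ) (hδ1 : δ ≤ 1) (hδε : δ ≤ ε)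
    (hD : 8 ≤ D * δ) (hn : 1 ≤ n) (hnm : n ≤ m) :
    ((n * 2 ^ (8 * (Nat.log 2 (m / n) / (D + 8))) + 2 ^ (4 * (Nat.log 2 m / D)) : ℕ) : ℝ) ≤
      2 * ((n : ℝ) * ((m : ℝ) / n) ^ ε) := by
  have hn0 : (0 : ℝ) < n := by exact_mod_cast hn
  have hm0 : (0 : ℝ) < m := by exact_mod_cast (by omega : 0 < m)
  have hu1 : (1 : ℝ) ≤ (m : ℝ) / n := by
    rw [le_div_iff₀ hn0, one_mul]; exact_mod_cast hnm
  have hε : ((m : ℝ) / n) ^ δ ≤ ((m : ℝ) / n) ^ ε := Real.rpow_le_rpow_of_exponent_le hu1 hδε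
  have key : ∀ (x : ℝ) (k j : ℕ), (2 : ℝ) ^ k ≤ x → (j : ℝ) ≤ k * δ → (2 : ℝ) ^ j ≤ x ^ δ := by
    intro x k j hx hj
    calc (2 : ℝ) ^ j = (2 : ℝ) ^ (j : ℝ) := (Real.rpow_natCast _ _).symm
      _ ≤ (2 : ℝ) ^ ((k : ℝ) * δ) := Real.rpow_le_rpow_of_exponent_le (by norm_num) hj
      _ = ((2 : ℝ) ^ k) ^ δ := by rw [Real.rpow_mul (by norm_num), Real.rpow_natCast]
      _ ≤ x ^ δ := Real.rpow_le_rpow (by positivity) hx hδ.le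
  have hscale : ∀ x k : ℕ, D * x ≤ k → (8 : ℝ) * x ≤ k * δ := by
    intro x k hx
    have h1 : (D : ℝ) * x ≤ k := by exact_mod_cast hx
    have h2 : (0 : ℝ) ≤ x := Nat.cast_nonneg x
    nlinarith
  have b1 : (2 : ℝ) ^ (8 * (Nat.log 2 (m / n) / (D + 8))) ≤ ((m : ℝ) / n) ^ δ := by
    refine key _ (Nat.log 2 (m / n)) _ ?_ ?_
    · have h1 : 2 ^ Nat.log 2 (m / n) ≤ m / n :=
        Nat.pow_log_le_self 2 (Nat.div_pos hnm hn).ne'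
      calc (2 : ℝ) ^ Nat.log 2 (m / n) ≤ ((m / n : ℕ) : ℝ) := by exact_mod_cast h1
        _ ≤ _ := Nat.cast_div_le
    · push_cast
      exact hscale _ _ ((Nat.mul_le_mul_right _ (Nat.le_add_right D 8)).trans (Nat.mul_div_le _ _))
  have b2 : (2 : ℝ) ^ (4 * (Nat.log 2 m / D)) ≤ (m : ℝ) ^ δ := by
    refine key _ (Nat.log 2 m) _ ?_ ?_
    · exact_mod_cast Nat.pow_log_le_self 2 (by omega : m ≠ 0)
    · have := hscale _ _ (Nat.mul_div_le (Nat.log 2 m) D)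
      have h2 : (0 : ℝ) ≤ ((Nat.log 2 m / D : ℕ) : ℝ) := Nat.cast_nonneg _
      push_cast at this ⊢
      linarith
  have b3 : (m : ℝ) ^ δ ≤ n * ((m : ℝ) / n) ^ δ := by
    rw [Real.div_rpow hm0.le hn0.le, ← mul_div_assoc, le_div_iff₀ (by positivity), mul_comm]
    refine mul_le_mul_of_nonneg_right ?_ (by positivity)
    calc (n : ℝ) ^ δ ≤ (n : ℝ) ^ (1 : ℝ) :=
          Real.rpow_le_rpow_of_exponent_le (by exact_mod_cast hn) hδ1
      _ = n := Real.rpow_one _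
  push_cast
  have b4 := mul_le_mul_of_nonneg_left (b1.trans hε) hn0.le
  have b5 := mul_le_mul_of_nonneg_left hε hn0.le
  linarith

/-- The choice is `e = 6 + ⌈log₂(8/δ)⌉` with `δ = min ε 1`, the `6` serving `exists_fid`; then `e ≤
10 + 2 x ≤ 12 x` for `x = max 1 (log (1/ε))`. -/
theorem exists_rounds : ∀ ε : ℝ, 0 < ε → ∃ e : ℕ, 6 ≤ e ∧ 8 ≤ ((2 ^ e : ℕ) : ℝ) * min ε 1 ∧
    (e : ℝ) ≤ 12 * max 1 (Real.log (1 / ε)) := by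
  intro ε hε
  set δ := min ε 1 with hδ
  have hδ0 : 0 < δ := lt_min hε one_pos
  have hδ1 : δ ≤ 1 := min_le_right _ _
  have h8 : 1 ≤ 8 / δ := by rw [le_div_iff₀ hδ0]; linarith
  refine ⟨6 + ⌈Real.logb 2 (8 / δ)⌉₊, by omega, ?_, ?_⟩
  · have h1 : 8 / δ ≤ (2 : ℝ) ^ ⌈Real.logb 2 (8 / δ)⌉₊ := by
      calc 8 / δ = (2 : ℝ) ^ Real.logb 2 (8 / δ) :=
            (Real.rpow_logb (by norm_num) (by norm_num) (by positivity)).symm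
        _ ≤ (2 : ℝ) ^ ((⌈Real.logb 2 (8 / δ)⌉₊ : ℕ) : ℝ) :=
            Real.rpow_le_rpow_of_exponent_le (by norm_num) (Nat.le_ceil _)
        _ = _ := Real.rpow_natCast _ _
    rw [div_le_iff₀ hδ0] at h1
    push_cast
    rw [pow_add]
    have h2 : (0 : ℝ) ≤ (2 : ℝ) ^ ⌈Real.logb 2 (8 / δ)⌉₊ * δ := by positivity
    nlinarith
  · set x := max 1 (Real.log (1 / ε)) with hx
    have hx1 : 1 ≤ x := le_max_left _ _
    have hlog : Real.log (1 / δ) ≤ x := by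
      rcases le_total ε 1 with h | h
      · rw [hδ, min_eq_left h]; exact le_max_right _ _
      · rw [hδ, min_eq_right h]; simp; linarith
    have hceil := Nat.ceil_lt_add_one (Real.logb_nonneg (show (1 : ℝ) < 2 by norm_num) h8)
    have hl2 : 0.69 < Real.log 2 := by linarith [Real.log_two_gt_d9]
    have hb : Real.logb 2 (8 / δ) ≤ 3 + 2 * x := by
      rw [Real.logb, div_le_iff₀ (by linarith), show (8 : ℝ) / δ = 2 ^ 3 * (1 / δ) by ring,
        Real.log_mul (by norm_num) (by positivity), Real.log_pow]
      push_cast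
      nlinarith
    push_cast
    linarith

end WordRAM

open WordRAM in
theorem corollary3p2 :
    ∃ Ct : ℝ, 0 < Ct ∧ ∀ (K : ℕ) (ε : ℝ), 0 < ε →
      ∃ (A : FIDPrograms) (T : ℕ) (Cs : ℝ),
        (T : ℝ) ≤ Ct * max 1 (Real.log (1 / ε)) ∧
        ∀ (m n w : ℕ) (S : Fin m → Bool),
          1 ≤ n → numOnes S = n →
          Nat.log 2 m + 1 ≤ w → w ≤ K * (Nat.log 2 m + 1) →
          ∃ M : List (BitVec w),
            (spaceBits M : ℝ) ≤
              (infoBound n m : ℝ) + Cs * ((n : ℝ) * ((m : ℝ) / (n : ℝ)) ^ ε) ∧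
            IsFID A M S T := by
  obtain ⟨t, ht⟩ : ∃ t : ℕ, 1000 ≤ t := ⟨1000, le_rfl⟩
  -- Each round costs `200` and there are at most `12 * max 1 (log (1/ε))` rounds, whence `2400`.
  refine ⟨20 * 2 ^ t + 2000 + 2400, by positivity, fun K ε hε => ?_⟩
  obtain ⟨e, he, hD, hlog⟩ := exists_rounds ε hε
  obtain ⟨C, hC⟩ := exists_fid e t K he ht
  refine ⟨queryPrograms e t, 20 * 2 ^ t + 2000 + 200 * e, 2 * C, ?_, ?_⟩
  · have hx1 : 1 ≤ max 1 (Real.log (1 / ε)) := le_max_left _ _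
    have hp : (0 : ℝ) ≤ 20 * 2 ^ t + 2000 := by positivity
    push_cast
    nlinarith [mul_le_mul_of_nonneg_left hx1 hp]
  · intro m n w S hn hS hw hwK
    obtain ⟨M, hM, hfid⟩ := hC m n w S hn hS hw hwK
    refine ⟨M, ?_, hfid⟩
    have hnm : n ≤ m := by
      have := bitRank_false_add_true S le_rfl
      rw [bitRank_full, hS] at this
      omega
    have hb := budget_le (lt_min hε one_pos) (min_le_right ε 1) (min_le_left ε 1) hD hn hnm
    have h1 : (spaceBits M : ℝ) ≤ C * ((n * 2 ^ (8 * (Nat.log 2 (m / n) / (2 ^ e + 8))) +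
        2 ^ (4 * (Nat.log 2 m / 2 ^ e)) : ℕ) : ℝ) := by
      rw [spaceBits]; exact_mod_cast hM
    have h2 := mul_le_mul_of_nonneg_left hb (Nat.cast_nonneg (α := ℝ) C)
    -- Only the nonnegativity of the information bound enters; the redundancy term pays for
    -- everything.
    have h3 : (0 : ℝ) ≤ infoBound n m := Nat.cast_nonneg _
    linarith
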